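/- Let $q\ge r$, $v_x,v_y>0$. For $\Theta\in\mathbb R^{r\times q}$ let $X\mid\Theta\sim N_{r\times q}(\Theta,v_xI_r\otimes I_q)$ and $Y\mid\Theta\sim N_{r\times q}(\Theta,v_yI_r\otimes I_q)$ be independent, with densities $p(X\mid\Theta)$ and $p(Y\mid\Theta)$. A predictive density is a jointly measurable $\hat p(Y\mid X)\ge 0$ with $\int\hat p(Y\mid X)\,dY=1$ for all $X$; its Kullback–Leibler risk is $$R_{KL}(\Theta,\hat p)=\int p(X\mid\Theta)\int p(Y\mid\Theta)\log\frac{p(Y\mid\Theta)}{\hat p(Y\mid X)}\,dY\,dX\in[0,\infty],$$ and $\hat p$ is KL-minimax if $\sup_\Theta R_{KL}(\Theta,\hat p)\le\sup_\Theta R_{KL}(\Theta,\hat p')$ for every predictive density $\hat p'$. Let $\lambda_1\ge\dots\ge\lambda_r\ge 0$ be the ordered eigenvalues of $\Theta\Theta^\top$, $\Lambda=\mathrm{diag}(\lambda_1,\dots,\lambda_r)$, and let $\pi(\Theta)=g(\Lambda)\ge0$ be an orthogonally invariant (proper or improper) prior density that is not almost everywhere zero, with $m_\pi(X;v_x)=\int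 p(X\mid\Theta)\pi(\Theta)\,d\Theta<\infty$ for every $X$. Suppose that $g$ is twice differentiable on $\{\lambda_1>\dots>\lambda_r>0\}$ and, only if $q=r$, that $\pi$ is differentiable also at those $\Theta$ with $\lambda_1>\dots>\lambda_r=0$. (Both hold if $\pi$ is twice differentiable on $\mathbb R^{r\times q}$.) Put $\phi_i=\partial g/\partial\lambda_i$ and $$D(\Lambda)=2\sum_{i=1}^r\Big\{(q-r+1)\phi_i(\Lambda)+\sum_{j\ne i}\frac{\lambda_i\phi_i(\Lambda)-\lambda_j\phi_j(\Lambda)}{\lambda_i-\lambda_j}+2\lambda_i\frac{\partial\phi_i(\Lambda)}{\partial\lambda_i}\Big\}.$$ (1) At every $\Theta$ for which $\Theta\Theta^\top$ has distinct eigenvalues and $g$ is twice differentiable at $\Lambda$ (in particular whenever $\lambda_1>\dots>\lambda_r>0$), $\pi$ is twice differentiable and $\sum_{i=1}^r\sum_{j=1}^q\partial^2\pi/\partial\theta_{ij}^2=D(\Lambda)$. (2) If $D(\Lambda)\le0$ whenever $\lambda_1>\dots>\lambda_r>0$, then the Bayesian predictive density $$\hat p_\pi(Y\mid X)=\frac{\int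 p(X\mid\Theta)p(Y\mid\Theta)\pi(\Theta)\,d\Theta}{\int p(X\mid\Theta)\pi(\Theta)\,d\Theta}$$ is a predictive density and is KL-minimax. -/

import Mathlib

open MeasureTheory Matrix
open scoped ENNReal Topology

noncomputable section

/-- The space of real `r × q` matrices, with its product Borel structure and Lebesgue measure. -/
abbrev Mat (r q : ℕ) : Type := Fin r → Fin q → ℝ

/-- The squared Frobenius norm `tr (A Aᵀ)`. -/
def frobSq {r q : ℕ} (A : Mat r q) : ℝ := ∑ i, ∑ j, A i j ^ 2

/-- The density at `Z` of the matrix normal law with mean `Θ` and covariance `v I_r ⊗ I_q`. -/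
def normalDensity {r q : ℕ} (v : ℝ) (Θ Z : Mat r q) : ℝ :=
  (2 * Real.pi * v) ^ (-((q : ℝ) * r / 2)) * Real.exp (-(frobSq (Z - Θ) / (2 * v)))

/-- The measure with Lebesgue density `f`. -/
def densityMeasure {r q : ℕ} (f : Mat r q → ℝ) : Measure (Mat r q) :=
  volume.withDensity fun Z => ENNReal.ofReal (f Z)

/-- `ph X Y` is a predictive density of `Y` based on the observation `X`. -/
structure IsPredictiveDensity {r q : ℕ} (ph : Mat r q → Mat r q → ℝ) : Prop where
  measurable : Measurable (Function.uncurry ph)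
  nonneg : ∀ X Y, 0 ≤ ph X Y
  lintegral_eq_one : ∀ X, ∫⁻ Y, ENNReal.ofReal (ph X Y) = 1

/-- The Kullback-Leibler loss of the density `f` as an estimate of the density of
`Y ∼ N(Θ, vy I_r ⊗ I_q)`; it takes the value `∞` when the divergence is infinite. -/
def klLoss {r q : ℕ} (vy : ℝ) (Θ : Mat r q) (f : Mat r q → ℝ) : ℝ≥0∞ :=
  InformationTheory.klDiv (densityMeasure (normalDensity vy Θ)) (densityMeasure f)

/-- The Kullback-Leibler risk: the expected loss under `X ∼ N(Θ, vx I_r ⊗ I_q)`. -/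
def klRisk {r q : ℕ} (vx vy : ℝ) (Θ : Mat r q) (ph : Mat r q → Mat r q → ℝ) : ℝ≥0∞ :=
  ∫⁻ X, klLoss vy Θ (ph X) ∂(densityMeasure (normalDensity vx Θ))

/-- `ph` is a predictive density whose maximal Kullback-Leibler risk is the smallest possible. -/
def IsKLMinimax {r q : ℕ} (vx vy : ℝ) (ph : Mat r q → Mat r q → ℝ) : Prop :=
  IsPredictiveDensity ph ∧
    ∀ ψ : Mat r q → Mat r q → ℝ, IsPredictiveDensity ψ →
      ⨆ Θ, klRisk vx vy Θ ph ≤ ⨆ Θ, klRisk vx vy Θ ψ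

/-- The marginal density `m_π(X; v)` of `X` under the prior density `prior`. -/
def marginal {r q : ℕ} (prior : Mat r q → ℝ) (v : ℝ) (X : Mat r q) : ℝ :=
  ∫ Θ, normalDensity v Θ X * prior Θ

/-- The Bayesian predictive density `p_π(X, Y) / m_π(X; vx)`. -/
def bayesPredictive {r q : ℕ} (prior : Mat r q → ℝ) (vx vy : ℝ) (X Y : Mat r q) : ℝ :=
  (∫ Θ, normalDensity vx Θ X * normalDensity vy Θ Y * prior Θ) / marginal prior vx X

theorem gram_isHermitian {r q : ℕ} (Θ : Mat r q) :
    (Matrix.of Θ * (Matrix.of Θ)ᵀ).IsHermitian := by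
  simpa using Matrix.isHermitian_mul_conjTranspose_self (Matrix.of Θ)

/-- The eigenvalues `λ_1 ≥ ⋯ ≥ λ_r` of `Θ Θᵀ`, in decreasing order. -/
def gramEigenvalues {r q : ℕ} (Θ : Mat r q) (i : Fin r) : ℝ :=
  (gram_isHermitian Θ).eigenvalues₀ (Fin.cast (Fintype.card_fin r).symm i)

/-- The orthogonally invariant prior `π(Θ) = g(Λ)`. -/
def spectralPrior {r : ℕ} (q : ℕ) (g : (Fin r → ℝ) → ℝ) (Θ : Mat r q) : ℝ :=
  g (gramEigenvalues Θ)

/-- `f` is twice differentiable at `x`. -/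
def TwiceDifferentiableAt {E : Type*} [NormedAddCommGroup E] [NormedSpace ℝ E]
    (f : E → ℝ) (x : E) : Prop :=
  (∀ᶠ y in 𝓝 x, DifferentiableAt ℝ f y) ∧ DifferentiableAt ℝ (fderiv ℝ f) x

/-- The partial derivative `∂f/∂θ_ij`. -/
def matPartial {r q : ℕ} (i : Fin r) (j : Fin q) (f : Mat r q → ℝ) (Θ : Mat r q) : ℝ :=
  lineDeriv ℝ f Θ (Pi.single i (Pi.single j 1))

/-- The Laplacian `tr (∇ ∇ᵀ f) = ∑ i, ∑ j, ∂²f/∂θ_ij²`. -/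
def matLaplacian {r q : ℕ} (f : Mat r q → ℝ) (Θ : Mat r q) : ℝ :=
  ∑ i, ∑ j, matPartial i j (matPartial i j f) Θ

/-- The partial derivative `∂g/∂λ_i`. -/
def eigPartial {r : ℕ} (i : Fin r) (g : (Fin r → ℝ) → ℝ) (lam : Fin r → ℝ) : ℝ :=
  lineDeriv ℝ g lam (Pi.single i 1)

/-- The expression
`2 ∑_i {(q-r+1) φ_i + ∑_{j≠i} (λ_i φ_i - λ_j φ_j)/(λ_i - λ_j) + 2 λ_i ∂φ_i/∂λ_i}`
with `φ_i = ∂g/∂λ_i`. -/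
def spectralLaplacian {r : ℕ} (q : ℕ) (g : (Fin r → ℝ) → ℝ) (lam : Fin r → ℝ) : ℝ :=
  2 * ∑ i, (((q : ℝ) - r + 1) * eigPartial i g lam
    + ∑ j ∈ Finset.univ.erase i,
        (lam i * eigPartial i g lam - lam j * eigPartial j g lam) / (lam i - lam j)
    + 2 * lam i * eigPartial i (eigPartial i g) lam)

end

/-! The Laplacian formula is second-order perturbation theory. Where $\Theta\Theta^\top$ has simple
spectrum, its eigenpairs are $C^2$ in $\Theta$ by the implicit function theorem
(`exists_smooth_eigenpairs`). The gradients of the eigenvalues are mutually orthogonal with squared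
lengths $4\lambda_k$, and their Laplacians are $2q+2\sum_{l\ne
k}(\lambda_k+\lambda_l)/(\lambda_k-\lambda_l)$. The chain rule for $g(\Lambda)$ then gives
$D(\Lambda)$ (`hasCoordLaplacian_spectralPrior`).

Minimaxity compares everything with $c=\frac{rq}{2}\log\frac{v_x+v_y}{v_y}$, the constant risk of
the invariant density $N(X,v_x+v_y)$. No predictive density has maximal risk below $c$
(`ofReal_le_iSup_klRisk`): the Bayes risks under the priors $N(0,\tau)$ tend to $c$ as
$\tau\to\infty$. These Bayes risks are bounded below by Fenchel duality, whose additive form can be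
averaged over $X$ and $\Theta$ with Tonelli alone, even when losses are infinite.

Conversely, $\hat p_\pi$ is the invariant density times $m_\pi(W;u)/m_\pi(X;v_x)$, where $W$ pools
$X$ and $Y$ and $u=v_xv_y/(v_x+v_y)$. Since $\log\rho\le\rho-1$, its risk is at most $c$ once
$\rho=m_\pi(X;v_x)/m_\pi(W;u)$ has mean at most one. Conditionally on $W$, $X$ is Gaussian about
$W$, so this holds whenever the heat semigroup decreases $\pi$ (`isKLMinimax_bayesPredictive`).

It remains to pass from $D\le0$, known only where the eigenvalues are distinct and positive, to
decrease under the heat flow on the whole space. This is a parabolic minimum principle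
(`heatFlow_le_of_superharmonic`) with two devices for the exceptional set. The logarithm of the
discriminant is harmonic and tends to $-\infty$ at eigenvalue collisions, so a small multiple of it
keeps the minimum away from them; for $q>r$ the subharmonic $\log\det\Theta\Theta^\top$ does the
same for the rank-deficient matrices. For $q=r$ the set $\det\Theta=0$ is a hypersurface and cannot
be avoided in this way. There $\pi$ is differentiable, and subtracting a small multiple of
$|\det\Theta|$ creates a downward kink at which no minimum can sit. -/

noncomputable section

/-! ### Gaussian densities on matrix space: products, moments and substitution. -/

section Gaussian

variable {r q : ℕ}

theorem frobSq_nonneg (A : Mat r q) : 0 ≤ frobSq A :=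
  Finset.sum_nonneg fun _ _ => Finset.sum_nonneg fun _ _ => sq_nonneg _

theorem frobSq_sub_comm (A B : Mat r q) : frobSq (A - B) = frobSq (B - A) := by
  simp only [frobSq, Pi.sub_apply]
  exact Finset.sum_congr rfl fun _ _ => Finset.sum_congr rfl fun _ _ => by ring

@[fun_prop]
theorem continuous_frobSq : Continuous (frobSq : Mat r q → ℝ) := by
  unfold frobSq; fun_prop

theorem frobSq_smul (c : ℝ) (A : Mat r q) : frobSq (c • A) = c ^ 2 * frobSq A := by
  simp [frobSq, Finset.mul_sum, mul_pow]

theorem normalDensity_pos {v : ℝ} (hv : 0 < v) (Θ Z : Mat r q) : 0 < normalDensity v Θ Z := by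
  unfold normalDensity; positivity

theorem normalDensity_nonneg {v : ℝ} (hv : 0 < v) (Θ Z : Mat r q) : 0 ≤ normalDensity v Θ Z :=
  (normalDensity_pos hv Θ Z).le

theorem normalDensity_comm (v : ℝ) (Θ Z : Mat r q) : normalDensity v Θ Z = normalDensity v Z Θ := by
  unfold normalDensity; rw [frobSq_sub_comm]

@[fun_prop]
theorem continuous_normalDensity (v : ℝ) :
    Continuous fun p : Mat r q × Mat r q => normalDensity v p.1 p.2 := by
  unfold normalDensity; fun_prop

@[fun_prop]
theorem measurable_normalDensity (v : ℝ) :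
    Measurable fun p : Mat r q × Mat r q => normalDensity v p.1 p.2 :=
  (continuous_normalDensity v).measurable

/-- Completing the square in `Θ`, entry by entry: the first factor is the posterior under a flat
prior, centred at the precision-weighted mean. All conjugate computations below rest on it. -/
theorem normalDensity_mul_normalDensity {v w : ℝ} (hv : 0 < v) (hw : 0 < w) (Θ X Y : Mat r q) :
    normalDensity v Θ X * normalDensity w Θ Y =
      normalDensity (v * w / (v + w)) Θ ((v + w)⁻¹ • (w • X + v • Y)) *
        normalDensity (v + w) X Y := by
  unfold normalDensity
  have h1 : (2 * Real.pi * v) ^ (-((q : ℝ) * r / 2)) * (2 * Real.pi * w) ^ (-((q : ℝ) * r / 2)) =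
      (2 * Real.pi * (v * w / (v + w))) ^ (-((q : ℝ) * r / 2)) *
        (2 * Real.pi * (v + w)) ^ (-((q : ℝ) * r / 2)) := by
    rw [← Real.mul_rpow (by positivity) (by positivity),
      ← Real.mul_rpow (by positivity) (by positivity)]
    congr 1
    field_simp
  have h2 : frobSq (X - Θ) / (2 * v) + frobSq (Y - Θ) / (2 * w) =
      frobSq ((v + w)⁻¹ • (w • X + v • Y) - Θ) / (2 * (v * w / (v + w))) +
        frobSq (Y - X) / (2 * (v + w)) := by
    simp only [frobSq, Finset.sum_div, ← Finset.sum_add_distrib, Pi.sub_apply, Pi.smul_apply,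
      Pi.add_apply, smul_eq_mul]
    refine Finset.sum_congr rfl fun i _ => Finset.sum_congr rfl fun j _ => ?_
    field_simp
    ring
  rw [mul_mul_mul_comm, h1, ← Real.exp_add, mul_mul_mul_comm, ← Real.exp_add, ← neg_add, h2,
    neg_add]

theorem integrable_mat_prod {h : Fin r → Fin q → ℝ → ℝ} (hh : ∀ i j, Integrable (h i j)) :
    Integrable fun Z : Mat r q => ∏ i, ∏ j, h i j (Z i j) := by
  have h1 : ∀ i, Integrable fun z : Fin q → ℝ => ∏ j, h i j (z j) := fun i =>
    Integrable.fintype_prod (f := h i) (hh i)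
  exact Integrable.fintype_prod (f := fun i (z : Fin q → ℝ) => ∏ j, h i j (z j)) h1

theorem integral_mat_prod (h : Fin r → Fin q → ℝ → ℝ) :
    ∫ Z : Mat r q, ∏ i, ∏ j, h i j (Z i j) = ∏ i, ∏ j, ∫ z, h i j z := by
  have := integral_fintype_prod_volume_eq_prod (𝕜 := ℝ) (E := fun _ : Fin r => Fin q → ℝ)
    fun i z => ∏ j, h i j (z j)
  refine this.trans (Finset.prod_congr rfl fun i _ => ?_)
  exact integral_fintype_prod_volume_eq_prod (𝕜 := ℝ) (E := fun _ : Fin q => ℝ) fun j => h i j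

theorem normalDensity_eq_prod {v : ℝ} (hv : 0 < v) (Θ Z : Mat r q) :
    normalDensity v Θ Z =
      ∏ i, ∏ j, ProbabilityTheory.gaussianPDFReal (Θ i j) ⟨v, hv.le⟩ (Z i j) := by
  simp only [ProbabilityTheory.gaussianPDFReal, Finset.prod_mul_distrib, Finset.prod_const,
    Finset.card_univ, Fintype.card_fin, ← Real.exp_sum, normalDensity]
  congr 1
  · rw [Real.sqrt_eq_rpow, ← Real.rpow_neg (by positivity), ← Real.rpow_natCast,
      ← Real.rpow_natCast, ← Real.rpow_mul (by positivity), ← Real.rpow_mul (by positivity)]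
    congr 1
    ring
  · simp only [frobSq, Finset.sum_div, ← Finset.sum_neg_distrib, Pi.sub_apply, neg_div]
    rfl

theorem integrable_normalDensity {v : ℝ} (hv : 0 < v) (Θ : Mat r q) :
    Integrable (normalDensity v Θ) := by
  rw [show normalDensity v Θ = _ from funext fun Z => normalDensity_eq_prod hv Θ Z]
  exact integrable_mat_prod (h := fun i j =>
    ProbabilityTheory.gaussianPDFReal (Θ i j) ⟨v, hv.le⟩) fun i j =>
      ProbabilityTheory.integrable_gaussianPDFReal _ _

theorem integral_normalDensity {v : ℝ} (hv : 0 < v) (Θ : Mat r q) :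
    ∫ Z, normalDensity v Θ Z = 1 := by
  have hv' : (⟨v, hv.le⟩ : NNReal) ≠ 0 := fun h => hv.ne' (congrArg NNReal.toReal h)
  simp_rw [normalDensity_eq_prod hv]
  rw [integral_mat_prod fun i j => ProbabilityTheory.gaussianPDFReal (Θ i j) ⟨v, hv.le⟩]
  simp [ProbabilityTheory.integral_gaussianPDFReal_eq_one _ hv']

theorem lintegral_normalDensity {v : ℝ} (hv : 0 < v) (Θ : Mat r q) :
    ∫⁻ Z, ENNReal.ofReal (normalDensity v Θ Z) = 1 := by
  rw [← ofReal_integral_eq_lintegral_ofReal (integrable_normalDensity hv Θ)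
    (.of_forall fun Z => normalDensity_nonneg hv Θ Z), integral_normalDensity hv, ENNReal.ofReal_one]

theorem lintegral_normalDensity' {v : ℝ} (hv : 0 < v) (Z : Mat r q) :
    ∫⁻ Θ, ENNReal.ofReal (normalDensity v Θ Z) = 1 := by
  simp_rw [normalDensity_comm v _ Z]
  exact lintegral_normalDensity hv Z

theorem lintegral_normalDensity_mul {v w : ℝ} (hv : 0 < v) (hw : 0 < w) (X Y : Mat r q) :
    ∫⁻ Z, ENNReal.ofReal (normalDensity v Z X) * ENNReal.ofReal (normalDensity w Z Y) =
      ENNReal.ofReal (normalDensity (v + w) X Y) := by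
  simp_rw [← ENNReal.ofReal_mul (normalDensity_nonneg hv _ _),
    normalDensity_mul_normalDensity hv hw,
    ENNReal.ofReal_mul (normalDensity_nonneg (show 0 < v * w / (v + w) by positivity) _ _)]
  rw [lintegral_mul_const _ (by fun_prop), lintegral_normalDensity' (by positivity), one_mul]

theorem integral_gaussianPDFReal_mul_sq {v : NNReal} (hv : v ≠ 0) (m a : ℝ) :
    Integrable (fun z => ProbabilityTheory.gaussianPDFReal m v z * (z - a) ^ 2) ∧
      ∫ z, ProbabilityTheory.gaussianPDFReal m v z * (z - a) ^ 2 = v + (m - a) ^ 2 := by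
  open ProbabilityTheory in
  have hL : MemLp (fun z : ℝ => z) 2 (gaussianReal m v) := memLp_id_gaussianReal' 2 (by simp)
  have hL' : MemLp (fun z : ℝ => z - a) 2 (gaussianReal m v) := hL.sub (memLp_const a)
  have hI : Integrable (fun z : ℝ => (z - a) ^ 2) (gaussianReal m v) := hL'.integrable_sq
  have hint : ∫ z, (z - a) ^ 2 ∂(gaussianReal m v) = v + (m - a) ^ 2 := by
    have h1 := variance_eq_sub hL'
    rw [variance_sub_const hL.1, variance_fun_id_gaussianReal] at h1
    have h2 : ∫ z, (z - a) ∂(gaussianReal m v) = m - a := by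
      rw [integral_sub (hL.integrable (by norm_num)) (integrable_const a)]
      have := integral_id_gaussianReal (μ := m) (v := v)
      simp [this]
    rw [h2] at h1
    simp only [Pi.pow_apply] at h1
    linarith
  constructor
  · rw [gaussianReal_of_var_ne_zero m hv,
      integrable_withDensity_iff (measurable_gaussianPDF m v) (by simp [gaussianPDF])] at hI
    simpa [toReal_gaussianPDF, mul_comm] using hI
  · rw [← hint, integral_gaussianReal_eq_integral_smul hv]
    simp

theorem normalDensity_mul_frobSq {v : ℝ} (hv : 0 < v) (Θ A : Mat r q) :
    Integrable (fun Z => normalDensity v Θ Z * frobSq (Z - A)) ∧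
      ∫ Z, normalDensity v Θ Z * frobSq (Z - A) = r * q * v + frobSq (Θ - A) := by
  have hv' : (⟨v, hv.le⟩ : NNReal) ≠ 0 := fun h => hv.ne' (congrArg NNReal.toReal h)
  set G : Fin r → Fin q → ℝ → ℝ := fun i j =>
    ProbabilityTheory.gaussianPDFReal (Θ i j) ⟨v, hv.le⟩ with hG
  -- The density times one squared entry of `Z - A` is still a product over entries, so each summand
  -- of `frobSq` is handled by Fubini.
  set H : Fin r → Fin q → Fin r → Fin q → ℝ → ℝ := fun a b i j z =>
    G i j z * if i = a ∧ j = b then (z - A a b) ^ 2 else 1 with hH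
  have hGi : ∀ i j, Integrable (G i j) := fun i j =>
    ProbabilityTheory.integrable_gaussianPDFReal _ _
  have hHi : ∀ a b i j, Integrable (H a b i j) := by
    intro a b i j
    simp only [hH]
    split_ifs with h
    · obtain ⟨rfl, rfl⟩ := h
      exact (integral_gaussianPDFReal_mul_sq hv' _ _).1
    · simpa using hGi i j
  have hHv : ∀ a b i j, ∫ z, H a b i j z =
      if i = a then (if j = b then v + (Θ a b - A a b) ^ 2 else 1) else 1 := by
    intro a b i j
    have h1 : ∫ z, G i j z = 1 := ProbabilityTheory.integral_gaussianPDFReal_eq_one _ hv'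
    simp only [hH]
    by_cases hi : i = a
    · by_cases hj : j = b
      · subst hi hj
        simpa using! (integral_gaussianPDFReal_mul_sq hv' (Θ i j) (A i j)).2
      · simp [hj, h1]
    · simp [hi, h1]
  have hprod : ∀ Z : Mat r q, normalDensity v Θ Z * frobSq (Z - A) =
      ∑ a, ∑ b, ∏ i, ∏ j, H a b i j (Z i j) := by
    intro Z
    simp only [hH, Finset.prod_mul_distrib, ← Finset.mul_sum, normalDensity_eq_prod hv]
    congr 1
    refine Finset.sum_congr rfl fun a _ => Finset.sum_congr rfl fun b _ => ?_
    rw [Finset.prod_eq_single a, Finset.prod_eq_single b] <;>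
      simp +contextual
  simp_rw [hprod]
  have hi : ∀ a b, Integrable fun Z : Mat r q => ∏ i, ∏ j, H a b i j (Z i j) := fun a b =>
    integrable_mat_prod (hHi a b)
  refine ⟨integrable_finsetSum _ fun a _ => integrable_finsetSum _ fun b _ => hi a b, ?_⟩
  rw [integral_finsetSum _ fun a _ => integrable_finsetSum _ fun b _ => hi a b]
  simp_rw [integral_finsetSum _ fun b _ => hi _ b, integral_mat_prod, hHv]
  simp [frobSq, Finset.sum_add_distrib]
  ring

theorem lintegral_densityMeasure {f : Mat r q → ℝ} (hf : Measurable f) {h : Mat r q → ℝ≥0∞} :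
    ∫⁻ Z, h Z ∂(densityMeasure f) = ∫⁻ Z, ENNReal.ofReal (f Z) * h Z :=
  lintegral_withDensity_eq_lintegral_mul_non_measurable _ (by fun_prop) (by simp) _

theorem integral_densityMeasure {f : Mat r q → ℝ} (hf : Measurable f) (hf0 : ∀ Z, 0 ≤ f Z)
    (h : Mat r q → ℝ) : ∫ Z, h Z ∂(densityMeasure f) = ∫ Z, f Z * h Z := by
  unfold densityMeasure
  rw [integral_withDensity_eq_integral_toReal_smul (by fun_prop) (by simp)]
  simp [ENNReal.toReal_ofReal (hf0 _)]

theorem integrable_densityMeasure {f : Mat r q → ℝ} (hf : Measurable f) (hf0 : ∀ Z, 0 ≤ f Z)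
    {h : Mat r q → ℝ} : Integrable h (densityMeasure f) ↔ Integrable fun Z => f Z * h Z := by
  unfold densityMeasure
  rw [integrable_withDensity_iff (by fun_prop) (by simp)]
  simp [ENNReal.toReal_ofReal (hf0 _), mul_comm]

theorem isProbabilityMeasure_densityMeasure {f : Mat r q → ℝ}
    (h : ∫⁻ Z, ENNReal.ofReal (f Z) = 1) : IsProbabilityMeasure (densityMeasure f) :=
  ⟨by simpa [densityMeasure] using h⟩

/-- Affine substitution in a Lebesgue integral over matrices. -/
theorem lintegral_comp_smul_add {c : ℝ} (hc : 0 < c) (B : Mat r q) {h : Mat r q → ℝ≥0∞} :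
    ∫⁻ Z, h (c • Z + B) = ENNReal.ofReal ((c ^ (r * q))⁻¹) * ∫⁻ Z, h Z := by
  have he : MeasurableEmbedding (c • · : Mat r q → Mat r q) :=
    (Homeomorph.smulOfNeZero c hc.ne').toMeasurableEquiv.measurableEmbedding
  have h1 : ∫⁻ Z : Mat r q, h (c • Z + B) = ∫⁻ Z, h (Z + B) ∂(volume.map (c • · : Mat r q → _)) :=
    (he.lintegral_map (μ := volume) fun Z => h (Z + B)).symm
  rw [h1, Measure.map_addHaar_smul _ hc.ne', lintegral_smul_measure, lintegral_add_right_eq_self h,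
    abs_of_pos (by positivity)]
  simp [Module.finrank_pi_fintype]

end Gaussian

/-! ### Lower bound for the maximal risk of any predictive density. -/

section LowerBound

/-- Integrability is not needed, because the Bochner integral of a non-integrable function is 0. -/
theorem ofReal_integral_le_lintegral {α : Type*} [MeasurableSpace α] {μ : Measure α} (f : α → ℝ) :
    ENNReal.ofReal (∫ x, f x ∂μ) ≤ ∫⁻ x, ENNReal.ofReal (f x) ∂μ := by
  by_cases hf : Integrable f μ
  · rw [integral_eq_lintegral_pos_part_sub_lintegral_neg_part hf]
    refine (ENNReal.ofReal_le_ofReal (sub_le_self _ ENNReal.toReal_nonneg)).trans ?_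
    exact ENNReal.ofReal_toReal_le
  · simp [integral_undef hf]

/-- Fenchel–Young: the convex conjugate of `klFun` is $e^h-1$. For `t > 0` it is $1+x\le e^x$ at
$x=h-\log t$. -/
theorem mul_add_one_le_klFun_add_exp {t : ℝ} (ht : 0 ≤ t) (h : ℝ) :
    t * h + 1 ≤ InformationTheory.klFun t + Real.exp h := by
  rw [InformationTheory.klFun_apply]
  rcases ht.eq_or_lt with rfl | ht
  · simp [Real.exp_nonneg]
  · have h1 := Real.add_one_le_exp (h - Real.log t)
    rw [Real.exp_sub, Real.exp_log ht, le_div_iff₀ ht] at h1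
    linarith

/-- The Fenchel lower bound for the Kullback-Leibler divergence of probability measures. -/
theorem ofReal_integral_add_one_le_klDiv_add {α : Type*} [MeasurableSpace α] {P Q : Measure α}
    [IsProbabilityMeasure P] [IsProbabilityMeasure Q] {h : α → ℝ} (hm : Measurable h)
    (hi : Integrable h P) :
    ENNReal.ofReal (∫ x, h x ∂P + 1) ≤
      InformationTheory.klDiv P Q + ∫⁻ x, ENNReal.ofReal (Real.exp (h x)) ∂Q := by
  by_cases hac : P ≪ Q
  swap; · simp [InformationTheory.klDiv_of_not_ac hac]
  have hi' : Integrable (fun x => (P.rnDeriv Q x).toReal * h x) Q :=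
    (integrable_rnDeriv_smul_iff hac).2 hi
  rw [InformationTheory.klDiv_eq_lintegral_klFun_of_ac hac, ← lintegral_add_right _ (by fun_prop)]
  have h1 : ∫ x, h x ∂P + 1 = ∫ x, ((P.rnDeriv Q x).toReal * h x + 1) ∂Q := by
    rw [integral_add hi' (integrable_const 1)]
    have := integral_rnDeriv_smul (f := h) hac
    simp only [smul_eq_mul] at this
    simp [this]
  rw [h1]
  refine (ofReal_integral_le_lintegral _).trans (lintegral_mono fun x => ?_)
  rw [← ENNReal.ofReal_add (InformationTheory.klFun_nonneg ENNReal.toReal_nonneg)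
    (Real.exp_nonneg _)]
  exact ENNReal.ofReal_le_ofReal (mul_add_one_le_klFun_add_exp ENNReal.toReal_nonneg _)

variable {r q : ℕ}

theorem log_normalDensity_div {v w : ℝ} (hv : 0 < v) (hw : 0 < w) (Θ A Y : Mat r q) :
    Real.log (normalDensity v Θ Y / normalDensity w A Y) =
      r * q / 2 * Real.log (w / v) - frobSq (Y - Θ) / (2 * v) + frobSq (Y - A) / (2 * w) := by
  have hv' : 0 < 2 * Real.pi * v := by positivity
  have hw' : 0 < 2 * Real.pi * w := by positivity
  rw [Real.log_div (normalDensity_pos hv _ _).ne' (normalDensity_pos hw _ _).ne']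
  unfold normalDensity
  rw [Real.log_mul (Real.rpow_pos_of_pos hv' _).ne' (Real.exp_pos _).ne',
    Real.log_mul (Real.rpow_pos_of_pos hw' _).ne' (Real.exp_pos _).ne', Real.log_exp, Real.log_exp,
    Real.log_rpow hv', Real.log_rpow hw', Real.log_mul (by positivity) hv.ne',
    Real.log_mul (by positivity) hw.ne', Real.log_div hw.ne' hv.ne']
  ring

/-- The Gaussian log-likelihood ratio is integrable, with this integral. -/
theorem integral_log_normalDensity_div {v w : ℝ} (hv : 0 < v) (hw : 0 < w) (Θ A : Mat r q) :
    Integrable (fun Y => normalDensity v Θ Y *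
        Real.log (normalDensity v Θ Y / normalDensity w A Y)) ∧
      ∫ Y, normalDensity v Θ Y * Real.log (normalDensity v Θ Y / normalDensity w A Y) =
        r * q / 2 * Real.log (w / v) - r * q / 2 + (r * q * v + frobSq (Θ - A)) / (2 * w) := by
  obtain ⟨i1, e1⟩ := normalDensity_mul_frobSq hv Θ Θ
  obtain ⟨i2, e2⟩ := normalDensity_mul_frobSq hv Θ A
  have i0 := (integrable_normalDensity hv Θ).const_mul (r * q / 2 * Real.log (w / v))
  have h : (fun Y => normalDensity v Θ Y *
      Real.log (normalDensity v Θ Y / normalDensity w A Y)) = fun Y =>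
      r * q / 2 * Real.log (w / v) * normalDensity v Θ Y -
        (2 * v)⁻¹ * (normalDensity v Θ Y * frobSq (Y - Θ)) +
        (2 * w)⁻¹ * (normalDensity v Θ Y * frobSq (Y - A)) := by
    funext Y
    rw [log_normalDensity_div hv hw]
    ring
  have i3 : Integrable fun Y => r * q / 2 * Real.log (w / v) * normalDensity v Θ Y -
      (2 * v)⁻¹ * (normalDensity v Θ Y * frobSq (Y - Θ)) := i0.sub (i1.const_mul _)
  rw [h]
  refine ⟨i3.add (i2.const_mul _), ?_⟩
  rw [integral_add i3 (i2.const_mul _), integral_sub i0 (i1.const_mul _),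
    integral_const_mul, integral_const_mul, integral_const_mul, e1, e2, integral_normalDensity hv]
  have : frobSq (Θ - Θ) = 0 := by simp [frobSq]
  rw [this]
  field_simp
  ring

/-- The second moment of `Θ - a X` about the origin. -/
theorem normalDensity_mul_frobSq_sub_smul {v : ℝ} (hv : 0 < v) (Θ : Mat r q) {a : ℝ} (ha : 0 < a) :
    Integrable (fun X => normalDensity v Θ X * frobSq (Θ - a • X)) ∧
      ∫ X, normalDensity v Θ X * frobSq (Θ - a • X) =
        a ^ 2 * (r * q * v) + (1 - a) ^ 2 * frobSq Θ := by
  obtain ⟨i1, e1⟩ := normalDensity_mul_frobSq hv Θ (a⁻¹ • Θ)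
  have h : ∀ X : Mat r q, frobSq (Θ - a • X) = a ^ 2 * frobSq (X - a⁻¹ • Θ) := by
    intro X
    rw [← frobSq_smul, smul_sub, smul_inv_smul₀ ha.ne', frobSq_sub_comm]
  have h2 : frobSq (Θ - a⁻¹ • Θ) = (1 - a⁻¹) ^ 2 * frobSq Θ := by
    rw [← frobSq_smul, sub_smul, one_smul]
  simp_rw [h, mul_left_comm _ (a ^ 2)]
  refine ⟨i1.const_mul _, ?_⟩
  rw [integral_const_mul, e1, h2]
  field_simp
  ring

variable {vx vy : ℝ} {ψ : Mat r q → Mat r q → ℝ}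

theorem measurable_lintegral_ratio (hψ : IsPredictiveDensity ψ) (a v w : ℝ) :
    Measurable fun p : Mat r q × Mat r q => ∫⁻ Y, ENNReal.ofReal (ψ p.2 Y) *
      ENNReal.ofReal (normalDensity v p.1 Y / normalDensity w (a • p.2) Y) := by
  have hm : Measurable fun p : (Mat r q × Mat r q) × Mat r q => ENNReal.ofReal (ψ p.1.2 p.2) *
      ENNReal.ofReal (normalDensity v p.1.1 p.2 / normalDensity w (a • p.1.2) p.2) := by
    have : Measurable fun p : (Mat r q × Mat r q) × Mat r q => ψ p.1.2 p.2 :=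
      hψ.measurable.comp ((measurable_snd.comp measurable_fst).prodMk measurable_snd)
    exact this.ennreal_ofReal.mul (by fun_prop)
  exact hm.lintegral_prod_right'

/-- The normalising term in the Fenchel bound, averaged over the Gaussian prior. -/
theorem lintegral_normalDensity_ratio (hvx : 0 < vx) (hvy : 0 < vy) (hψ : IsPredictiveDensity ψ)
    {τ : ℝ} (hτ : 0 < τ) :
    ∫⁻ Θ : Mat r q, ENNReal.ofReal (normalDensity τ 0 Θ) *
      ∫⁻ X, ENNReal.ofReal (normalDensity vx Θ X) *
        ∫⁻ Y, ENNReal.ofReal (ψ X Y) * ENNReal.ofReal (normalDensity vy Θ Y /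
          normalDensity (τ * vx / (τ + vx) + vy) ((τ / (τ + vx)) • X) Y) = 1 := by
  have hψm := hψ.measurable
  have hψX : ∀ X, Measurable (ψ X) := fun X => hψm.of_uncurry_left
  have hw : 0 < τ * vx / (τ + vx) := by positivity
  have hw' : 0 < τ * vx / (τ + vx) + vy := by positivity
  have hm2 := measurable_lintegral_ratio hψ (τ / (τ + vx)) vy (τ * vx / (τ + vx) + vy)
  calc _ = ∫⁻ Θ : Mat r q, ∫⁻ X, ENNReal.ofReal (normalDensity τ 0 Θ) *
      (ENNReal.ofReal (normalDensity vx Θ X) *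
        ∫⁻ Y, ENNReal.ofReal (ψ X Y) * ENNReal.ofReal (normalDensity vy Θ Y /
          normalDensity (τ * vx / (τ + vx) + vy) ((τ / (τ + vx)) • X) Y)) := by
        refine lintegral_congr fun Θ => (lintegral_const_mul _ ?_).symm
        have := hm2.comp (measurable_const (a := Θ) |>.prodMk measurable_id)
        exact Measurable.mul (by fun_prop) this
    _ = ∫⁻ X, ∫⁻ Θ : Mat r q, ENNReal.ofReal (normalDensity τ 0 Θ) *
      (ENNReal.ofReal (normalDensity vx Θ X) *
        ∫⁻ Y, ENNReal.ofReal (ψ X Y) * ENNReal.ofReal (normalDensity vy Θ Y /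
          normalDensity (τ * vx / (τ + vx) + vy) ((τ / (τ + vx)) • X) Y)) := by
        refine lintegral_lintegral_swap (Measurable.aemeasurable ?_)
        exact Measurable.mul (by fun_prop) (Measurable.mul (by fun_prop) hm2)
    _ = ∫⁻ X, ENNReal.ofReal (normalDensity (τ + vx) 0 X) * ∫⁻ Y, ENNReal.ofReal (ψ X Y) := by
        refine lintegral_congr fun X => ?_
        -- Prior times likelihood of `X` is rewritten as marginal of `X` times posterior of `Θ`.
        calc _ = ∫⁻ Θ : Mat r q, ∫⁻ Y, ENNReal.ofReal (normalDensity (τ + vx) 0 X) *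
              (ENNReal.ofReal (ψ X Y) *
              (ENNReal.ofReal (normalDensity (τ * vx / (τ + vx) + vy) ((τ / (τ + vx)) • X) Y)⁻¹ *
              (ENNReal.ofReal (normalDensity (τ * vx / (τ + vx)) Θ ((τ / (τ + vx)) • X)) *
                ENNReal.ofReal (normalDensity vy Θ Y)))) := by
              refine lintegral_congr fun Θ => ?_
              rw [← mul_assoc, ← lintegral_const_mul]
              swap
              · have := hψX X
                fun_prop
              refine lintegral_congr fun Y => ?_
              rw [div_eq_mul_inv, ENNReal.ofReal_mul (normalDensity_nonneg hvy _ _),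
                ← ENNReal.ofReal_mul (normalDensity_nonneg hτ _ _),
                normalDensity_comm τ 0 Θ, normalDensity_mul_normalDensity hτ hvx,
                ENNReal.ofReal_mul (normalDensity_nonneg hw _ _), smul_zero, zero_add, smul_smul,
                inv_mul_eq_div]
              ring
          _ = ∫⁻ Y, ∫⁻ Θ : Mat r q, ENNReal.ofReal (normalDensity (τ + vx) 0 X) *
              (ENNReal.ofReal (ψ X Y) *
              (ENNReal.ofReal (normalDensity (τ * vx / (τ + vx) + vy) ((τ / (τ + vx)) • X) Y)⁻¹ *
              (ENNReal.ofReal (normalDensity (τ * vx / (τ + vx)) Θ ((τ / (τ + vx)) • X)) *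
                ENNReal.ofReal (normalDensity vy Θ Y)))) := by
              refine lintegral_lintegral_swap (Measurable.aemeasurable ?_)
              have : Measurable fun p : Mat r q × Mat r q => ψ X p.2 :=
                (hψX X).comp measurable_snd
              unfold Function.uncurry
              fun_prop
          _ = _ := by
              rw [← lintegral_const_mul _ (by have := hψX X; fun_prop)]
              refine lintegral_congr fun Y => ?_
              -- Integrating `Θ` out of posterior times likelihood of `Y` gives the Bayes predictive
              -- density, which cancels the denominator.
              have hp := normalDensity_pos hw' ((τ / (τ + vx)) • X) Y
              rw [lintegral_const_mul _ (by fun_prop), lintegral_const_mul _ (by fun_prop),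
                lintegral_const_mul _ (by fun_prop), lintegral_normalDensity_mul hw hvy,
                ← ENNReal.ofReal_mul (inv_nonneg.2 hp.le), inv_mul_cancel₀ hp.ne']
              simp
    _ = 1 := by
        simp_rw [hψ.lintegral_eq_one, mul_one]
        exact lintegral_normalDensity (by positivity) _

/-- The left side is the Bayes risk under the prior $N(0,\tau)$. The dual bound is applied with the
optimal test function, the log ratio of the true density to the Bayes predictive density; its
exponential averages to one by `lintegral_normalDensity_ratio`. -/
theorem ofReal_le_iSup_klRisk_of_gaussianPrior (hvx : 0 < vx) (hvy : 0 < vy)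
    (hψ : IsPredictiveDensity ψ) {τ : ℝ} (hτ : 0 < τ) :
    ENNReal.ofReal (r * q / 2 * Real.log ((τ * vx / (τ + vx) + vy) / vy)) ≤
      ⨆ Θ, klRisk vx vy Θ ψ := by
  -- The posterior of `Θ` is normal with mean `a • X` and variance `w - vy`, so the Bayes predictive
  -- law is normal with mean `a • X` and variance `w`.
  set a := τ / (τ + vx) with ha
  set w := τ * vx / (τ + vx) + vy with hw
  have ha0 : 0 < a := by positivity
  have hw0 : 0 < w := by positivity
  have hψX : ∀ X, Measurable (ψ X) := fun X => hψ.measurable.of_uncurry_left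
  set S2 : Mat r q → Mat r q → ℝ≥0∞ := fun Θ X => ∫⁻ Y, ENNReal.ofReal (ψ X Y) *
    ENNReal.ofReal (normalDensity vy Θ Y / normalDensity w (a • X) Y) with hS2
  set H : Mat r q → Mat r q → ℝ := fun Θ X =>
    r * q / 2 * Real.log (w / vy) - r * q / 2 + (r * q * vy + frobSq (Θ - a • X)) / (2 * w) with hH
  have hm : Measurable fun p : (Mat r q × Mat r q) => S2 p.1 p.2 :=
    measurable_lintegral_ratio hψ a vy w
  have hmX : ∀ Θ, Measurable (S2 Θ) := fun Θ => hm.comp (measurable_const.prodMk measurable_id)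
  have hloss : ∀ Θ X, ENNReal.ofReal (H Θ X + 1) ≤ klLoss vy Θ (ψ X) + S2 Θ X := by
    intro Θ X
    have := isProbabilityMeasure_densityMeasure (hψ.lintegral_eq_one X)
    have := isProbabilityMeasure_densityMeasure (lintegral_normalDensity hvy Θ)
    have hN : Measurable (normalDensity vy Θ) := by fun_prop
    obtain ⟨i1, e1⟩ := integral_log_normalDensity_div hvy hw0 Θ (a • X)
    have h := ofReal_integral_add_one_le_klDiv_add
      (P := densityMeasure (normalDensity vy Θ)) (Q := densityMeasure (ψ X))
      (h := fun Y => Real.log (normalDensity vy Θ Y / normalDensity w (a • X) Y)) (by fun_prop)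
      ((integrable_densityMeasure hN (normalDensity_nonneg hvy Θ)).2 i1)
    rw [integral_densityMeasure hN (normalDensity_nonneg hvy Θ), e1,
      lintegral_densityMeasure (hψX X)] at h
    refine h.trans (add_le_add le_rfl (lintegral_mono fun Y => ?_))
    rw [Real.exp_log (div_pos (normalDensity_pos hvy _ _) (normalDensity_pos hw0 _ _))]
  -- The average of `H Θ X` over `X`.
  set K : Mat r q → ℝ := fun Θ => r * q / 2 * Real.log (w / vy) - r * q / 2 +
    (r * q * vy + (a ^ 2 * (r * q * vx) + (1 - a) ^ 2 * frobSq Θ)) / (2 * w) with hK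
  have hrisk : ∀ Θ, ENNReal.ofReal (K Θ + 1) ≤ klRisk vx vy Θ ψ +
      ∫⁻ X, ENNReal.ofReal (normalDensity vx Θ X) * S2 Θ X := by
    intro Θ
    obtain ⟨i1, e1⟩ := normalDensity_mul_frobSq_sub_smul hvx Θ ha0
    have i0 := integrable_normalDensity hvx Θ
    have he : K Θ + 1 = ∫ X, normalDensity vx Θ X * (H Θ X + 1) := by
      have : ∀ X, normalDensity vx Θ X * (H Θ X + 1) =
          (r * q / 2 * Real.log (w / vy) - r * q / 2 + (r * q * vy) / (2 * w) + 1) *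
            normalDensity vx Θ X + (2 * w)⁻¹ * (normalDensity vx Θ X * frobSq (Θ - a • X)) := by
        intro X; simp only [hH]; ring
      simp_rw [this]
      rw [integral_add (i0.const_mul _) (i1.const_mul _), integral_const_mul, integral_const_mul,
        integral_normalDensity hvx, e1]
      simp only [hK]; ring
    rw [he, klRisk, lintegral_densityMeasure (by fun_prop)]
    refine (ofReal_integral_le_lintegral _).trans ?_
    have hmN : Measurable fun X => ENNReal.ofReal (normalDensity vx Θ X) * S2 Θ X :=
      Measurable.mul (by fun_prop) (hmX Θ)
    rw [← lintegral_add_right _ hmN]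
    refine lintegral_mono fun X => ?_
    rw [ENNReal.ofReal_mul (normalDensity_nonneg hvx _ _), ← mul_add]
    gcongr
    exact hloss Θ X
  set L := r * q / 2 * Real.log (w / vy) with hL
  have hL0 : 0 ≤ L := by
    refine mul_nonneg (by positivity) (Real.log_nonneg ?_)
    rw [le_div_iff₀ hvy, one_mul, hw]
    have : 0 < τ * vx / (τ + vx) := by positivity
    linarith
  have hfinal : ENNReal.ofReal (L + 1) ≤ (⨆ Θ, klRisk vx vy Θ ψ) + 1 := by
    obtain ⟨i1, e1⟩ := normalDensity_mul_frobSq hτ (0 : Mat r q) 0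
    have i0 := integrable_normalDensity hτ (0 : Mat r q)
    have he : L + 1 = ∫ Θ : Mat r q, normalDensity τ 0 Θ * (K Θ + 1) := by
      have : ∀ Θ : Mat r q, normalDensity τ 0 Θ * (K Θ + 1) =
          (L - r * q / 2 + (r * q * vy + a ^ 2 * (r * q * vx)) / (2 * w) + 1) *
            normalDensity τ 0 Θ +
            (1 - a) ^ 2 / (2 * w) * (normalDensity τ 0 Θ * frobSq (Θ - 0)) := by
        intro X; simp only [hK, sub_zero]; ring
      simp_rw [this]
      rw [integral_add (i0.const_mul _) (i1.const_mul _), integral_const_mul, integral_const_mul,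
        integral_normalDensity hτ, e1]
      have h0 : frobSq (0 - 0 : Mat r q) = 0 := by simp [frobSq]
      -- Mean squared error of `a • X` equals the posterior variance; hence the quadratic terms add
      -- up to `r * q / 2` and cancel the constant in `K`.
      have h1 : a ^ 2 * vx + (1 - a) ^ 2 * τ = w - vy := by
        simp only [ha, hw]; field_simp; ring
      have h2 : (r * q * vy + a ^ 2 * (r * q * vx)) / (2 * w) + (1 - a) ^ 2 / (2 * w) *
          (r * q * τ) = r * q / 2 := by
        have : (r * q * vy + a ^ 2 * (r * q * vx)) / (2 * w) + (1 - a) ^ 2 / (2 * w) *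
          (r * q * τ) = r * q * (vy + (a ^ 2 * vx + (1 - a) ^ 2 * τ)) / (2 * w) := by ring
        rw [this, h1]; field_simp; ring
      rw [h0]
      linarith
    rw [he]
    refine (ofReal_integral_le_lintegral _).trans ?_
    have h1 := lintegral_normalDensity_ratio (r := r) (q := q) hvx hvy hψ hτ
    rw [← hw, ← ha] at h1
    have h2 : ⨆ Θ, klRisk vx vy Θ ψ = ∫⁻ Θ : Mat r q, ENNReal.ofReal (normalDensity τ 0 Θ) *
        ⨆ Θ, klRisk vx vy Θ ψ := by
      rw [lintegral_mul_const _ (by fun_prop), lintegral_normalDensity hτ, one_mul]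
    rw [h2, ← h1, ← lintegral_add_left (by fun_prop)]
    refine lintegral_mono fun Θ => ?_
    rw [ENNReal.ofReal_mul (normalDensity_nonneg hτ _ _), ← mul_add]
    gcongr
    exact (hrisk Θ).trans (add_le_add (le_iSup (fun Θ => klRisk vx vy Θ ψ) Θ) le_rfl)
  rw [ENNReal.ofReal_add hL0 zero_le_one, ENNReal.ofReal_one] at hfinal
  exact (ENNReal.add_le_add_iff_right ENNReal.one_ne_top).1 hfinal

/-- No predictive density has a maximal risk below that of the best invariant one. -/
theorem ofReal_le_iSup_klRisk (hvx : 0 < vx) (hvy : 0 < vy) (hψ : IsPredictiveDensity ψ) :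
    ENNReal.ofReal (r * q / 2 * Real.log ((vx + vy) / vy)) ≤ ⨆ Θ, klRisk vx vy Θ ψ := by
  have h1 : Filter.Tendsto (fun τ : ℝ => τ * vx / (τ + vx)) Filter.atTop (𝓝 vx) := by
    have h2 : Filter.Tendsto (fun τ : ℝ => vx - vx ^ 2 / (τ + vx)) Filter.atTop (𝓝 (vx - 0)) :=
      tendsto_const_nhds.sub (Filter.Tendsto.const_div_atTop
        (Filter.tendsto_atTop_add_const_right _ _ Filter.tendsto_id) _)
    rw [sub_zero] at h2
    refine h2.congr' ?_
    filter_upwards [Filter.eventually_gt_atTop 0] with τ hτ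
    field_simp
    ring
  have h3 : Filter.Tendsto (fun τ : ℝ => ENNReal.ofReal
      (r * q / 2 * Real.log ((τ * vx / (τ + vx) + vy) / vy))) Filter.atTop
      (𝓝 (ENNReal.ofReal (r * q / 2 * Real.log ((vx + vy) / vy)))) := by
    refine ENNReal.tendsto_ofReal (Filter.Tendsto.const_mul _ (Filter.Tendsto.log ?_ (by positivity)))
    exact (h1.add_const vy).div_const vy
  refine le_of_tendsto h3 ?_
  filter_upwards [Filter.eventually_gt_atTop 0] with τ hτ
  exact ofReal_le_iSup_klRisk_of_gaussianPrior hvx hvy hψ hτ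

end LowerBound

/-! ### Upper bound: priors decreased by the heat semigroup. -/

section UpperBound

variable {r q : ℕ}

/-- The terms `- f + h` have total integral zero but make the integrand pointwise nonnegative, so
the divergence is a Lebesgue integral without any integrability condition. -/
theorem klDiv_densityMeasure {f h : Mat r q → ℝ} (hf : Measurable f) (hh : Measurable h)
    (hf0 : ∀ Z, 0 ≤ f Z) (hh0 : ∀ Z, 0 < h Z) (hf1 : ∫⁻ Z, ENNReal.ofReal (f Z) = 1)
    (hh1 : ∫⁻ Z, ENNReal.ofReal (h Z) = 1) :
    InformationTheory.klDiv (densityMeasure f) (densityMeasure h) =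
      ∫⁻ Z, ENNReal.ofReal (f Z * Real.log (f Z / h Z) - f Z + h Z) := by
  have := isProbabilityMeasure_densityMeasure hf1
  have := isProbabilityMeasure_densityMeasure hh1
  have hwd : densityMeasure f = (densityMeasure h).withDensity
      fun Z => ENNReal.ofReal (f Z / h Z) := by
    unfold densityMeasure
    rw [← withDensity_mul _ (by fun_prop) (by fun_prop)]
    congr 1
    funext Z
    rw [Pi.mul_apply, ← ENNReal.ofReal_mul (hh0 Z).le, mul_div_cancel₀ _ (hh0 Z).ne']
  have hac : densityMeasure f ≪ densityMeasure h := by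
    rw [hwd]; exact withDensity_absolutelyContinuous _ _
  have hrn : (densityMeasure f).rnDeriv (densityMeasure h) =ᵐ[densityMeasure h]
      fun Z => ENNReal.ofReal (f Z / h Z) := by
    rw [hwd]; exact Measure.rnDeriv_withDensity _ (by fun_prop)
  rw [InformationTheory.klDiv_eq_lintegral_klFun_of_ac hac]
  have h1 : ∫⁻ Z, ENNReal.ofReal (InformationTheory.klFun
      ((densityMeasure f).rnDeriv (densityMeasure h) Z).toReal) ∂(densityMeasure h) =
      ∫⁻ Z, ENNReal.ofReal (InformationTheory.klFun (f Z / h Z)) ∂(densityMeasure h) := by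
    refine lintegral_congr_ae (hrn.mono fun Z hZ => ?_)
    simp only [hZ]
    rw [ENNReal.toReal_ofReal (div_nonneg (hf0 Z) (hh0 Z).le)]
  rw [h1, lintegral_densityMeasure hh]
  refine lintegral_congr fun Z => ?_
  rw [← ENNReal.ofReal_mul (hh0 Z).le, InformationTheory.klFun_apply]
  have := (hh0 Z).ne'
  congr 1
  field_simp
  ring

/-- The marginal density as an extended nonnegative number. -/
def extMarginal (prior : Mat r q → ℝ) (v : ℝ) (X : Mat r q) : ℝ≥0∞ :=
  ∫⁻ Θ, ENNReal.ofReal (normalDensity v Θ X) * ENNReal.ofReal (prior Θ)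

variable {prior : Mat r q → ℝ} {vx vy v w : ℝ}

/-- Transfers finiteness of the marginal from variance `vx` to every smaller variance, in particular
to that of the pooled mean. -/
theorem normalDensity_le_const_mul (hv : 0 < v) (hvw : v ≤ w) (Θ X : Mat r q) :
    normalDensity v Θ X ≤ ((2 * Real.pi * v) ^ (-((q : ℝ) * r / 2)) *
      ((2 * Real.pi * w) ^ (-((q : ℝ) * r / 2)))⁻¹) * normalDensity w Θ X := by
  have hw : 0 < w := hv.trans_le hvw
  unfold normalDensity
  have h1 : 0 < (2 * Real.pi * w) ^ (-((q : ℝ) * r / 2)) := Real.rpow_pos_of_pos (by positivity) _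
  have h2 := frobSq_nonneg (X - Θ)
  rw [← mul_assoc, inv_mul_cancel_right₀ h1.ne']
  gcongr

/-- Dividing the integrable product by the positive Gaussian density recovers measurability of the
prior. -/
theorem aemeasurable_of_integrable_normalDensity_mul (hv : 0 < v) (X : Mat r q)
    (h : Integrable fun Θ : Mat r q => normalDensity v Θ X * prior Θ) : AEMeasurable prior := by
  have h1 : AEMeasurable fun Θ => (normalDensity v Θ X)⁻¹ * (normalDensity v Θ X * prior Θ) :=
    AEMeasurable.mul (Measurable.aemeasurable (by fun_prop)) h.aemeasurable
  refine h1.congr (.of_forall fun Θ => ?_)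
  exact inv_mul_cancel_left₀ (normalDensity_pos hv _ _).ne' _

theorem extMarginal_ne_top (hv : 0 < v) (hvw : v ≤ w) {X : Mat r q}
    (h : Integrable fun Θ : Mat r q => normalDensity w Θ X * prior Θ) :
    extMarginal prior v X ≠ ⊤ := by
  have hw : 0 < w := hv.trans_le hvw
  have h1 : ∫⁻ Θ, ENNReal.ofReal (normalDensity w Θ X * prior Θ) ≠ ⊤ := h.lintegral_lt_top.ne
  set C := (2 * Real.pi * v) ^ (-((q : ℝ) * r / 2)) *
      ((2 * Real.pi * w) ^ (-((q : ℝ) * r / 2)))⁻¹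
  have hC : 0 ≤ C := by positivity
  refine ne_top_of_le_ne_top (ENNReal.mul_ne_top (ENNReal.ofReal_ne_top (r := C)) h1) ?_
  rw [← lintegral_const_mul' _ _ ENNReal.ofReal_ne_top]
  refine lintegral_mono fun Θ => ?_
  rw [ENNReal.ofReal_mul (normalDensity_nonneg hw _ _), ← mul_assoc, ← ENNReal.ofReal_mul hC]
  gcongr
  exact normalDensity_le_const_mul hv hvw _ _

theorem extMarginal_pos (hm : AEMeasurable prior) (h0 : ∀ Θ, 0 ≤ prior Θ)
    (hne : ¬ prior =ᵐ[volume] 0) (hv : 0 < v) (X : Mat r q) : 0 < extMarginal prior v X := by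
  rw [pos_iff_ne_zero]
  intro h
  have hmeas : AEMeasurable fun Θ => ENNReal.ofReal (normalDensity v Θ X) *
      ENNReal.ofReal (prior Θ) :=
    AEMeasurable.mul (Measurable.aemeasurable (by fun_prop)) hm.ennreal_ofReal
  rw [extMarginal, lintegral_eq_zero_iff' hmeas] at h
  refine hne (h.mono fun Θ hΘ => ?_)
  simp only [Pi.zero_apply, mul_eq_zero, ENNReal.ofReal_eq_zero] at hΘ
  rcases hΘ with hΘ | hΘ
  · exact absurd hΘ (not_le.2 (normalDensity_pos hv _ _))
  · exact le_antisymm hΘ (h0 Θ)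

theorem measurable_extMarginal (hm : AEMeasurable prior) (v : ℝ) :
    Measurable (extMarginal prior v) := by
  have h : extMarginal prior v = fun X => ∫⁻ Θ, ENNReal.ofReal (normalDensity v Θ X) *
      ENNReal.ofReal (hm.mk prior Θ) := by
    funext X
    refine lintegral_congr_ae (hm.ae_eq_mk.mono fun Θ hΘ => ?_)
    simp only [hΘ]
  rw [h]
  have h2 : Measurable fun p : Mat r q × Mat r q => hm.mk prior p.2 :=
    hm.measurable_mk.comp measurable_snd
  have h3 : Measurable fun p : Mat r q × Mat r q => ENNReal.ofReal (normalDensity v p.2 p.1) *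
      ENNReal.ofReal (hm.mk prior p.2) := Measurable.mul (by fun_prop) h2.ennreal_ofReal
  exact h3.lintegral_prod_right'

theorem marginal_eq_toReal (hm : AEMeasurable prior) (h0 : ∀ Θ, 0 ≤ prior Θ) (hv : 0 < v)
    (X : Mat r q) : marginal prior v X = (extMarginal prior v X).toReal := by
  rw [marginal, integral_eq_lintegral_of_nonneg_ae
    (.of_forall fun Θ => mul_nonneg (normalDensity_nonneg hv _ _) (h0 Θ))
    (AEMeasurable.mul (Measurable.aemeasurable (by fun_prop)) hm).aestronglyMeasurable, extMarginal]
  simp_rw [ENNReal.ofReal_mul (normalDensity_nonneg hv _ _)]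

/-- The sufficient statistic for `Θ` based on `X` and `Y`. -/
def pooledMean (vx vy : ℝ) (X Y : Mat r q) : Mat r q := (vx + vy)⁻¹ • (vy • X + vx • Y)

@[fun_prop]
theorem measurable_pooledMean (vx vy : ℝ) :
    Measurable fun p : Mat r q × Mat r q => pooledMean vx vy p.1 p.2 := by
  unfold pooledMean; fun_prop

/-- Completing the square in `Θ` exhibits the Bayes density as the invariant density $N(X,v_x+v_y)$
corrected by a ratio of marginals at two variances. -/
theorem bayesPredictive_eq (hvx : 0 < vx) (hvy : 0 < vy) (X Y : Mat r q) :
    bayesPredictive prior vx vy X Y = normalDensity (vx + vy) X Y *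
      marginal prior (vx * vy / (vx + vy)) (pooledMean vx vy X Y) / marginal prior vx X := by
  unfold bayesPredictive
  congr 1
  rw [marginal, ← integral_const_mul]
  refine integral_congr_ae (.of_forall fun Θ => ?_)
  simp only [normalDensity_mul_normalDensity hvx hvy, pooledMean]
  ring

theorem lintegral_normalDensity_mul_extMarginal (hm : AEMeasurable prior) (hvx : 0 < vx)
    (hvy : 0 < vy) (X : Mat r q) :
    ∫⁻ Y, ENNReal.ofReal (normalDensity (vx + vy) X Y) *
      extMarginal prior (vx * vy / (vx + vy)) (pooledMean vx vy X Y) = extMarginal prior vx X := by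
  calc _ = ∫⁻ Y, ∫⁻ Θ : Mat r q, ENNReal.ofReal (normalDensity vy Θ Y) *
        (ENNReal.ofReal (normalDensity vx Θ X) * ENNReal.ofReal (prior Θ)) := by
        refine lintegral_congr fun Y => ?_
        rw [extMarginal, ← lintegral_const_mul' _ _ ENNReal.ofReal_ne_top]
        refine lintegral_congr fun Θ => ?_
        rw [← mul_assoc, ← mul_assoc, ← ENNReal.ofReal_mul (normalDensity_nonneg (by positivity) _ _),
          ← ENNReal.ofReal_mul (normalDensity_nonneg (by positivity) _ _),
          mul_comm (normalDensity vy Θ Y), normalDensity_mul_normalDensity hvx hvy, pooledMean,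
          mul_comm (normalDensity (vx + vy) X Y)]
    _ = ∫⁻ Θ : Mat r q, ∫⁻ Y, ENNReal.ofReal (normalDensity vy Θ Y) *
        (ENNReal.ofReal (normalDensity vx Θ X) * ENNReal.ofReal (prior Θ)) := by
        refine lintegral_lintegral_swap ?_
        have m1 : Measurable fun p : Mat r q × Mat r q =>
          ENNReal.ofReal (normalDensity vy p.2 p.1) := by fun_prop
        have m2 : Measurable fun p : Mat r q × Mat r q =>
          ENNReal.ofReal (normalDensity vx p.2 X) := by fun_prop
        exact m1.aemeasurable.mul (m2.aemeasurable.mul (hm.comp_quasiMeasurePreserving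
          Measure.quasiMeasurePreserving_snd).ennreal_ofReal)
    _ = extMarginal prior vx X := by
        refine lintegral_congr fun Θ => ?_
        rw [lintegral_mul_const _ (by fun_prop), lintegral_normalDensity hvy, one_mul]

/-- For fixed `X` the pooled mean is affine in `Y` with slope `vx / (vx + vy)`, and the power is the
Jacobian. In the new variable `W`, the observation `X` is normal about `W` with variance `vx ^ 2 /
(vx + vy)`. -/
theorem normalDensity_eq_smul_pooledMean (hvx : 0 < vx) (hvy : 0 < vy) (X Y : Mat r q) :
    normalDensity (vx + vy) X Y = (vx / (vx + vy)) ^ (r * q) *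
      normalDensity (vx ^ 2 / (vx + vy)) (pooledMean vx vy X Y) X := by
  have hs : 0 < vx + vy := by positivity
  have hc : 0 < vx / (vx + vy) := by positivity
  unfold normalDensity
  have h1 : (2 * Real.pi * (vx ^ 2 / (vx + vy))) ^ (-((q : ℝ) * r / 2)) =
      (2 * Real.pi * (vx + vy)) ^ (-((q : ℝ) * r / 2)) * ((vx / (vx + vy)) ^ (r * q))⁻¹ := by
    have : 2 * Real.pi * (vx ^ 2 / (vx + vy)) =
        (2 * Real.pi * (vx + vy)) * (vx / (vx + vy)) ^ (2 : ℝ) := by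
      rw [Real.rpow_two]; field_simp
    rw [this, Real.mul_rpow (by positivity) (by positivity), ← Real.rpow_mul hc.le,
      ← Real.rpow_natCast, ← Real.rpow_neg hc.le]
    congr 2
    push_cast
    ring
  have h2 : X - pooledMean vx vy X Y = (vx / (vx + vy)) • (X - Y) := by
    ext i j
    simp only [pooledMean, Pi.sub_apply, Pi.smul_apply, Pi.add_apply, smul_eq_mul]
    field_simp
    ring
  rw [h1, h2, frobSq_smul, frobSq_sub_comm]
  have h3 : 0 < (vx / (vx + vy)) ^ (r * q) := by positivity
  field_simp

/-- Under the coupling of `X` with the sufficient statistic, the ratio of marginals has mean at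
most one. -/
theorem lintegral_extMarginal_ratio_le (hm : AEMeasurable prior) (h0 : ∀ Θ, 0 ≤ prior Θ)
    (hne : ¬ prior =ᵐ[volume] 0) (hvx : 0 < vx) (hvy : 0 < vy)
    (hfin : ∀ X : Mat r q, Integrable fun Θ : Mat r q => normalDensity vx Θ X * prior Θ)
    (hheat : ∀ s : ℝ, 0 < s → ∀ᵐ Z : Mat r q, extMarginal prior s Z ≤ ENNReal.ofReal (prior Z))
    (Θ : Mat r q) :
    ∫⁻ X, ENNReal.ofReal (normalDensity vx Θ X) * ∫⁻ Y, ENNReal.ofReal (normalDensity vy Θ Y) *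
      (extMarginal prior vx X / extMarginal prior (vx * vy / (vx + vy)) (pooledMean vx vy X Y)) ≤
      1 := by
  have hs0 : 0 < vx + vy := by positivity
  have hc : 0 < vx / (vx + vy) := by positivity
  set u := vx * vy / (vx + vy) with hu
  have hu0 : 0 < u := by positivity
  have huvx : u ≤ vx := by
    rw [hu, div_le_iff₀ hs0]; nlinarith
  set s := vx ^ 2 / (vx + vy) with hs
  have hs' : 0 < s := by positivity
  have hm1 := measurable_extMarginal hm vx
  have hm2 := measurable_extMarginal hm u
  -- By the semigroup law the left side is the marginal at variance `s + vx = u + 2 * s`, since `vx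
  -- = u + s`. The hypothesis `hheat` at time `2 * s` lowers it to variance `u`.
  have hsuper : ∀ W, ∫⁻ X, ENNReal.ofReal (normalDensity s W X) * extMarginal prior vx X ≤
      extMarginal prior u W := by
    intro W
    have hswap : ∀ {a b : ℝ}, 0 < a → 0 < b →
        ∫⁻ X, ENNReal.ofReal (normalDensity a W X) * extMarginal prior b X =
          extMarginal prior (a + b) W := by
      intro a b ha hb
      unfold extMarginal
      simp_rw [← lintegral_const_mul' _ _ ENNReal.ofReal_ne_top, ← mul_assoc]
      rw [lintegral_lintegral_swap]
      · refine lintegral_congr fun Θ => ?_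
        rw [lintegral_mul_const _ (by fun_prop), normalDensity_comm (a + b),
          ← lintegral_normalDensity_mul ha hb]
        simp_rw [normalDensity_comm a W, normalDensity_comm b Θ]
      · have m1 : Measurable fun p : Mat r q × Mat r q => ENNReal.ofReal (normalDensity a W p.1) *
          ENNReal.ofReal (normalDensity b p.2 p.1) := by fun_prop
        exact m1.aemeasurable.mul (hm.comp_quasiMeasurePreserving
          Measure.quasiMeasurePreserving_snd).ennreal_ofReal
    have he : s + vx = u + 2 * s := by
      simp only [hs, hu]; field_simp; ring
    rw [hswap hs' hvx, he, ← hswap hu0 (by positivity), extMarginal]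
    refine lintegral_mono_ae ((hheat (2 * s) (by positivity)).mono fun Z hZ => ?_)
    rw [normalDensity_comm]
    gcongr
  calc _ = ∫⁻ X, ∫⁻ W, ENNReal.ofReal (normalDensity u Θ W) *
        (ENNReal.ofReal (normalDensity s W X) * (extMarginal prior vx X / extMarginal prior u W)) := by
        refine lintegral_congr fun X => ?_
        rw [← lintegral_const_mul' _ _ ENNReal.ofReal_ne_top]
        -- The integrand as a function of the pooled mean, with the Jacobian that the substitution
        -- from `Y` to `W` removes.
        set h : Mat r q → ℝ≥0∞ := fun W => ENNReal.ofReal ((vx / (vx + vy)) ^ (r * q)) *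
          (ENNReal.ofReal (normalDensity u Θ W) * (ENNReal.ofReal (normalDensity s W X) *
            (extMarginal prior vx X / extMarginal prior u W))) with hh
        have h1 : ∀ Y, ENNReal.ofReal (normalDensity vx Θ X) *
            (ENNReal.ofReal (normalDensity vy Θ Y) *
              (extMarginal prior vx X / extMarginal prior u (pooledMean vx vy X Y))) =
            h ((vx / (vx + vy)) • Y + (vy / (vx + vy)) • X) := by
          intro Y
          have h2 : (vx / (vx + vy)) • Y + (vy / (vx + vy)) • X = pooledMean vx vy X Y := by
            rw [pooledMean, smul_add, smul_smul, smul_smul, add_comm, inv_mul_eq_div, inv_mul_eq_div]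
          simp only [h2, hh]
          rw [← mul_assoc, ← ENNReal.ofReal_mul (normalDensity_nonneg hvx _ _),
            normalDensity_mul_normalDensity hvx hvy, normalDensity_eq_smul_pooledMean hvx hvy,
            ENNReal.ofReal_mul (normalDensity_nonneg hu0 _ _), ENNReal.ofReal_mul (by positivity),
            ← pooledMean]
          ring
        simp_rw [h1]
        rw [lintegral_comp_smul_add hc, hh, lintegral_const_mul' _ _ ENNReal.ofReal_ne_top, ← mul_assoc,
          ← ENNReal.ofReal_mul (by positivity), inv_mul_cancel₀ (by positivity), ENNReal.ofReal_one,
          one_mul]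
    _ = ∫⁻ W, ∫⁻ X, ENNReal.ofReal (normalDensity u Θ W) *
        (ENNReal.ofReal (normalDensity s W X) * (extMarginal prior vx X / extMarginal prior u W)) := by
        refine lintegral_lintegral_swap (Measurable.aemeasurable ?_)
        have m1 : Measurable fun p : Mat r q × Mat r q =>
          ENNReal.ofReal (normalDensity u Θ p.2) := by fun_prop
        have m2 : Measurable fun p : Mat r q × Mat r q =>
          ENNReal.ofReal (normalDensity s p.2 p.1) := by fun_prop
        exact m1.mul (m2.mul ((hm1.comp measurable_fst).div (hm2.comp measurable_snd)))
    _ ≤ ∫⁻ W, ENNReal.ofReal (normalDensity u Θ W) := by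
        refine lintegral_mono fun W => ?_
        rw [lintegral_const_mul' _ _ ENNReal.ofReal_ne_top]
        have hpos := extMarginal_pos hm h0 hne hu0 W
        have htop := extMarginal_ne_top (prior := prior) hu0 huvx (hfin W)
        calc _ = ENNReal.ofReal (normalDensity u Θ W) *
              ((∫⁻ X, ENNReal.ofReal (normalDensity s W X) * extMarginal prior vx X) *
                (extMarginal prior u W)⁻¹) := by
              rw [← lintegral_mul_const _ (by fun_prop)]
              simp_rw [div_eq_mul_inv, mul_assoc]
          _ ≤ ENNReal.ofReal (normalDensity u Θ W) *
              (extMarginal prior u W * (extMarginal prior u W)⁻¹) := by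
              gcongr; exact hsuper W
          _ = _ := by rw [ENNReal.mul_inv_cancel hpos.ne' htop, mul_one]
    _ = 1 := lintegral_normalDensity hu0 Θ

/-- A prior decreased by the heat semigroup has a minimax Bayesian predictive density. -/
theorem isKLMinimax_bayesPredictive (h0 : ∀ Θ, 0 ≤ prior Θ)
    (hne : ¬ prior =ᵐ[volume] 0) (hvx : 0 < vx) (hvy : 0 < vy)
    (hfin : ∀ X : Mat r q, Integrable fun Θ : Mat r q => normalDensity vx Θ X * prior Θ)
    (hheat : ∀ s : ℝ, 0 < s → ∀ᵐ Z : Mat r q, extMarginal prior s Z ≤ ENNReal.ofReal (prior Z)) :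
    IsKLMinimax vx vy (bayesPredictive prior vx vy) := by
  have hm := aemeasurable_of_integrable_normalDensity_mul hvx 0 (hfin 0)
  have hs0 : 0 < vx + vy := by positivity
  set u := vx * vy / (vx + vy) with hu
  have hu0 : 0 < u := by positivity
  have huvx : u ≤ vx := by
    rw [hu, div_le_iff₀ hs0]; nlinarith
  have hm1 := measurable_extMarginal hm vx
  have hm2 := measurable_extMarginal hm u
  have hM1 : ∀ X, marginal prior vx X = (extMarginal prior vx X).toReal :=
    marginal_eq_toReal hm h0 hvx
  have hM2 : ∀ X, marginal prior u X = (extMarginal prior u X).toReal :=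
    marginal_eq_toReal hm h0 hu0
  have hf1 : ∀ X, extMarginal prior vx X ≠ ⊤ := fun X => extMarginal_ne_top hvx le_rfl (hfin X)
  have hf2 : ∀ X, extMarginal prior u X ≠ ⊤ := fun X => extMarginal_ne_top hu0 huvx (hfin X)
  have hp1 : ∀ X, 0 < marginal prior vx X := fun X => by
    rw [hM1]; exact ENNReal.toReal_pos (extMarginal_pos hm h0 hne hvx X).ne' (hf1 X)
  have hp2 : ∀ X, 0 < marginal prior u X := fun X => by
    rw [hM2]; exact ENNReal.toReal_pos (extMarginal_pos hm h0 hne hu0 X).ne' (hf2 X)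
  have hmm1 : Measurable (marginal prior vx) := by
    rw [show marginal prior vx = _ from funext hM1]; exact hm1.ennreal_toReal
  have hmm2 : Measurable (marginal prior u) := by
    rw [show marginal prior u = _ from funext hM2]; exact hm2.ennreal_toReal
  have hbeq : ∀ X Y, bayesPredictive prior vx vy X Y = normalDensity (vx + vy) X Y *
      marginal prior u (pooledMean vx vy X Y) / marginal prior vx X :=
    bayesPredictive_eq hvx hvy
  have hbpos : ∀ X Y, 0 < bayesPredictive prior vx vy X Y := fun X Y => by
    rw [hbeq]
    exact div_pos (mul_pos (normalDensity_pos hs0 _ _) (hp2 _)) (hp1 X)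
  have hpred : IsPredictiveDensity (bayesPredictive prior vx vy) := by
    refine ⟨?_, fun X Y => (hbpos X Y).le, fun X => ?_⟩
    · have : Function.uncurry (bayesPredictive prior vx vy) = fun p : Mat r q × Mat r q =>
          normalDensity (vx + vy) p.1 p.2 * marginal prior u (pooledMean vx vy p.1 p.2) /
            marginal prior vx p.1 := funext fun p => hbeq p.1 p.2
      rw [this]
      exact (Measurable.mul (by fun_prop) (hmm2.comp (by fun_prop))).div
        (hmm1.comp measurable_fst)
    · have h1 : ∀ Y, ENNReal.ofReal (bayesPredictive prior vx vy X Y) =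
          (extMarginal prior vx X)⁻¹ * (ENNReal.ofReal (normalDensity (vx + vy) X Y) *
            extMarginal prior u (pooledMean vx vy X Y)) := by
        intro Y
        rw [hbeq, ENNReal.ofReal_div_of_pos (hp1 X),
          ENNReal.ofReal_mul (normalDensity_nonneg hs0 _ _), hM1, hM2,
          ENNReal.ofReal_toReal (hf1 X), ENNReal.ofReal_toReal (hf2 _), div_eq_mul_inv, mul_comm]
      simp_rw [h1]
      rw [lintegral_const_mul' _ _ (ENNReal.inv_ne_top.2 (extMarginal_pos hm h0 hne hvx X).ne'),
        lintegral_normalDensity_mul_extMarginal hm hvx hvy,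
        ENNReal.inv_mul_cancel (extMarginal_pos hm h0 hne hvx X).ne' (hf1 X)]
  refine ⟨hpred, fun ψ hψ => le_trans (iSup_le fun Θ => ?_) (ofReal_le_iSup_klRisk hvx hvy hψ)⟩
  set c := r * q / 2 * Real.log ((vx + vy) / vy) with hc
  have hc0 : 0 ≤ c := by
    refine mul_nonneg (by positivity) (Real.log_nonneg ?_)
    rw [le_div_iff₀ hvy]; linarith
  have hbX : ∀ X, Measurable (bayesPredictive prior vx vy X) := fun X =>
    hpred.measurable.of_uncurry_left
  have hpm : ∀ X : Mat r q, Measurable fun Y : Mat r q => pooledMean vx vy X Y := fun X => by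
    unfold pooledMean; fun_prop
  -- All negative terms are moved to the left so that both sides are Lebesgue integrals of
  -- nonnegative functions: `2` comes from twice the density of `Y`, and `r * q / 2` from its
  -- quadratic exponent. The `1` on the right is the total mass of the Bayes density.
  have hloss : ∀ X, klLoss vy Θ (bayesPredictive prior vx vy X) + ENNReal.ofReal (2 + r * q / 2) ≤
      ENNReal.ofReal (c + 1 + (r * q * vy + frobSq (Θ - X)) / (2 * (vx + vy))) +
        ∫⁻ Y, ENNReal.ofReal (normalDensity vy Θ Y) *
          (extMarginal prior vx X / extMarginal prior u (pooledMean vx vy X Y)) := by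
    intro X
    obtain ⟨i1, e1⟩ := normalDensity_mul_frobSq hvy Θ Θ
    obtain ⟨i2, e2⟩ := normalDensity_mul_frobSq hvy Θ X
    have i0 := integrable_normalDensity hvy Θ
    have hz : frobSq (Θ - Θ) = 0 := by simp [frobSq]
    rw [klLoss, klDiv_densityMeasure (by fun_prop) (hbX X) (normalDensity_nonneg hvy Θ) (hbpos X)
      (lintegral_normalDensity hvy Θ) (hpred.lintegral_eq_one X)]
    have i4 : Integrable fun Y => normalDensity vy Θ Y * 2 +
        (2 * vy)⁻¹ * (normalDensity vy Θ Y * frobSq (Y - Θ)) := (i0.mul_const 2).add (i1.const_mul _)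
    have hA : ENNReal.ofReal (2 + r * q / 2) = ∫⁻ Y, ENNReal.ofReal (normalDensity vy Θ Y * 2 +
        (2 * vy)⁻¹ * (normalDensity vy Θ Y * frobSq (Y - Θ))) := by
      rw [← ofReal_integral_eq_lintegral_ofReal i4
        (.of_forall fun Y => ?_), integral_add (i0.mul_const 2) (i1.const_mul _),
        integral_mul_const, integral_const_mul, e1, integral_normalDensity hvy, hz]
      · congr 1; field_simp; ring
      · have := normalDensity_nonneg hvy Θ Y
        have := frobSq_nonneg (Y - Θ)
        show 0 ≤ _
        positivity
    have i3 : Integrable fun Y => normalDensity vy Θ Y * c + (2 * (vx + vy))⁻¹ *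
        (normalDensity vy Θ Y * frobSq (Y - X)) := (i0.mul_const c).add (i2.const_mul _)
    have hB : ENNReal.ofReal (c + (r * q * vy + frobSq (Θ - X)) / (2 * (vx + vy))) =
        ∫⁻ Y, ENNReal.ofReal (normalDensity vy Θ Y * c + (2 * (vx + vy))⁻¹ *
          (normalDensity vy Θ Y * frobSq (Y - X))) := by
      rw [← ofReal_integral_eq_lintegral_ofReal i3
        (.of_forall fun Y => ?_), integral_add (i0.mul_const c) (i2.const_mul _),
        integral_mul_const, integral_const_mul, e2, integral_normalDensity hvy]
      · congr 1; field_simp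
      · have := normalDensity_nonneg hvy Θ Y
        have := frobSq_nonneg (Y - X)
        show 0 ≤ _
        positivity
    have hfn := frobSq_nonneg (Θ - X)
    rw [add_right_comm, ENNReal.ofReal_add (by positivity) zero_le_one, ENNReal.ofReal_one, hA, hB,
      ← hpred.lintegral_eq_one X, ← lintegral_add_right _ (by fun_prop),
      ← lintegral_add_right _ (hbX X).ennreal_ofReal, ← lintegral_add_right _ (by
        have h1 : Measurable fun Y => extMarginal prior u (pooledMean vx vy X Y) := hm2.comp (hpm X)
        exact Measurable.mul (by fun_prop) (measurable_const.div h1))]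
    refine lintegral_mono fun Y => ?_
    have hN := normalDensity_pos hvy Θ Y
    have hN' := normalDensity_pos hs0 X Y
    have hb := hbpos X Y
    have hρ : extMarginal prior vx X / extMarginal prior u (pooledMean vx vy X Y) =
        ENNReal.ofReal (marginal prior vx X / marginal prior u (pooledMean vx vy X Y)) := by
      rw [ENNReal.ofReal_div_of_pos (hp2 _), hM1, hM2, ENNReal.ofReal_toReal (hf1 X),
        ENNReal.ofReal_toReal (hf2 _)]
    set ρ := marginal prior vx X / marginal prior u (pooledMean vx vy X Y) with hρdef
    have hρ0 : 0 < ρ := div_pos (hp1 _) (hp2 _)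
    have hf1' := frobSq_nonneg (Y - X)
    have hf2' := frobSq_nonneg (Y - Θ)
    -- The bound $\log\rho\le\rho-1$ replaces a logarithm of unknown integrability by a ratio whose
    -- mean is at most one.
    have hlog : Real.log (normalDensity vy Θ Y / bayesPredictive prior vx vy X Y) ≤
        Real.log (normalDensity vy Θ Y / normalDensity (vx + vy) X Y) + (ρ - 1) := by
      have : normalDensity vy Θ Y / bayesPredictive prior vx vy X Y =
          (normalDensity vy Θ Y / normalDensity (vx + vy) X Y) * ρ := by
        rw [hbeq, hρdef]
        have := hp1 X
        have := hp2 (pooledMean vx vy X Y)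
        field_simp
      rw [this, Real.log_mul (by positivity) hρ0.ne']
      gcongr
      exact Real.log_le_sub_one_of_pos hρ0
    rw [log_normalDensity_div hvy hs0] at hlog
    have hkl : 0 ≤ normalDensity vy Θ Y *
        Real.log (normalDensity vy Θ Y / bayesPredictive prior vx vy X Y) -
        normalDensity vy Θ Y + bayesPredictive prior vx vy X Y := by
      have h1 := Real.log_le_sub_one_of_pos (div_pos hb hN)
      rw [← inv_div (normalDensity vy Θ Y), Real.log_inv, inv_div] at h1
      have h2 := mul_le_mul_of_nonneg_left h1 hN.le
      have h3 : normalDensity vy Θ Y * (bayesPredictive prior vx vy X Y / normalDensity vy Θ Y - 1)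
        = bayesPredictive prior vx vy X Y - normalDensity vy Θ Y := by field_simp
      linarith
    rw [hρ, ← ENNReal.ofReal_mul hN.le, ← ENNReal.ofReal_add hkl (by positivity),
      ← ENNReal.ofReal_add (by positivity) hb.le, ← ENNReal.ofReal_add (by positivity)
        (by positivity)]
    refine ENNReal.ofReal_le_ofReal ?_
    have h2 := mul_le_mul_of_nonneg_left hlog hN.le
    have h3 : normalDensity vy Θ Y * (r * q / 2 * Real.log ((vx + vy) / vy) -
        frobSq (Y - Θ) / (2 * vy) + frobSq (Y - X) / (2 * (vx + vy)) + (ρ - 1)) =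
        normalDensity vy Θ Y * c - (2 * vy)⁻¹ * (normalDensity vy Θ Y * frobSq (Y - Θ)) +
        (2 * (vx + vy))⁻¹ * (normalDensity vy Θ Y * frobSq (Y - X)) + normalDensity vy Θ Y * ρ -
        normalDensity vy Θ Y := by
      rw [hc]; field_simp; ring
    linarith
  have hmain : klRisk vx vy Θ (bayesPredictive prior vx vy) + ENNReal.ofReal (2 + r * q / 2) ≤
      ENNReal.ofReal c + ENNReal.ofReal (2 + r * q / 2) := by
    obtain ⟨i1, e1⟩ := normalDensity_mul_frobSq hvx Θ Θ
    have i0 := integrable_normalDensity hvx Θ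
    have hz : frobSq (Θ - Θ) = 0 := by simp [frobSq]
    calc _ = ∫⁻ X, ENNReal.ofReal (normalDensity vx Θ X) *
          (klLoss vy Θ (bayesPredictive prior vx vy X) + ENNReal.ofReal (2 + r * q / 2)) := by
          rw [klRisk, lintegral_densityMeasure (by fun_prop)]
          simp_rw [mul_add]
          rw [lintegral_add_right _ (by fun_prop), lintegral_mul_const _ (by fun_prop),
            lintegral_normalDensity hvx, one_mul]
      _ ≤ ∫⁻ X, (ENNReal.ofReal (normalDensity vx Θ X * (c + 1 + (r * q * vy) / (2 * (vx + vy))) +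
            (2 * (vx + vy))⁻¹ * (normalDensity vx Θ X * frobSq (X - Θ))) +
            ENNReal.ofReal (normalDensity vx Θ X) * ∫⁻ Y, ENNReal.ofReal (normalDensity vy Θ Y) *
          (extMarginal prior vx X / extMarginal prior u (pooledMean vx vy X Y))) := by
          refine lintegral_mono fun X => ?_
          refine (mul_le_mul_right (hloss X) _).trans (le_of_eq ?_)
          rw [mul_add, ← ENNReal.ofReal_mul (normalDensity_nonneg hvx _ _), frobSq_sub_comm Θ X]
          congr 2
          field_simp
          ring
      -- Averaging the squared distance over `X` contributes `r * q * vx`, so the quadratic part is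
      -- `r * q / 2`; the final `1` bounds the mean of the ratio.
      _ ≤ ENNReal.ofReal (c + 1 + r * q / 2) + 1 := by
          rw [lintegral_add_left (by fun_prop)]
          refine add_le_add (le_of_eq ?_)
            (lintegral_extMarginal_ratio_le hm h0 hne hvx hvy hfin hheat Θ)
          have i4 : Integrable fun X => normalDensity vx Θ X *
              (c + 1 + (r * q * vy) / (2 * (vx + vy))) +
              (2 * (vx + vy))⁻¹ * (normalDensity vx Θ X * frobSq (X - Θ)) :=
            (i0.mul_const _).add (i1.const_mul _)
          rw [← ofReal_integral_eq_lintegral_ofReal i4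
            (.of_forall fun Y => ?_), integral_add (i0.mul_const _) (i1.const_mul _),
            integral_mul_const, integral_const_mul, e1, integral_normalDensity hvx, hz]
          · congr 1; field_simp; ring
          · have := normalDensity_nonneg hvx Θ Y
            have := frobSq_nonneg (Y - Θ)
            show 0 ≤ _
            positivity
      _ = _ := by
          rw [← ENNReal.ofReal_one, ← ENNReal.ofReal_add (by positivity) zero_le_one,
            ← ENNReal.ofReal_add hc0 (by positivity)]
          congr 1
          ring
  exact (ENNReal.add_le_add_iff_right ENNReal.ofReal_ne_top).1 hmain

end UpperBound

/-! ### Second derivatives along lines and minimum tests. -/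

section LineDerivatives

/-- `φ` is differentiable near the origin and `φ''(0) = a`. -/
def HasSecondDerivAtZero (φ : ℝ → ℝ) (a : ℝ) : Prop :=
  (∀ᶠ s in 𝓝 0, DifferentiableAt ℝ φ s) ∧ HasDerivAt (deriv φ) a 0

theorem HasSecondDerivAtZero.of_hasDerivAt {φ φ' : ℝ → ℝ} {a : ℝ}
    (h : ∀ᶠ s in 𝓝 0, HasDerivAt φ (φ' s) s) (h' : HasDerivAt φ' a 0) :
    HasSecondDerivAtZero φ a :=
  ⟨h.mono fun _ hs => hs.differentiableAt,
    h'.congr_of_eventuallyEq (h.mono fun _ hs => hs.deriv)⟩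

theorem HasSecondDerivAtZero.add {φ ψ : ℝ → ℝ} {a b : ℝ} (hφ : HasSecondDerivAtZero φ a)
    (hψ : HasSecondDerivAtZero ψ b) : HasSecondDerivAtZero (fun s => φ s + ψ s) (a + b) :=
  .of_hasDerivAt (by
    filter_upwards [hφ.1, hψ.1] with s h1 h2 using h1.hasDerivAt.add h2.hasDerivAt)
    (hφ.2.add hψ.2)

theorem HasSecondDerivAtZero.const_mul {φ : ℝ → ℝ} {a : ℝ} (c : ℝ)
    (hφ : HasSecondDerivAtZero φ a) : HasSecondDerivAtZero (fun s => c * φ s) (c * a) :=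
  .of_hasDerivAt (by filter_upwards [hφ.1] with s h1 using h1.hasDerivAt.const_mul c)
    (hφ.2.const_mul c)

/-- If `a` were negative, the second derivative test would make the origin a local maximum as well.
Then `φ` would be locally constant and `a` would be 0. -/
theorem HasSecondDerivAtZero.nonneg_of_isLocalMin {φ : ℝ → ℝ} {a : ℝ}
    (hφ : HasSecondDerivAtZero φ a) (hmin : IsLocalMin φ 0) : 0 ≤ a := by
  by_contra! ha
  have hd : deriv φ 0 = 0 := hmin.deriv_eq_zero
  have hmax : IsLocalMax φ 0 := by
    have h1 : IsLocalMin (fun s => -φ s) 0 := by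
      refine isLocalMin_of_deriv_deriv_pos ?_ ?_ ?_
      · have : deriv (fun s => -φ s) = fun s => -deriv φ s := by
          funext s; exact deriv.fun_neg
        rw [this, deriv.fun_neg, hφ.2.deriv]
        linarith
      · rw [deriv.fun_neg, hd, neg_zero]
      · exact hφ.1.self_of_nhds.continuousAt.neg
    simpa using h1.neg
  have hconst : φ =ᶠ[𝓝 0] fun _ => φ 0 := by
    filter_upwards [hmin, hmax] with s h1 h2 using le_antisymm h2 h1
  have h2 : deriv φ =ᶠ[𝓝 0] fun _ => 0 := by
    filter_upwards [hconst.eventuallyEq_nhds] with s hs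
    rw [hs.deriv_eq]; simp
  have h3 := h2.deriv_eq
  rw [hφ.2.deriv] at h3
  simp at h3
  linarith

/-- Only earlier times are compared, because the minimum in time may sit at the right end of the
interval. -/
theorem nonpos_of_hasDerivAt_of_forall_le {φ : ℝ → ℝ} {a T : ℝ} (hT : 0 < T)
    (hφ : HasDerivAt φ a T) (hmin : ∀ t, 0 ≤ t → t ≤ T → φ T ≤ φ t) : a ≤ 0 := by
  have h := hφ.hasDerivWithinAt (s := Set.Iio T)
  rw [hasDerivWithinAt_iff_tendsto_slope' (by simp)] at h
  refine le_of_tendsto h ?_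
  have h0 : ∀ᶠ t in 𝓝[<] T, 0 < t := nhdsWithin_le_nhds (eventually_gt_nhds hT)
  filter_upwards [h0, self_mem_nhdsWithin] with t h1 h2
  rw [slope_def_field]
  exact div_nonpos_of_nonneg_of_nonpos (sub_nonneg.2 (hmin t h1.le (le_of_lt h2)))
    (sub_nonpos.2 (le_of_lt h2))

/-- A minimum would give $\varphi(s)\ge\varphi(0)+c|s|$ near 0. Then $\varphi'(0)=0$, so
$\varphi(s)-\varphi(0)=o(s)$, a contradiction. -/
theorem not_isLocalMin_sub_abs {φ : ℝ → ℝ} {c : ℝ} (hc : 0 < c) (hφ : DifferentiableAt ℝ φ 0) :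
    ¬ IsLocalMin (fun s => φ s - c * |s|) 0 := by
  intro hmin
  have h1 : ∀ᶠ s in 𝓝 0, φ 0 + c * |s| ≤ φ s := by
    filter_upwards [hmin] with s hs
    simp at hs
    linarith
  have hloc : IsLocalMin φ 0 := by
    filter_upwards [h1] with s hs
    have := mul_nonneg hc.le (abs_nonneg s)
    linarith
  have hd := hφ.hasDerivAt
  rw [hloc.deriv_eq_zero, hasDerivAt_iff_isLittleO] at hd
  have h2 := hd.bound (half_pos hc)
  simp only [sub_zero, smul_zero] at h2
  obtain ⟨s, ⟨hs1, hs2⟩, hs3⟩ := ((h1.and h2).filter_mono nhdsWithin_le_nhds |>.and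
    (self_mem_nhdsWithin : Set.Ioi (0 : ℝ) ∈ 𝓝[>] 0)).exists
  simp only [Real.norm_eq_abs] at hs2
  have h3 := (le_abs_self _).trans hs2
  have h4 : 0 < c * |s| := mul_pos hc (abs_pos.2 (ne_of_gt hs3))
  linarith

variable {r q : ℕ}

/-- The matrix unit `E_ij`. -/
def matUnit (i : Fin r) (j : Fin q) : Mat r q := Pi.single i (Pi.single j 1)

/-- The second derivatives of `p` along the coordinate axes at `x` exist and add up to `ℓ`. -/
def HasCoordLaplacian (p : Mat r q → ℝ) (x : Mat r q) (ℓ : ℝ) : Prop :=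
  ∃ a : Fin r → Fin q → ℝ,
    (∀ i j, HasSecondDerivAtZero (fun s => p (x + s • matUnit i j)) (a i j)) ∧
      ∑ i, ∑ j, a i j = ℓ

theorem HasCoordLaplacian.add {p p' : Mat r q → ℝ} {x : Mat r q} {ℓ ℓ' : ℝ}
    (h : HasCoordLaplacian p x ℓ) (h' : HasCoordLaplacian p' x ℓ') :
    HasCoordLaplacian (fun y => p y + p' y) x (ℓ + ℓ') := by
  obtain ⟨a, ha, rfl⟩ := h
  obtain ⟨b, hb, rfl⟩ := h'
  exact ⟨fun i j => a i j + b i j, fun i j => (ha i j).add (hb i j), by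
    simp [Finset.sum_add_distrib]⟩

theorem HasCoordLaplacian.const_mul {p : Mat r q → ℝ} {x : Mat r q} {ℓ : ℝ} (c : ℝ)
    (h : HasCoordLaplacian p x ℓ) : HasCoordLaplacian (fun y => c * p y) x (c * ℓ) := by
  obtain ⟨a, ha, rfl⟩ := h
  exact ⟨fun i j => c * a i j, fun i j => (ha i j).const_mul c, by simp [Finset.mul_sum]⟩

theorem hasCoordLaplacian_const (c : ℝ) (x : Mat r q) :
    HasCoordLaplacian (fun _ => c) x 0 :=
  ⟨fun _ _ => 0, fun _ _ => .of_hasDerivAt (.of_forall fun s => hasDerivAt_const s c)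
    (hasDerivAt_const 0 0), by simp⟩

theorem HasCoordLaplacian.nonneg_of_isLocalMin {p : Mat r q → ℝ} {x : Mat r q} {ℓ : ℝ}
    (h : HasCoordLaplacian p x ℓ) (hmin : IsLocalMin p x) : 0 ≤ ℓ := by
  obtain ⟨a, ha, rfl⟩ := h
  refine Finset.sum_nonneg fun i _ => Finset.sum_nonneg fun j _ =>
    (ha i j).nonneg_of_isLocalMin ?_
  have hc : ContinuousAt (fun s : ℝ => x + s • matUnit i j) 0 := by fun_prop
  have : IsLocalMin p (x + (0 : ℝ) • matUnit i j) := by simpa using hmin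
  have h2 : Filter.Tendsto (fun s : ℝ => x + s • matUnit i j) (𝓝 0)
      (𝓝 (x + (0 : ℝ) • matUnit i j)) := hc
  exact IsMinFilter.comp_tendsto this h2

/-- The Frobenius inner product. -/
def frobInner (A B : Mat r q) : ℝ := ∑ i, ∑ j, A i j * B i j

@[fun_prop]
theorem continuous_frobInner :
    Continuous fun p : Mat r q × Mat r q => frobInner p.1 p.2 := by
  unfold frobInner; fun_prop

theorem hasDerivAt_frobSq_sub_add_smul (z x B : Mat r q) (s : ℝ) :
    HasDerivAt (fun s => frobSq (z - (x + s • B))) (-2 * frobInner (z - (x + s • B)) B) s := by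
  have h : ∀ i j, HasDerivAt (fun s : ℝ => (z i j - (x i j + s * B i j)) ^ 2)
      (-2 * ((z i j - (x i j + s * B i j)) * B i j)) s := by
    intro i j
    have := ((((hasDerivAt_id s).mul_const (B i j)).const_add (x i j)).const_sub (z i j)).pow 2
    refine this.congr_deriv ?_
    simp; ring
  simp only [frobSq, frobInner, Finset.mul_sum]
  exact HasDerivAt.fun_sum fun i _ => HasDerivAt.fun_sum fun j _ => h i j

theorem hasDerivAt_frobInner_sub_add_smul (z x B : Mat r q) (s : ℝ) :
    HasDerivAt (fun s => frobInner (z - (x + s • B)) B) (-frobSq B) s := by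
  have h : ∀ i j, HasDerivAt (fun s : ℝ => (z i j - (x i j + s * B i j)) * B i j)
      (-(B i j) ^ 2) s := by
    intro i j
    have := ((((hasDerivAt_id s).mul_const (B i j)).const_add (x i j)).const_sub
      (z i j)).mul_const (B i j)
    refine this.congr_deriv ?_
    simp; ring
  simp only [frobSq, frobInner, ← Finset.sum_neg_distrib]
  exact HasDerivAt.fun_sum fun i _ => HasDerivAt.fun_sum fun j _ => h i j

theorem frobSq_matUnit (i : Fin r) (j : Fin q) : frobSq (matUnit i j) = 1 := by
  unfold frobSq matUnit
  rw [Finset.sum_eq_single i, Finset.sum_eq_single j] <;> simp +contextual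

theorem frobInner_matUnit (A : Mat r q) (i : Fin r) (j : Fin q) :
    frobInner A (matUnit i j) = A i j := by
  unfold frobInner matUnit
  rw [Finset.sum_eq_single i, Finset.sum_eq_single j] <;> simp +contextual

theorem hasCoordLaplacian_frobSq (x : Mat r q) :
    HasCoordLaplacian frobSq x (2 * (r * q)) := by
  refine ⟨fun _ _ => 2, fun i j => ?_, by simp; ring⟩
  have h : ∀ s : ℝ, HasDerivAt (fun s => frobSq (x + s • matUnit i j))
      (-2 * frobInner (0 - (x + s • matUnit i j)) (matUnit i j)) s := by
    intro s
    have := hasDerivAt_frobSq_sub_add_smul 0 x (matUnit i j) s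
    simpa only [frobSq_sub_comm 0, sub_zero] using this
  refine .of_hasDerivAt (.of_forall h) ?_
  have := (hasDerivAt_frobInner_sub_add_smul 0 x (matUnit i j) 0).const_mul (-2)
  rw [frobSq_matUnit] at this
  simpa using this

end LineDerivatives

/-! ### The heat flow of compactly supported continuous functions. -/

section HeatFlow

variable {r q : ℕ}

/-- The heat semigroup, normalised so that its generator is half the Laplacian. -/
def heatFlow (f : Mat r q → ℝ) (t : ℝ) (x : Mat r q) : ℝ :=
  ∫ z : Mat r q, normalDensity 1 0 z * f (x + √t • z)

theorem heatFlow_zero (f : Mat r q → ℝ) (x : Mat r q) : heatFlow f 0 x = f x := by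
  simp [heatFlow, integral_mul_const, integral_normalDensity]

/-- In this form all derivatives fall on the Gaussian kernel, so `f` need only be continuous. -/
theorem heatFlow_eq (f : Mat r q → ℝ) {t : ℝ} (ht : 0 < t) (x : Mat r q) :
    heatFlow f t x = ∫ z, normalDensity t x z * f z := by
  have hs : 0 < √t := Real.sqrt_pos.2 ht
  have h1 : ∀ z : Mat r q, normalDensity 1 0 z = √t ^ (r * q) * normalDensity t x (x + √t • z) := by
    intro z
    unfold normalDensity
    have h2 : (2 * Real.pi * t) ^ (-((q : ℝ) * r / 2)) =
        (2 * Real.pi * 1) ^ (-((q : ℝ) * r / 2)) * (√t ^ (r * q))⁻¹ := by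
      have : 2 * Real.pi * t = (2 * Real.pi * 1) * √t ^ (2 : ℝ) := by
        rw [Real.rpow_two, Real.sq_sqrt ht.le]; ring
      rw [this, Real.mul_rpow (by positivity) (by positivity), ← Real.rpow_mul hs.le,
        ← Real.rpow_natCast, ← Real.rpow_neg hs.le]
      congr 2
      push_cast
      ring
    rw [h2, add_sub_cancel_left, frobSq_smul, Real.sq_sqrt ht.le, sub_zero]
    have h3 : 0 < √t ^ (r * q) := by positivity
    field_simp
  have h4 : ∫ z, normalDensity t x (x + √t • z) * f (x + √t • z) =
      (√t ^ (r * q))⁻¹ * ∫ z, normalDensity t x z * f z := by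
    rw [Measure.integral_comp_smul (μ := volume)
      (fun z => normalDensity t x (x + z) * f (x + z)) (√t),
      integral_add_left_eq_self (μ := volume) (fun z => normalDensity t x z * f z) x,
      abs_of_pos (by positivity)]
    simp [Module.finrank_pi_fintype]
  simp_rw [heatFlow, h1, mul_assoc]
  rw [integral_const_mul, h4, mul_inv_cancel_left₀ (by positivity)]

variable {f : Mat r q → ℝ}

theorem heatFlow_le_of_le (hf : Continuous f) {M : ℝ} (hM : ∀ x, ‖f x‖ ≤ M) (t : ℝ)
    (x : Mat r q) : heatFlow f t x ≤ M := by
  have h1 : ∫ z : Mat r q, normalDensity 1 0 z * M = M := by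
    rw [integral_mul_const, integral_normalDensity one_pos, one_mul]
  have hN := integrable_normalDensity one_pos (0 : Mat r q)
  rw [heatFlow, ← h1]
  refine integral_mono (hN.mul_bdd (c := M) (by fun_prop) (.of_forall fun z => hM _))
    (hN.mul_const M) fun z => ?_
  exact mul_le_mul_of_nonneg_left ((le_abs_self _).trans (hM _)) (normalDensity_nonneg one_pos _ _)

/-- The definition with a fixed kernel and scale `√t` gives continuity up to the initial time, where
the kernel form is not available; negative times are harmless since `√t` is then 0. -/
theorem continuous_heatFlow (hf : Continuous f) {M : ℝ} (hM : ∀ x, ‖f x‖ ≤ M) :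
    Continuous fun p : ℝ × Mat r q => heatFlow f p.1 p.2 := by
  unfold heatFlow
  refine continuous_of_dominated (bound := fun z => normalDensity 1 0 z * M)
    (fun p => Continuous.aestronglyMeasurable (by fun_prop)) (fun p => .of_forall fun z => ?_)
    ((integrable_normalDensity one_pos 0).mul_const M) (.of_forall fun z => by fun_prop)
  rw [norm_mul, Real.norm_of_nonneg (normalDensity_nonneg one_pos _ _)]
  exact mul_le_mul_of_nonneg_left (hM _) (normalDensity_nonneg one_pos _ _)

/-- Differentiation under the integral against a compactly supported continuous function. -/
theorem hasDerivAt_integral_mul_of_hasCompactSupport (hf : Continuous f)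
    (hfc : HasCompactSupport f) {G G' : ℝ → Mat r q → ℝ} {I : Set ℝ} (hI : IsOpen I)
    (hG : ∀ s ∈ I, ∀ z, HasDerivAt (fun s => G s z) (G' s z) s)
    (hGc : ∀ s ∈ I, Continuous (G s))
    (hG' : ContinuousOn (fun p : ℝ × Mat r q => G' p.1 p.2) (I ×ˢ Set.univ)) {s₀ : ℝ}
    (hs₀ : s₀ ∈ I) :
    HasDerivAt (fun s => ∫ z, G s z * f z) (∫ z, G' s₀ z * f z) s₀ := by
  obtain ⟨ε, hε, hball⟩ := Metric.nhds_basis_closedBall.mem_iff.1 (hI.mem_nhds hs₀)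
  have hK : IsCompact (Metric.closedBall s₀ ε ×ˢ tsupport f) :=
    (isCompact_closedBall s₀ ε).prod hfc
  have hcont : ContinuousOn (fun p : ℝ × Mat r q => G' p.1 p.2 * f p.2)
      (Metric.closedBall s₀ ε ×ˢ tsupport f) :=
    (hG'.mono (Set.prod_mono hball (Set.subset_univ _))).mul (by fun_prop)
  obtain ⟨C, hC⟩ := hK.exists_bound_of_continuousOn hcont
  have hG'c : Continuous (G' s₀) := by
    have := hG'.comp_continuous (f := fun z : Mat r q => (s₀, z)) (by fun_prop)
      fun z => ⟨hs₀, trivial⟩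
    exact this
  refine (hasDerivAt_integral_of_dominated_loc_of_deriv_le (F := fun s z => G s z * f z)
    (F' := fun s z => G' s z * f z) (bound := (tsupport f).indicator fun _ => C) (Metric.closedBall_mem_nhds s₀ hε) ?_ ?_ ?_ ?_ ?_
    ?_).2
  · filter_upwards [hI.mem_nhds hs₀] with s hs
    exact ((hGc s hs).mul hf).aestronglyMeasurable
  · exact ((hGc s₀ hs₀).mul hf).integrable_of_hasCompactSupport hfc.mul_left
  · exact (hG'c.mul hf).aestronglyMeasurable
  · refine .of_forall fun z s hs => ?_
    by_cases hz : z ∈ tsupport f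
    · rw [Set.indicator_of_mem hz]
      exact hC (s, z) ⟨hs, hz⟩
    · rw [Set.indicator_of_notMem hz, image_eq_zero_of_notMem_tsupport hz]
      simp
  · exact (integrable_indicator_iff (isClosed_tsupport f).measurableSet).2
      (integrableOn_const (hs := IsCompact.measure_lt_top hfc |>.ne))
  · exact .of_forall fun z s hs => (hG s (hball hs) z).mul_const _

theorem hasDerivAt_normalDensity_add_smul {t : ℝ} (ht : 0 < t) (x B z : Mat r q) (s : ℝ) :
    HasDerivAt (fun s => normalDensity t (x + s • B) z)
      (normalDensity t (x + s • B) z * (frobInner (z - (x + s • B)) B / t)) s := by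
  unfold normalDensity
  have h := (((hasDerivAt_frobSq_sub_add_smul z x B s).div_const (2 * t)).neg.exp).const_mul
    ((2 * Real.pi * t) ^ (-((q : ℝ) * r / 2)))
  refine h.congr_deriv ?_
  simp only [Pi.neg_apply]
  field_simp

theorem hasDerivAt_heatFlow_line (hf : Continuous f) (hfc : HasCompactSupport f) {t : ℝ}
    (ht : 0 < t) (x B : Mat r q) (s : ℝ) :
    HasDerivAt (fun s => heatFlow f t (x + s • B))
      (∫ z, normalDensity t (x + s • B) z * (frobInner (z - (x + s • B)) B / t) * f z) s := by
  simp_rw [heatFlow_eq f ht]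
  refine hasDerivAt_integral_mul_of_hasCompactSupport hf hfc (I := Set.univ)
    (G := fun s z => normalDensity t (x + s • B) z)
    (G' := fun s z => normalDensity t (x + s • B) z * (frobInner (z - (x + s • B)) B / t))
    isOpen_univ
    (fun s _ z => hasDerivAt_normalDensity_add_smul ht x B z s) (fun s _ => by fun_prop)
    (Continuous.continuousOn (by fun_prop)) trivial

theorem hasSecondDerivAtZero_heatFlow (hf : Continuous f) (hfc : HasCompactSupport f) {t : ℝ}
    (ht : 0 < t) (x B : Mat r q) :
    HasSecondDerivAtZero (fun s => heatFlow f t (x + s • B))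
      (∫ z, normalDensity t x z * ((frobInner (z - x) B / t) ^ 2 - frobSq B / t) * f z) := by
  refine .of_hasDerivAt (.of_forall fun s => hasDerivAt_heatFlow_line hf hfc ht x B s) ?_
  have := hasDerivAt_integral_mul_of_hasCompactSupport hf hfc (I := Set.univ)
    (G := fun s z => normalDensity t (x + s • B) z * (frobInner (z - (x + s • B)) B / t))
    (G' := fun s z => normalDensity t (x + s • B) z *
      ((frobInner (z - (x + s • B)) B / t) ^ 2 - frobSq B / t)) isOpen_univ
    (fun s _ z => ?_) (fun s _ => by fun_prop)
    (Continuous.continuousOn (by fun_prop)) (Set.mem_univ (0 : ℝ))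
  · simpa using this
  · refine ((hasDerivAt_normalDensity_add_smul ht x B z s).mul
      ((hasDerivAt_frobInner_sub_add_smul z x B s).div_const t)).congr_deriv ?_
    ring

theorem hasDerivAt_normalDensity_time {t : ℝ} (ht : 0 < t) (x z : Mat r q) :
    HasDerivAt (fun t => normalDensity t x z)
      (normalDensity t x z * (frobSq (z - x) / (2 * t ^ 2) - r * q / (2 * t))) t := by
  unfold normalDensity
  have h1 : HasDerivAt (fun t : ℝ => (2 * Real.pi * t) ^ (-((q : ℝ) * r / 2)))
      ((2 * Real.pi * t) ^ (-((q : ℝ) * r / 2)) * (-(r * q / (2 * t)))) t := by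
    have h2 := ((hasDerivAt_id t).const_mul (2 * Real.pi)).rpow_const
      (p := -((q : ℝ) * r / 2)) (Or.inl (by simp [Real.pi_ne_zero, ht.ne']))
    refine h2.congr_deriv ?_
    have h3 : 2 * Real.pi * t ≠ 0 := by positivity
    simp only [id]
    rw [Real.rpow_sub_one h3]
    field_simp
  have h2 : HasDerivAt (fun t : ℝ => Real.exp (-(frobSq (z - x) / (2 * t))))
      (Real.exp (-(frobSq (z - x) / (2 * t))) * (frobSq (z - x) / (2 * t ^ 2))) t := by
    have h4 : HasDerivAt (fun t : ℝ => (2 * t)⁻¹) (-(2 * 1) / (2 * t) ^ 2) t :=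
      ((hasDerivAt_id t).const_mul 2).fun_inv (by simpa using ht.ne')
    have h3 := (h4.const_mul (frobSq (z - x))).fun_neg.exp
    simp only [← div_eq_mul_inv] at h3
    refine h3.congr_deriv ?_
    field_simp
  refine (h1.mul h2).congr_deriv ?_
  ring

theorem hasDerivAt_heatFlow_time (hf : Continuous f) (hfc : HasCompactSupport f) {t : ℝ}
    (ht : 0 < t) (x : Mat r q) :
    HasDerivAt (fun t => heatFlow f t x)
      (∫ z, normalDensity t x z * (frobSq (z - x) / (2 * t ^ 2) - r * q / (2 * t)) * f z) t := by
  have h := hasDerivAt_integral_mul_of_hasCompactSupport hf hfc (I := Set.Ioi 0)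
    (G := fun t z => normalDensity t x z)
    (G' := fun t z => normalDensity t x z * (frobSq (z - x) / (2 * t ^ 2) - r * q / (2 * t)))
    isOpen_Ioi (fun s hs z => hasDerivAt_normalDensity_time hs x z) (fun s _ => by fun_prop) ?_ ht
  · refine h.congr_of_eventuallyEq ?_
    filter_upwards [isOpen_Ioi.mem_nhds (show t ∈ Set.Ioi 0 from ht)] with s hs
    exact heatFlow_eq f hs x
  · rintro ⟨s, z⟩ ⟨hs, -⟩
    have hs' : s ≠ 0 := ne_of_gt hs
    have hs2 : 2 * Real.pi * s ≠ 0 := by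
      have : (0 : ℝ) < s := hs
      positivity
    unfold normalDensity
    refine ContinuousAt.continuousWithinAt ?_
    refine ContinuousAt.mul (ContinuousAt.mul (ContinuousAt.rpow_const (by fun_prop)
      (Or.inl hs2)) ?_) ?_
    · fun_prop (disch := simpa using hs')
    · fun_prop (disch := simpa using hs')

/-- The integral is exactly the time derivative in `hasDerivAt_heatFlow_time`, so the two lemmas
together are the heat equation $\partial_t=\tfrac12\Delta$. -/
theorem hasCoordLaplacian_heatFlow (hf : Continuous f) (hfc : HasCompactSupport f) {t : ℝ}
    (ht : 0 < t) (x : Mat r q) :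
    HasCoordLaplacian (heatFlow f t) x (2 *
      ∫ z, normalDensity t x z * (frobSq (z - x) / (2 * t ^ 2) - r * q / (2 * t)) * f z) := by
  refine ⟨_, fun i j => hasSecondDerivAtZero_heatFlow hf hfc ht x (matUnit i j), ?_⟩
  have hi : ∀ i j, Integrable fun z => normalDensity t x z *
      ((frobInner (z - x) (matUnit i j) / t) ^ 2 - frobSq (matUnit i j) / t) * f z := fun i j =>
    Continuous.integrable_of_hasCompactSupport (by fun_prop) hfc.mul_left
  simp_rw [← integral_finsetSum _ fun j _ => hi _ j]
  rw [← integral_finsetSum _ fun i _ => integrable_finsetSum _ fun j _ => hi i j,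
    ← integral_const_mul]
  congr 1
  funext z
  simp_rw [frobInner_matUnit, frobSq_matUnit, ← Finset.sum_mul, ← Finset.mul_sum,
    Finset.sum_sub_distrib, div_pow, ← Finset.sum_div]
  simp only [frobSq, Finset.sum_const, Finset.card_univ, Fintype.card_fin, Pi.sub_apply,
    nsmul_eq_mul]
  field_simp

end HeatFlow

/-! ### Parabolic minimum principle with exceptional sets. -/

section Comparison

variable {r q : ℕ}

theorem isCompact_frobSq_le (R : ℝ) : IsCompact {x : Mat r q | frobSq x ≤ R} := by
  refine Metric.isCompact_of_isClosed_isBounded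
    (isClosed_le continuous_frobSq continuous_const) ?_
  refine (Metric.isBounded_closedBall (x := (0 : Mat r q)) (r := √R)).subset fun x hx => ?_
  rw [mem_closedBall_zero_iff, pi_norm_le_iff_of_nonneg (Real.sqrt_nonneg _)]
  intro i
  rw [pi_norm_le_iff_of_nonneg (Real.sqrt_nonneg _)]
  intro j
  refine Real.abs_le_sqrt (le_trans ?_ hx)
  unfold frobSq
  calc x i j ^ 2 ≤ ∑ j, x i j ^ 2 :=
        Finset.single_le_sum (f := fun j => x i j ^ 2) (fun _ _ => sq_nonneg _) (Finset.mem_univ j)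
    _ ≤ _ := Finset.single_le_sum (f := fun i => ∑ j, x i j ^ 2)
        (fun _ _ => Finset.sum_nonneg fun _ _ => sq_nonneg _) (Finset.mem_univ i)

/-- Comparison of a nonnegative function `p` that is superharmonic away from the polar set `F = 0`
and from a hypersurface, along which `p` is differentiable and `k` has a kink, with the heat flow
of a minorant. -/
theorem heatFlow_le_of_superharmonic {p F k f : Mat r q → ℝ} {Reg : Set (Mat r q)}
    (hp0 : ∀ x, 0 ≤ p x) (hF : Continuous F) (hk : Continuous k)
    (hk0 : ∀ x, 0 ≤ k x) (hpc : ContinuousOn p {x | 0 < F x})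
    (hreg : ∀ x, 0 < F x → x ∈ Reg → ∃ a b c, HasCoordLaplacian p x a ∧
      HasCoordLaplacian (fun y => Real.log (F y)) x b ∧ HasCoordLaplacian k x c ∧
        a ≤ 0 ∧ 0 ≤ b ∧ 0 ≤ c)
    (hsing : ∀ x, 0 < F x → x ∉ Reg → ∃ (B : Mat r q) (c : ℝ), 0 < c ∧
      DifferentiableAt ℝ (fun s : ℝ => p (x + s • B)) 0 ∧
      DifferentiableAt ℝ (fun s : ℝ => F (x + s • B)) 0 ∧ ∀ s : ℝ, k (x + s • B) = c * |s|)
    (hf : Continuous f) (hfc : HasCompactSupport f) (hfp : ∀ x, 0 < F x → f x ≤ p x)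
    {x₁ : Mat r q} (hx₁ : 0 < F x₁) {T : ℝ} (hT : 0 < T) : heatFlow f T x₁ ≤ p x₁ := by
  by_contra! hlt
  set d := heatFlow f T x₁ - p x₁ with hd
  have hd0 : 0 < d := sub_pos.2 hlt
  obtain ⟨M, hM⟩ := hfc.exists_bound_of_continuous hf
  have hM0 : 0 ≤ M := (norm_nonneg _).trans (hM x₁)
  have huM := heatFlow_le_of_le hf hM
  have huc := continuous_heatFlow hf hM
  set n : ℝ := r * q with hn
  have hn0 : 0 ≤ n := by positivity
  have hx₁0 := frobSq_nonneg x₁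
  set S := frobSq x₁ + (n + 1) * T with hS
  have hS0 : 0 ≤ S := by positivity
  -- The `δ` and `ε` terms each cost at most `d / 4` at `(T, x₁)`, so the perturbed difference stays
  -- below `-(d / 2)` there.
  obtain ⟨δ, hδ, hδS⟩ : ∃ δ : ℝ, 0 < δ ∧ δ * S ≤ d / 4 := by
    refine ⟨d / 4 / (S + 1), by positivity, ?_⟩
    rw [div_mul_eq_mul_div, div_le_iff₀ (by positivity)]
    nlinarith
  -- On `frobSq x = R` the confining term exceeds `M + 2`, which beats the heat flow (at most `M`)
  -- and the kink term (at most 1).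
  set R := frobSq x₁ + (M + 2) / δ + 1 with hR
  have hRx : frobSq x₁ < R := by
    have : 0 ≤ (M + 2) / δ := by positivity
    linarith
  have hδR : M + 2 < δ * R := by
    have : δ * ((M + 2) / δ) = M + 2 := by field_simp
    nlinarith
  have hB := isCompact_frobSq_le (r := r) (q := q) R
  obtain ⟨C, hC⟩ := hB.exists_bound_of_continuousOn hF.continuousOn
  obtain ⟨Ck, hCk⟩ := hB.exists_bound_of_continuousOn hk.continuousOn
  have hFC : ∀ x, frobSq x ≤ R → F x ≤ C := fun x hx => (le_abs_self _).trans (hC x hx)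
  have hkC : ∀ x, frobSq x ≤ R → k x ≤ Ck := fun x hx => (le_abs_self _).trans (hCk x hx)
  have hC0 : 0 < C := hx₁.trans_le (hFC x₁ hRx.le)
  have hCk0 : 0 ≤ Ck := (norm_nonneg _).trans (hCk x₁ hRx.le)
  have hlog : ∀ x, frobSq x ≤ R → 0 < F x → 0 ≤ Real.log C - Real.log (F x) := fun x hx hx' =>
    sub_nonneg.2 (Real.log_le_log hx' (hFC x hx))
  obtain ⟨ε, hε, hεx⟩ : ∃ ε : ℝ, 0 < ε ∧ ε * (Real.log C - Real.log (F x₁)) ≤ d / 4 := by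
    have h1 := hlog x₁ hRx.le hx₁
    refine ⟨d / 4 / (Real.log C - Real.log (F x₁) + 1), by positivity, ?_⟩
    rw [div_mul_eq_mul_div, div_le_iff₀ (by positivity)]
    nlinarith
  -- The bound by 1 serves on the lateral boundary; the bound by `d / 4` serves at time 0, where the
  -- minorant property controls everything else.
  obtain ⟨κ, hκ, hκ1, hκd⟩ : ∃ κ : ℝ, 0 < κ ∧ κ * Ck ≤ 1 ∧ κ * Ck ≤ d / 4 := by
    have h0 : 0 < min 1 (d / 4) := by positivity
    refine ⟨min 1 (d / 4) / (Ck + 1), by positivity, ?_, ?_⟩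
    · rw [div_mul_eq_mul_div, div_le_iff₀ (by positivity)]
      nlinarith [min_le_left 1 (d / 4)]
    · rw [div_mul_eq_mul_div, div_le_iff₀ (by positivity)]
      nlinarith [min_le_right 1 (d / 4)]
  have hκk : ∀ x, frobSq x ≤ R → κ * k x ≤ κ * Ck := fun x hx =>
    mul_le_mul_of_nonneg_left (hkC x hx) hκ.le
  -- Chosen so that on `F x = η` the logarithmic barrier alone reaches `M + 2`.
  obtain ⟨η, hη, hηx, hηε⟩ : ∃ η : ℝ, 0 < η ∧ η < F x₁ ∧
      M + 2 ≤ ε * (Real.log C - Real.log η) := by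
    refine ⟨min (F x₁) (C * Real.exp (-((M + 2) / ε))) / 2, by positivity, ?_, ?_⟩
    · have := min_le_left (F x₁) (C * Real.exp (-((M + 2) / ε)))
      linarith
    · have h1 : min (F x₁) (C * Real.exp (-((M + 2) / ε))) / 2 ≤ C * Real.exp (-((M + 2) / ε)) := by
        have h2 := min_le_right (F x₁) (C * Real.exp (-((M + 2) / ε)))
        have h3 : 0 < C * Real.exp (-((M + 2) / ε)) := by positivity
        linarith
      have h2 := Real.log_le_log (by positivity) h1
      rw [Real.log_mul hC0.ne' (Real.exp_pos _).ne', Real.log_exp] at h2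
      have h3 : (M + 2) / ε ≤ Real.log C -
          Real.log (min (F x₁) (C * Real.exp (-((M + 2) / ε))) / 2) := by linarith
      rwa [div_le_iff₀' hε] at h3
  -- The gap between `p` and the heat flow, plus a logarithmic barrier at `F = 0`, minus a multiple
  -- of `k` whose kink excludes minima, plus a confining term whose `n + 1` in place of `n` makes
  -- `w` a strict supersolution.
  set w : ℝ × Mat r q → ℝ := fun y => p y.2 + ε * (Real.log C - Real.log (F y.2)) - κ * k y.2 +
    δ * (frobSq y.2 + (n + 1) * y.1) - heatFlow f y.1 y.2 with hw
  set K : Set (Mat r q) := {x | frobSq x ≤ R} ∩ {x | η ≤ F x} with hK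
  have hKc : IsCompact K := hB.inter_right (isClosed_le continuous_const hF)
  have hwc : ContinuousOn w (Set.Icc 0 T ×ˢ K) := by
    have h1 : ContinuousOn (fun y : ℝ × Mat r q => p y.2) (Set.Icc 0 T ×ˢ K) :=
      hpc.comp continuousOn_snd fun y hy => hη.trans_le hy.2.2
    have h2 : ContinuousOn (fun y : ℝ × Mat r q => Real.log (F y.2)) (Set.Icc 0 T ×ˢ K) :=
      ContinuousOn.log (by fun_prop) fun y hy => (hη.trans_le hy.2.2).ne'
    have h3 : Continuous fun y : ℝ × Mat r q => δ * (frobSq y.2 + (n + 1) * y.1) := by fun_prop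
    have h4 : Continuous fun y : ℝ × Mat r q => κ * k y.2 := by fun_prop
    exact (((h1.add ((continuousOn_const.sub h2).const_mul ε)).sub h4.continuousOn).add
      h3.continuousOn).sub huc.continuousOn
  have hmem : (T, x₁) ∈ Set.Icc 0 T ×ˢ K := ⟨⟨hT.le, le_rfl⟩, hRx.le, hηx.le⟩
  obtain ⟨⟨t₀, x₀⟩, ⟨ht₀, hx₀R, hx₀η⟩, hmin⟩ :=
    (isCompact_Icc.prod hKc).exists_isMinOn ⟨_, hmem⟩ hwc
  have hw₁ : w (T, x₁) ≤ -(d / 2) := by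
    have := mul_nonneg hκ.le (hk0 x₁)
    simp only [hw]
    linarith
  have hw₀ : w (t₀, x₀) ≤ -(d / 2) := (hmin hmem).trans hw₁
  simp only [Set.mem_ofPred_eq] at hx₀R hx₀η
  simp only at ht₀
  have hF₀ : 0 < F x₀ := hη.trans_le hx₀η
  have hl₀ := mul_nonneg hε.le (hlog x₀ hx₀R hF₀)
  have hk₀ := hκk x₀ hx₀R
  have hfr₀ := frobSq_nonneg x₀
  have htt : 0 ≤ (n + 1) * t₀ := mul_nonneg (by positivity) ht₀.1
  have hδ₀ : 0 ≤ δ * (frobSq x₀ + (n + 1) * t₀) := by positivity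
  have hp₀ := hp0 x₀
  have hu₀ := huM t₀ x₀
  have ht₀pos : 0 < t₀ := by
    refine lt_of_le_of_ne ht₀.1 fun h => ?_
    have h1 : heatFlow f t₀ x₀ ≤ p x₀ := by
      rw [← h, heatFlow_zero]; exact hfp x₀ hF₀
    simp only [hw] at hw₀
    linarith
  have hx₀R' : frobSq x₀ < R := by
    refine lt_of_le_of_ne hx₀R fun h => ?_
    have h1 : M + 2 < δ * (frobSq x₀ + (n + 1) * t₀) := by
      rw [h]; nlinarith
    simp only [hw] at hw₀
    linarith
  have hx₀η' : η < F x₀ := by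
    refine lt_of_le_of_ne hx₀η fun h => ?_
    rw [h] at hηε
    simp only [hw] at hw₀
    linarith
  have hspace : IsLocalMin (fun x => w (t₀, x)) x₀ := by
    have h1 : ∀ᶠ x in 𝓝 x₀, frobSq x < R :=
      continuous_frobSq.continuousAt.eventually_lt_const hx₀R'
    have h2 : ∀ᶠ x in 𝓝 x₀, η < F x := hF.continuousAt.eventually_const_lt hx₀η'
    filter_upwards [h1, h2] with x hx1 hx2
    exact hmin (show (t₀, x) ∈ Set.Icc 0 T ×ˢ K from ⟨ht₀, hx1.le, hx2.le⟩)
  -- With `D` the time derivative of the heat flow, the minimum in time forces `δ * (n + 1) ≤ D` at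
  -- a regular point, while the minimum in space forces `D ≤ δ * n`. At a singular point the kink of
  -- `- κ * k` already rules out a minimum.
  by_cases hr : x₀ ∈ Reg
  · obtain ⟨a, b, c, ha, hb, hc, ha0, hb0, hc0⟩ := hreg x₀ hF₀ hr
    have hu := hasCoordLaplacian_heatFlow hf hfc ht₀pos x₀
    have hut := hasDerivAt_heatFlow_time hf hfc ht₀pos x₀
    generalize (∫ z, normalDensity t₀ x₀ z *
      (frobSq (z - x₀) / (2 * t₀ ^ 2) - r * q / (2 * t₀)) * f z) = D at hu hut
    have hlap := ((((ha.add (((hasCoordLaplacian_const (Real.log C) x₀).add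
      (hb.const_mul (-1))).const_mul ε)).add (hc.const_mul (-κ))).add
      (((hasCoordLaplacian_frobSq x₀).add
        (hasCoordLaplacian_const ((n + 1) * t₀) x₀)).const_mul δ)).add
      (hu.const_mul (-1))).nonneg_of_isLocalMin (by
        convert hspace using 1
        funext x
        simp only [hw]
        ring)
    have htime : δ * (n + 1) - D ≤ 0 := by
      have h1 : HasDerivAt (fun t => w (t, x₀)) (δ * (n + 1) - D) t₀ := by
        have h2 : HasDerivAt (fun t : ℝ => δ * (frobSq x₀ + (n + 1) * t)) (δ * (n + 1)) t₀ := by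
          refine ((((hasDerivAt_id t₀).const_mul (n + 1)).const_add _).const_mul δ).congr_deriv ?_
          ring
        exact (h2.const_add (p x₀ + ε * (Real.log C - Real.log (F x₀)) - κ * k x₀)).sub hut
      exact nonpos_of_hasDerivAt_of_forall_le ht₀pos h1 fun t h2 h3 =>
        hmin (show (t, x₀) ∈ Set.Icc 0 T ×ˢ K from ⟨⟨h2, h3.trans ht₀.2⟩, hx₀R, hx₀η⟩)
    have h1 := mul_nonneg hε.le hb0
    have h2 := mul_nonneg hκ.le hc0
    rw [← hn] at hlap
    linarith
  · obtain ⟨B, c, hc, hp, hFd, hkB⟩ := hsing x₀ hF₀ hr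
    have hkc : ContinuousAt (fun s : ℝ => x₀ + s • B) 0 := by fun_prop
    have hlin : Filter.Tendsto (fun s : ℝ => x₀ + s • B) (𝓝 0) (𝓝 x₀) := by
      simpa [ContinuousAt] using hkc
    have hu : DifferentiableAt ℝ (fun s : ℝ => heatFlow f t₀ (x₀ + s • B)) 0 :=
      (hasDerivAt_heatFlow_line hf hfc ht₀pos x₀ B 0).differentiableAt
    have hfr : DifferentiableAt ℝ (fun s : ℝ => frobSq (x₀ + s • B)) 0 := by
      have := (hasDerivAt_frobSq_sub_add_smul 0 x₀ B 0).differentiableAt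
      simpa only [frobSq_sub_comm 0, sub_zero] using this
    refine not_isLocalMin_sub_abs (mul_pos hκ hc) (φ := fun s => p (x₀ + s • B) +
      ε * (Real.log C - Real.log (F (x₀ + s • B))) + δ * (frobSq (x₀ + s • B) + (n + 1) * t₀) -
      heatFlow f t₀ (x₀ + s • B)) ?_ ?_
    · have hlogd : DifferentiableAt ℝ (fun s : ℝ => Real.log (F (x₀ + s • B))) 0 :=
        hFd.log (by simpa using hF₀.ne')
      exact ((hp.add ((hlogd.const_sub _).const_mul _)).add ((hfr.add_const _).const_mul _)).sub hu
    · have h1 : IsLocalMin (fun s : ℝ => w (t₀, x₀ + s • B)) 0 := by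
        have h2 := hlin.eventually hspace
        filter_upwards [h2] with s hs
        simpa using hs
      convert h1 using 1
      funext s
      simp only [hw, hkB]
      ring

/-- The superharmonic function `p` of `heatFlow_le_of_superharmonic` is decreased by the heat
semigroup. -/
theorem extMarginal_le_of_superharmonic {p F k : Mat r q → ℝ} {Reg : Set (Mat r q)}
    (hp0 : ∀ x, 0 ≤ p x) (hF : Continuous F) (hk : Continuous k)
    (hk0 : ∀ x, 0 ≤ k x) (hpc : ContinuousOn p {x | 0 < F x})
    (hreg : ∀ x, 0 < F x → x ∈ Reg → ∃ a b c, HasCoordLaplacian p x a ∧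
      HasCoordLaplacian (fun y => Real.log (F y)) x b ∧ HasCoordLaplacian k x c ∧
        a ≤ 0 ∧ 0 ≤ b ∧ 0 ≤ c)
    (hsing : ∀ x, 0 < F x → x ∉ Reg → ∃ (B : Mat r q) (c : ℝ), 0 < c ∧
      DifferentiableAt ℝ (fun s : ℝ => p (x + s • B)) 0 ∧
      DifferentiableAt ℝ (fun s : ℝ => F (x + s • B)) 0 ∧ ∀ s : ℝ, k (x + s • B) = c * |s|)
    (hae : ∀ᵐ x : Mat r q, 0 < F x) {s : ℝ} (hs : 0 < s) :
    ∀ᵐ x : Mat r q, extMarginal p s x ≤ ENNReal.ofReal (p x) := by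
  -- Cutoffs supported where `1 ≤ j * F x` and `frobSq x ≤ j`, equal to 1 where `2 ≤ j * F x` and
  -- `frobSq x ≤ j - 1`. They make `p * χ j` continuous with compact support although `p` is
  -- continuous only where `F > 0`.
  set χ : ℕ → Mat r q → ℝ := fun j x =>
    max 0 (min 1 (j * F x - 1)) * max 0 (min 1 (j - frobSq x)) with hχ
  have hχc : ∀ j, Continuous (χ j) := fun j => by simp only [hχ]; fun_prop
  have hχ0 : ∀ j x, 0 ≤ χ j x := fun j x => by simp only [hχ]; positivity
  have hχ1 : ∀ j x, χ j x ≤ 1 := fun j x => by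
    simp only [hχ]
    exact mul_le_one₀ (by simp) (by positivity) (by simp)
  have hsupp : ∀ j x, χ j x ≠ 0 → frobSq x ≤ j ∧ 1 ≤ j * F x := by
    intro j x hx
    simp only [hχ, ne_eq, mul_eq_zero, not_or] at hx
    constructor
    · by_contra! h
      exact hx.2 (max_eq_left (min_le_of_right_le (by linarith)))
    · by_contra! h
      exact hx.1 (max_eq_left (min_le_of_right_le (by linarith)))
  have hK : ∀ j : ℕ, IsCompact ({x : Mat r q | frobSq x ≤ j} ∩ {x | 1 ≤ j * F x}) := fun j =>
    (isCompact_frobSq_le _).inter_right (isClosed_le continuous_const (by fun_prop))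
  have hFpos : ∀ (j : ℕ) x, 1 ≤ j * F x → 0 < F x := by
    intro j x hx
    by_contra! h
    have : (j : ℝ) * F x ≤ 0 := mul_nonpos_of_nonneg_of_nonpos (by positivity) h
    linarith
  set f : ℕ → Mat r q → ℝ := fun j x => p x * χ j x with hfdef
  have hts : ∀ j, tsupport (χ j) ⊆ {x : Mat r q | frobSq x ≤ j} ∩ {x | 1 ≤ j * F x} := fun j =>
    closure_minimal (fun x hx => hsupp j x hx) (hK j).isClosed
  have hfcs : ∀ j, HasCompactSupport (f j) := fun j => by
    have : HasCompactSupport (χ j) := HasCompactSupport.intro (hK j) fun x hx => by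
      by_contra h
      exact hx (hsupp j x h)
    exact this.mul_left
  have hfc : ∀ j, Continuous (f j) := by
    intro j
    refine continuous_of_tsupport fun x hx => ?_
    have hx' : 0 < F x :=
      hFpos j x (hts j (tsupport_mul_subset_right hx)).2
    exact (hpc.continuousAt ((isOpen_lt continuous_const hF).mem_nhds hx')).mul
      (hχc j).continuousAt
  have hfp : ∀ j x, f j x ≤ p x := fun j x => mul_le_of_le_one_right (hp0 x) (hχ1 j x)
  have hf0 : ∀ j x, 0 ≤ f j x := fun j x => mul_nonneg (hp0 x) (hχ0 j x)
  have hlim : ∀ x, 0 < F x → Filter.Tendsto (fun j => f j x) Filter.atTop (𝓝 (p x)) := by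
    intro x hx
    refine tendsto_const_nhds.congr' ?_
    obtain ⟨N1, hN1⟩ := exists_nat_ge (2 / F x)
    obtain ⟨N2, hN2⟩ := exists_nat_ge (frobSq x + 1)
    filter_upwards [Filter.eventually_ge_atTop N1, Filter.eventually_ge_atTop N2] with j h1 h2
    have h3 : (N1 : ℝ) ≤ j := by exact_mod_cast h1
    have h4 : (N2 : ℝ) ≤ j := by exact_mod_cast h2
    have h5 : 2 ≤ j * F x := by
      rw [div_le_iff₀ hx] at hN1
      exact hN1.trans (mul_le_mul_of_nonneg_right h3 hx.le)
    simp only [hfdef, hχ]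
    rw [min_eq_left (by linarith), min_eq_left (by linarith)]
    simp
  filter_upwards [hae] with x hx
  -- Fatou's lemma passes the bound from the truncations to `p`.
  have h1 : extMarginal p s x ≤ Filter.liminf (fun j => ∫⁻ z,
      ENNReal.ofReal (normalDensity s z x) * ENNReal.ofReal (f j z)) Filter.atTop := by
    have h2 : extMarginal p s x = ∫⁻ z, Filter.liminf (fun j =>
      ENNReal.ofReal (normalDensity s z x) * ENNReal.ofReal (f j z)) Filter.atTop := by
      refine lintegral_congr_ae (hae.mono fun z hz => ?_)
      refine (Filter.Tendsto.liminf_eq ?_).symm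
      exact ENNReal.Tendsto.const_mul (ENNReal.tendsto_ofReal (hlim z hz))
        (Or.inr ENNReal.ofReal_ne_top)
    rw [h2]
    refine lintegral_liminf_le fun j => ?_
    have := (hfc j).measurable
    exact Measurable.mul (by fun_prop) this.ennreal_ofReal
  refine h1.trans (Filter.liminf_le_of_frequently_le' (Filter.Frequently.of_forall fun j => ?_))
  have h2 := heatFlow_le_of_superharmonic hp0 hF hk hk0 hpc hreg hsing (hfc j) (hfcs j)
    (fun y _ => hfp j y) hx hs
  rw [heatFlow_eq _ hs] at h2
  refine le_trans (le_of_eq ?_) (ENNReal.ofReal_le_ofReal h2)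
  have hcont : Continuous fun z => normalDensity s x z * f j z :=
    Continuous.mul (by fun_prop) (hfc j)
  rw [ofReal_integral_eq_lintegral_ofReal
    (hcont.integrable_of_hasCompactSupport (hfcs j).mul_left)
    (.of_forall fun z => mul_nonneg (normalDensity_nonneg hs _ _) (hf0 j z))]
  refine lintegral_congr fun z => ?_
  rw [ENNReal.ofReal_mul (normalDensity_nonneg hs _ _), normalDensity_comm]

end Comparison

/-! ### Smoothness of simple eigenvalues and eigenvectors. -/

section Eigen

variable {r q : ℕ}

theorem gramEigenvalues_antitone (Θ : Mat r q) : Antitone (gramEigenvalues Θ) := fun _ _ hij =>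
  (gram_isHermitian Θ).eigenvalues₀_antitone hij

/-- An orthonormal eigenbasis of `Θ Θᵀ`, in the order of `gramEigenvalues`. -/
theorem exists_gram_eigenbasis (Θ : Mat r q) : ∃ u : Fin r → Fin r → ℝ,
    (∀ k l, u k ⬝ᵥ u l = if k = l then 1 else 0) ∧
      ∀ k, (Matrix.of Θ * (Matrix.of Θ)ᵀ) *ᵥ u k = gramEigenvalues Θ k • u k := by
  set hA := gram_isHermitian Θ
  set e : Fin r → Fin r := fun k => (Fintype.equivOfCardEq (Fintype.card_fin _))
    (Fin.cast (Fintype.card_fin r).symm k) with he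
  have hinj : Function.Injective e := fun a b h => by
    simpa [he] using h
  refine ⟨fun k => ⇑(hA.eigenvectorBasis (e k)), fun k l => ?_, fun k => ?_⟩
  · have h := orthonormal_iff_ite.1 hA.eigenvectorBasis.orthonormal (e k) (e l)
    rw [EuclideanSpace.inner_eq_star_dotProduct, dotProduct_comm] at h
    simpa [hinj.eq_iff] using h
  · rw [hA.mulVec_eigenvectorBasis]
    congr 1
    simp [IsHermitian.eigenvalues, gramEigenvalues, he]

/-- The quadratic form of `Θ Θᵀ`. -/
theorem dotProduct_gram_mulVec (Θ : Mat r q) (w u : Fin r → ℝ) :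
    w ⬝ᵥ ((Matrix.of Θ * (Matrix.of Θ)ᵀ) *ᵥ u) =
      (w ᵥ* Matrix.of Θ) ⬝ᵥ (u ᵥ* Matrix.of Θ) := by
  rw [← Matrix.mulVec_mulVec, Matrix.dotProduct_mulVec, Matrix.mulVec_transpose]

theorem dotProduct_eq_sum_of_orthonormal {u : Fin r → Fin r → ℝ}
    (hu : ∀ k l, u k ⬝ᵥ u l = if k = l then 1 else 0) (x y : Fin r → ℝ) :
    x ⬝ᵥ y = ∑ k, (u k ⬝ᵥ x) * (u k ⬝ᵥ y) := by
  set U : Matrix (Fin r) (Fin r) ℝ := Matrix.of u with hU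
  have h1 : U * Uᵀ = 1 := by
    ext k l
    rw [Matrix.mul_apply, Matrix.one_apply, ← hu k l]
    rfl
  have h2 : Uᵀ * U = 1 := mul_eq_one_comm.1 h1
  calc x ⬝ᵥ y = x ⬝ᵥ ((Uᵀ * U) *ᵥ y) := by rw [h2, Matrix.one_mulVec]
    _ = (U *ᵥ x) ⬝ᵥ (U *ᵥ y) := by
      rw [← Matrix.mulVec_mulVec, Matrix.dotProduct_mulVec, Matrix.vecMul_transpose]
    _ = _ := rfl

theorem eq_zero_of_forall_dotProduct_eq_zero {u : Fin r → Fin r → ℝ}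
    (hu : ∀ k l, u k ⬝ᵥ u l = if k = l then 1 else 0) {x : Fin r → ℝ}
    (hx : ∀ k, u k ⬝ᵥ x = 0) : x = 0 := by
  rw [← dotProduct_self_eq_zero, dotProduct_eq_sum_of_orthonormal hu]
  simp [hx]

/-- A strictly decreasing list of `r` eigenvalues of `Θ Θᵀ` is `gramEigenvalues Θ`. -/
theorem gramEigenvalues_eq_of_strictAnti (Θ : Mat r q) {μ : Fin r → ℝ} (hμ : StrictAnti μ)
    (h : ∀ k, ∃ v : Fin r → ℝ, v ≠ 0 ∧ (Matrix.of Θ * (Matrix.of Θ)ᵀ) *ᵥ v = μ k • v) :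
    gramEigenvalues Θ = μ := by
  obtain ⟨u, hu, heig⟩ := exists_gram_eigenbasis Θ
  have h1 : ∀ k, ∃ l, gramEigenvalues Θ l = μ k := by
    intro k
    obtain ⟨v, hv, hvk⟩ := h k
    by_contra! hne
    refine hv (eq_zero_of_forall_dotProduct_eq_zero hu fun l => ?_)
    have h2 := congrArg (u l ⬝ᵥ ·) hvk
    simp only [dotProduct_smul, smul_eq_mul] at h2
    rw [dotProduct_gram_mulVec, dotProduct_comm, ← dotProduct_gram_mulVec, heig l,
      dotProduct_smul, dotProduct_comm, smul_eq_mul] at h2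
    have h3 : (gramEigenvalues Θ l - μ k) * (u l ⬝ᵥ v) = 0 := by rw [sub_mul, h2, sub_self]
    exact (mul_eq_zero.1 h3).resolve_left (sub_ne_zero.2 (hne l))
  choose σ hσ using h1
  have hσi : Function.Injective σ := fun a b hab => hμ.injective (by rw [← hσ a, ← hσ b, hab])
  have hσs : Function.Surjective σ := Finite.surjective_of_injective hσi
  have hinj : Function.Injective (gramEigenvalues Θ) := by
    intro a b hab
    obtain ⟨a, rfl⟩ := hσs a
    obtain ⟨b, rfl⟩ := hσs b
    rw [hσ, hσ] at hab
    rw [hμ.injective hab]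
  refine (StrictAnti.range_inj ((gramEigenvalues_antitone Θ).strictAnti_of_injective hinj) hμ).1 ?_
  ext y
  constructor
  · rintro ⟨l, rfl⟩
    obtain ⟨k, rfl⟩ := hσs l
    exact ⟨k, (hσ k).symm⟩
  · rintro ⟨k, rfl⟩
    exact ⟨σ k, hσ k⟩

/-- The equation of a normalised eigenpair of `Θ Θᵀ`. -/
def eigenpairEquation (u₀ : Fin r → ℝ) (p : Mat r q × ((Fin r → ℝ) × ℝ)) : (Fin r → ℝ) × ℝ :=
  ((Matrix.of p.1 * (Matrix.of p.1)ᵀ) *ᵥ p.2.1 - p.2.2 • p.2.1, u₀ ⬝ᵥ p.2.1)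

theorem contDiff_eigenpairEquation (u₀ : Fin r → ℝ) :
    ContDiff ℝ 2 (eigenpairEquation (q := q) u₀) := by
  unfold eigenpairEquation
  refine ContDiff.prodMk ?_ (by unfold dotProduct; fun_prop)
  rw [contDiff_pi]
  intro a
  simp only [Pi.sub_apply, Pi.smul_apply, smul_eq_mul, Matrix.mulVec, dotProduct, Matrix.mul_apply,
    Matrix.transpose_apply, Matrix.of_apply]
  fun_prop

/-- The partial derivative is $(v,m)\mapsto(Av-\lambda_kv-mu_k,\ u_k\cdot v)$. Pairing a kernel
element with $u_k$ gives $m=0$, and pairing with the other $u_l$ gives $v=0$ because $\lambda_k$ is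
simple. -/
theorem eigenpairEquation_isInvertible {Θ : Mat r q} {u : Fin r → Fin r → ℝ}
    (hu : ∀ k l, u k ⬝ᵥ u l = if k = l then 1 else 0)
    (heig : ∀ k, (Matrix.of Θ * (Matrix.of Θ)ᵀ) *ᵥ u k = gramEigenvalues Θ k • u k)
    (hΘ : StrictAnti (gramEigenvalues Θ)) (k : Fin r) :
    (fderiv ℝ (eigenpairEquation (u k)) (Θ, (u k, gramEigenvalues Θ k)) ∘L
      .inr ℝ (Mat r q) ((Fin r → ℝ) × ℝ)).IsInvertible := by
  set f' := fderiv ℝ (eigenpairEquation (u k)) (Θ, (u k, gramEigenvalues Θ k)) ∘L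
      .inr ℝ (Mat r q) ((Fin r → ℝ) × ℝ) with hf'
  set A := Matrix.of Θ * (Matrix.of Θ)ᵀ with hA
  have hval : ∀ v : Fin r → ℝ, ∀ m : ℝ, f' (v, m) =
      (A *ᵥ v - gramEigenvalues Θ k • v - m • u k, u k ⬝ᵥ v) := by
    intro v m
    have hd : HasFDerivAt (eigenpairEquation (u k))
        (fderiv ℝ (eigenpairEquation (u k)) (Θ, (u k, gramEigenvalues Θ k)))
        (Θ, (u k, gramEigenvalues Θ k)) :=
      ((contDiff_eigenpairEquation (u k)).differentiable (by norm_num) _).hasFDerivAt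
    have hline := hd.hasLineDerivAt ((0 : Mat r q), (v, m))
    have hexp : HasDerivAt (fun s : ℝ => eigenpairEquation (u k)
        ((Θ, (u k, gramEigenvalues Θ k)) + s • ((0 : Mat r q), (v, m))))
        (A *ᵥ v - gramEigenvalues Θ k • v - m • u k, u k ⬝ᵥ v) 0 := by
      have he : ∀ s : ℝ, eigenpairEquation (u k)
          ((Θ, (u k, gramEigenvalues Θ k)) + s • ((0 : Mat r q), (v, m))) =
          (s • (A *ᵥ v - gramEigenvalues Θ k • v - m • u k) - (s * s) • (m • v),
            1 + s * (u k ⬝ᵥ v)) := by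
        intro s
        simp only [eigenpairEquation, Prod.mk_add_mk, Prod.smul_mk, smul_zero, add_zero,
          Matrix.mulVec_add, Matrix.mulVec_smul, dotProduct_add, dotProduct_smul, smul_eq_mul, hu,
          if_true, Prod.mk.injEq, and_true, ← hA, heig]
        ext a
        simp only [Pi.add_apply, Pi.sub_apply, Pi.smul_apply, smul_eq_mul]
        ring
      simp_rw [he]
      refine HasDerivAt.prodMk ?_ ?_
      · have h1 := (hasDerivAt_id (0 : ℝ)).smul_const (A *ᵥ v - gramEigenvalues Θ k • v - m • u k)
        have h2 := ((hasDerivAt_id (0 : ℝ)).mul (hasDerivAt_id (0 : ℝ))).smul_const (m • v)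
        refine (h1.sub h2).congr_deriv ?_
        simp
      · refine (((hasDerivAt_id (0 : ℝ)).mul_const (u k ⬝ᵥ v)).const_add 1).congr_deriv ?_
        simp
    exact HasDerivAt.unique hline hexp
  have hinj : Function.Injective f' := by
    rw [injective_iff_map_eq_zero]
    rintro ⟨v, m⟩ h
    rw [hval, Prod.mk_eq_zero] at h
    obtain ⟨h1, h2⟩ := h
    have h3 : ∀ l, (gramEigenvalues Θ l - gramEigenvalues Θ k) * (u l ⬝ᵥ v) =
        m * (if l = k then 1 else 0) := by
      intro l
      have h4 := congrArg (u l ⬝ᵥ ·) h1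
      simp only [dotProduct_sub, dotProduct_smul, smul_eq_mul, dotProduct_zero, hu] at h4
      rw [hA, dotProduct_gram_mulVec, dotProduct_comm, ← dotProduct_gram_mulVec, heig l,
        dotProduct_smul, dotProduct_comm, smul_eq_mul] at h4
      linarith
    have hm : m = 0 := by simpa using (h3 k).symm
    have hv : v = 0 := by
      refine eq_zero_of_forall_dotProduct_eq_zero hu fun l => ?_
      by_cases hl : l = k
      · rw [hl, h2]
      · have := h3 l
        rw [hm, zero_mul, mul_eq_zero] at this
        exact this.resolve_left (sub_ne_zero.2 (hΘ.injective.ne hl))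
    rw [hm, hv]; rfl
  exact ⟨(LinearEquiv.ofInjectiveEndo (f' : _ →ₗ[ℝ] _) hinj).toContinuousLinearEquiv, by ext <;> rfl⟩

/-- Near a `Θ` with distinct eigenvalues the eigenpairs of `Θ Θᵀ` can be chosen smoothly. -/
theorem exists_smooth_eigenpairs {Θ : Mat r q} (hΘ : StrictAnti (gramEigenvalues Θ)) :
    ∃ (u : Fin r → Fin r → ℝ) (U : Fin r → Mat r q → Fin r → ℝ),
      (∀ k l, u k ⬝ᵥ u l = if k = l then 1 else 0) ∧
      (∀ k, (Matrix.of Θ * (Matrix.of Θ)ᵀ) *ᵥ u k = gramEigenvalues Θ k • u k) ∧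
      (∀ k, U k Θ = u k) ∧ (∀ k, ContDiffAt ℝ 2 (U k) Θ) ∧
      (∀ k, ContDiffAt ℝ 2 (fun T => gramEigenvalues T k) Θ) ∧
      ∀ᶠ T in 𝓝 Θ, ∀ k, u k ⬝ᵥ U k T = 1 ∧
        (Matrix.of T * (Matrix.of T)ᵀ) *ᵥ U k T = gramEigenvalues T k • U k T := by
  obtain ⟨u, hu, heig⟩ := exists_gram_eigenbasis Θ
  have cdf : ∀ k, ContDiffAt ℝ 2 (eigenpairEquation (u k)) (Θ, (u k, gramEigenvalues Θ k)) :=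
    fun k => (contDiff_eigenpairEquation (u k)).contDiffAt
  have hinv := eigenpairEquation_isInvertible hu heig hΘ
  set ψ : Fin r → Mat r q → (Fin r → ℝ) × ℝ := fun k =>
    (cdf k).implicitFunction (by norm_num) (hinv k) with hψ
  have hψ0 : ∀ k, ψ k Θ = (u k, gramEigenvalues Θ k) := fun k =>
    (cdf k).implicitFunction_apply_self (by norm_num) (hinv k)
  have hψc : ∀ k, ContDiffAt ℝ 2 (ψ k) Θ := fun k =>
    (cdf k).contDiffAt_implicitFunction (by norm_num) (hinv k)
  have hψe : ∀ᶠ T in 𝓝 Θ, ∀ k, eigenpairEquation (u k) (T, ψ k T) = (0, 1) := by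
    rw [Filter.eventually_all]
    intro k
    filter_upwards [(cdf k).eventually_apply_implicitFunction (by norm_num) (hinv k)] with T hT
    rw [hT]
    simp [eigenpairEquation, heig, hu]
  -- Persistence of the strict order identifies the implicit functions with the ordered eigenvalues,
  -- by `gramEigenvalues_eq_of_strictAnti`.
  have hanti : ∀ᶠ T in 𝓝 Θ, StrictAnti fun k => (ψ k T).2 := by
    have : ∀ᶠ T in 𝓝 Θ, ∀ k l, k < l → (ψ l T).2 < (ψ k T).2 := by
      simp only [Filter.eventually_all]
      intro k l hkl
      refine ContinuousAt.eventually_lt (hψc l).continuousAt.snd (hψc k).continuousAt.snd ?_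
      simpa [hψ0] using hΘ hkl
    exact this.mono fun T hT k l hkl => hT k l hkl
  have hev : ∀ᶠ T in 𝓝 Θ, ∀ k, u k ⬝ᵥ (ψ k T).1 = 1 ∧
      (Matrix.of T * (Matrix.of T)ᵀ) *ᵥ (ψ k T).1 = (ψ k T).2 • (ψ k T).1 := by
    filter_upwards [hψe] with T hT k
    have h := hT k
    simp only [eigenpairEquation, Prod.mk.injEq, sub_eq_zero] at h
    exact ⟨h.2, h.1⟩
  have heq : ∀ᶠ T in 𝓝 Θ, gramEigenvalues T = fun k => (ψ k T).2 := by
    filter_upwards [hev, hanti] with T h1 h2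
    refine gramEigenvalues_eq_of_strictAnti T h2 fun k => ⟨_, ?_, (h1 k).2⟩
    intro h0
    have := (h1 k).1
    rw [h0, dotProduct_zero] at this
    exact zero_ne_one this
  refine ⟨u, fun k T => (ψ k T).1, hu, heig, fun k => by simp [hψ0], fun k => (hψc k).fst,
    fun k => ?_, ?_⟩
  · exact (hψc k).snd.congr_of_eventuallyEq (heq.mono fun T hT => congrFun hT k)
  · filter_upwards [hev, heq] with T h1 h2 k
    rw [h2]
    exact h1 k

end Eigen

/-! ### First and second variations of the eigenvalues. -/

section SpectralCalculus

variable {r q : ℕ}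

/-- The symmetrised bilinear form `w, u ↦ wᵀ (Θ Bᵀ + B Θᵀ) u`. -/
def gramVariation (Θ B : Mat r q) (w u : Fin r → ℝ) : ℝ :=
  (w ᵥ* Matrix.of Θ) ⬝ᵥ (u ᵥ* Matrix.of B) + (w ᵥ* Matrix.of B) ⬝ᵥ (u ᵥ* Matrix.of Θ)

theorem gramVariation_comm (Θ B : Mat r q) (w u : Fin r → ℝ) :
    gramVariation Θ B w u = gramVariation Θ B u w := by
  unfold gramVariation
  rw [dotProduct_comm, dotProduct_comm (w ᵥ* Matrix.of B), add_comm]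

theorem vecMul_add_smul (Θ B : Mat r q) (s : ℝ) (w u : Fin r → ℝ) :
    (w ᵥ* Matrix.of (Θ + s • B)) ⬝ᵥ (u ᵥ* Matrix.of (Θ + s • B)) =
      (w ᵥ* Matrix.of Θ) ⬝ᵥ (u ᵥ* Matrix.of Θ) + s * gramVariation Θ B w u +
        s ^ 2 * ((w ᵥ* Matrix.of B) ⬝ᵥ (u ᵥ* Matrix.of B)) := by
  have h : Matrix.of (Θ + s • B) = Matrix.of Θ + s • Matrix.of B := rfl
  simp only [h, gramVariation, Matrix.vecMul_add, Matrix.vecMul_smul, dotProduct_add,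
    add_dotProduct, dotProduct_smul, smul_dotProduct, smul_eq_mul]
  ring

/-- Writing the form as a pairing with a fixed vector reduces derivatives along an eigenvector curve
to `HasDerivAt.const_dotProduct`. -/
theorem exists_vec_gramVariation (Θ B : Mat r q) (w : Fin r → ℝ) :
    ∃ p : Fin r → ℝ, ∀ u, gramVariation Θ B w u = p ⬝ᵥ u := by
  refine ⟨Matrix.of B *ᵥ (w ᵥ* Matrix.of Θ) + Matrix.of Θ *ᵥ (w ᵥ* Matrix.of B), fun u => ?_⟩
  rw [gramVariation, add_dotProduct, dotProduct_comm _ u, dotProduct_comm _ u,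
    Matrix.dotProduct_mulVec, Matrix.dotProduct_mulVec, dotProduct_comm, dotProduct_comm (w ᵥ* _)]

theorem exists_vec_vecMul (B : Mat r q) (w : Fin r → ℝ) :
    ∃ p : Fin r → ℝ, ∀ u, (w ᵥ* Matrix.of B) ⬝ᵥ (u ᵥ* Matrix.of B) = p ⬝ᵥ u := by
  refine ⟨Matrix.of B *ᵥ (w ᵥ* Matrix.of B), fun u => ?_⟩
  rw [dotProduct_comm _ u, Matrix.dotProduct_mulVec, dotProduct_comm]

theorem HasDerivAt.const_dotProduct {y : ℝ → Fin r → ℝ} {y' : Fin r → ℝ} {s : ℝ}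
    (hy : HasDerivAt y y' s) (p : Fin r → ℝ) : HasDerivAt (fun s => p ⬝ᵥ y s) (p ⬝ᵥ y') s := by
  unfold dotProduct
  exact HasDerivAt.fun_sum fun i _ => ((hasDerivAt_pi.1 hy) i).const_mul (p i)

/-- First and second variation of the eigenvalues of `Θ Θᵀ` along a line. -/
theorem exists_eigenvalue_variations {Θ : Mat r q} (hΘ : StrictAnti (gramEigenvalues Θ)) :
    ∃ u : Fin r → Fin r → ℝ, (∀ k l, u k ⬝ᵥ u l = if k = l then 1 else 0) ∧
      (∀ k, (Matrix.of Θ * (Matrix.of Θ)ᵀ) *ᵥ u k = gramEigenvalues Θ k • u k) ∧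
      (∀ k, ContDiffAt ℝ 2 (fun T => gramEigenvalues T k) Θ) ∧
      ∀ (B : Mat r q) (k : Fin r),
        HasDerivAt (fun s : ℝ => gramEigenvalues (Θ + s • B) k) (gramVariation Θ B (u k) (u k)) 0 ∧
        HasSecondDerivAtZero (fun s : ℝ => gramEigenvalues (Θ + s • B) k)
          (2 * ((u k ᵥ* Matrix.of B) ⬝ᵥ (u k ᵥ* Matrix.of B)) +
            2 * ∑ j, gramVariation Θ B (u k) (u j) ^ 2 /
              (gramEigenvalues Θ k - gramEigenvalues Θ j)) := by
  obtain ⟨u, U, hu, heig, hU0, hUc, hLc, hev⟩ := exists_smooth_eigenpairs hΘ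
  refine ⟨u, hu, heig, hLc, fun B k => ?_⟩
  set y : ℝ → Fin r → ℝ := fun s => U k (Θ + s • B) with hy
  set l : ℝ → ℝ := fun s => gramEigenvalues (Θ + s • B) k with hl
  have hlin : ContDiffAt ℝ 2 (fun s : ℝ => Θ + s • B) 0 := by fun_prop
  have hlin0 : Filter.Tendsto (fun s : ℝ => Θ + s • B) (𝓝 0) (𝓝 Θ) := by
    have := hlin.continuousAt
    simpa [ContinuousAt] using this
  have hy0 : y 0 = u k := by simp [hy, hU0]
  have hl0 : l 0 = gramEigenvalues Θ k := by simp [hl]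
  have hyc : ContDiffAt ℝ 2 y 0 :=
    ContDiffAt.comp (0 : ℝ) (g := U k) (by simpa using hUc k) hlin
  have hyd : ∀ᶠ s in 𝓝 0, HasDerivAt y (deriv y s) s := by
    filter_upwards [hyc.eventually (by simp)] with s hs
    exact (hs.differentiableAt (by norm_num)).hasDerivAt
  have hyd0 : HasDerivAt y (deriv y 0) 0 := hyd.self_of_nhds
  have hydd : DifferentiableAt ℝ (deriv y) 0 := by
    have h := (hyc.fderiv_right (m := 1) (by norm_num)).differentiableAt (by norm_num)
    exact h.clm_apply (differentiableAt_const (1 : ℝ))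
  -- The eigenvalue equation along the line, projected on the unperturbed eigenvectors.
  have hequation : ∀ᶠ s in 𝓝 0, u k ⬝ᵥ y s = 1 ∧ ∀ j, gramEigenvalues Θ j * (u j ⬝ᵥ y s) +
      s * gramVariation Θ B (u j) (y s) +
      s ^ 2 * ((u j ᵥ* Matrix.of B) ⬝ᵥ (y s ᵥ* Matrix.of B)) = l s * (u j ⬝ᵥ y s) := by
    filter_upwards [hlin0.eventually hev] with s hs
    refine ⟨(hs k).1, fun j => ?_⟩
    have h1 := congrArg (u j ⬝ᵥ ·) (hs k).2
    simp only [dotProduct_smul, smul_eq_mul] at h1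
    have h2 : (u j ᵥ* Matrix.of Θ) ⬝ᵥ (U k (Θ + s • B) ᵥ* Matrix.of Θ) =
        gramEigenvalues Θ j * (u j ⬝ᵥ U k (Θ + s • B)) := by
      rw [dotProduct_comm, ← dotProduct_gram_mulVec, heig j, dotProduct_smul, smul_eq_mul,
        dotProduct_comm]
    rw [dotProduct_gram_mulVec, vecMul_add_smul, h2] at h1
    exact h1
  choose p hp using fun j => exists_vec_gramVariation Θ B (u j)
  choose w hw using fun j => exists_vec_vecMul B (u j)
  -- In the `k`-th component the normalisation `u k ⬝ᵥ y s = 1` isolates the eigenvalue. Its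
  -- explicit powers of `s` remove the second derivative of `y` from the second derivative of `l` at
  -- 0.
  have hlexp : ∀ᶠ s in 𝓝 0, l s = gramEigenvalues Θ k + s * (p k ⬝ᵥ y s) +
      s ^ 2 * (w k ⬝ᵥ y s) := by
    filter_upwards [hequation] with s hs
    have h := hs.2 k
    rw [hs.1, hp, hw, mul_one, mul_one] at h
    exact h.symm
  have hld : ∀ᶠ s in 𝓝 0, HasDerivAt l ((p k ⬝ᵥ y s) + s * (p k ⬝ᵥ deriv y s) +
      2 * s * (w k ⬝ᵥ y s) + s ^ 2 * (w k ⬝ᵥ deriv y s)) s := by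
    filter_upwards [hlexp.eventually_nhds, hyd] with s h1 h2
    refine HasDerivAt.congr_of_eventuallyEq ?_ h1
    refine ((((hasDerivAt_id s).mul (h2.const_dotProduct (p k))).const_add
      (gramEigenvalues Θ k)).add (((hasDerivAt_id s).pow 2).mul
        (h2.const_dotProduct (w k)))).congr_deriv ?_
    simp
    ring
  have hld0 : HasDerivAt l (gramVariation Θ B (u k) (u k)) 0 := by
    refine hld.self_of_nhds.congr_deriv ?_
    rw [hy0, hp]
    ring
  refine ⟨hld0, ?_⟩
  have hk0 : u k ⬝ᵥ deriv y 0 = 0 := by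
    have h1 : HasDerivAt (fun s => u k ⬝ᵥ y s) 0 0 :=
      (hasDerivAt_const (0 : ℝ) (1 : ℝ)).congr_of_eventuallyEq (hequation.mono fun s hs => hs.1)
    exact (hyd0.const_dotProduct (u k)).unique h1
  have hj0 : ∀ j, j ≠ k → u j ⬝ᵥ deriv y 0 =
      gramVariation Θ B (u k) (u j) / (gramEigenvalues Θ k - gramEigenvalues Θ j) := by
    intro j hj
    have hne : gramEigenvalues Θ k - gramEigenvalues Θ j ≠ 0 :=
      sub_ne_zero.2 (hΘ.injective.ne hj.symm)
    have h1 : HasDerivAt (fun s => gramEigenvalues Θ j * (u j ⬝ᵥ y s) + s * (p j ⬝ᵥ y s) +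
        s ^ 2 * (w j ⬝ᵥ y s)) (gramEigenvalues Θ j * (u j ⬝ᵥ deriv y 0) + p j ⬝ᵥ u k) 0 := by
      refine ((((hyd0.const_dotProduct (u j)).const_mul (gramEigenvalues Θ j)).add
        ((hasDerivAt_id (0 : ℝ)).mul (hyd0.const_dotProduct (p j)))).add
        (((hasDerivAt_id (0 : ℝ)).pow 2).mul (hyd0.const_dotProduct (w j)))).congr_deriv ?_
      simp [hy0]
    have h2 : HasDerivAt (fun s => l s * (u j ⬝ᵥ y s))
        (gramEigenvalues Θ k * (u j ⬝ᵥ deriv y 0)) 0 := by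
      refine (hld0.mul (hyd0.const_dotProduct (u j))).congr_deriv ?_
      simp [hy0, hl0, hu, hj]
    have h3 := h1.unique (h2.congr_of_eventuallyEq (hequation.mono fun s hs => by
      simpa only [← hp, ← hw] using hs.2 j))
    rw [← hp, gramVariation_comm] at h3
    rw [eq_div_iff hne]
    linarith
  have hval : p k ⬝ᵥ deriv y 0 = ∑ j, gramVariation Θ B (u k) (u j) ^ 2 /
      (gramEigenvalues Θ k - gramEigenvalues Θ j) := by
    rw [dotProduct_eq_sum_of_orthonormal hu]
    refine Finset.sum_congr rfl fun j _ => ?_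
    rw [dotProduct_comm, ← hp]
    -- The diagonal term of the sum is 0 by division by zero, in agreement with `hk0`.
    by_cases hj : j = k
    · subst hj; simp [hk0]
    · rw [hj0 j hj]; ring
  refine .of_hasDerivAt hld ?_
  have hdd := hydd.hasDerivAt
  refine ((((hyd0.const_dotProduct (p k)).add ((hasDerivAt_id (0 : ℝ)).mul
    (hdd.const_dotProduct (p k)))).add (((hasDerivAt_id (0 : ℝ)).const_mul 2).mul
    (hyd0.const_dotProduct (w k)))).add (((hasDerivAt_id (0 : ℝ)).pow 2).mul
    (hdd.const_dotProduct (w k)))).congr_deriv ?_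
  rw [hw, ← hval]
  simp [hy0]
  ring

theorem gram_inner_eq {Θ : Mat r q} {u : Fin r → Fin r → ℝ}
    (hu : ∀ k l, u k ⬝ᵥ u l = if k = l then 1 else 0)
    (heig : ∀ k, (Matrix.of Θ * (Matrix.of Θ)ᵀ) *ᵥ u k = gramEigenvalues Θ k • u k)
    (k l : Fin r) : (u k ᵥ* Matrix.of Θ) ⬝ᵥ (u l ᵥ* Matrix.of Θ) =
      if k = l then gramEigenvalues Θ k else 0 := by
  rw [← dotProduct_gram_mulVec, heig, dotProduct_smul, hu]
  split_ifs with h <;> simp [h]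

theorem vecMul_matUnit (w : Fin r → ℝ) (i : Fin r) (j : Fin q) :
    w ᵥ* Matrix.of (matUnit i j) = Pi.single j (w i) := by
  ext b
  simp only [Matrix.vecMul, dotProduct, matUnit, Matrix.of_apply]
  rw [Finset.sum_eq_single i (by simp +contextual) (by simp)]
  by_cases h : b = j
  · subst h; simp
  · simp [h]

theorem gramVariation_matUnit (Θ : Mat r q) (i : Fin r) (j : Fin q) (w u : Fin r → ℝ) :
    gramVariation Θ (matUnit i j) w u =
      (w ᵥ* Matrix.of Θ) j * u i + w i * (u ᵥ* Matrix.of Θ) j := by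
  simp [gramVariation, vecMul_matUnit]

/-- The gradients of distinct eigenvalues are orthogonal. -/
theorem sum_gramVariation_mul {Θ : Mat r q} {u : Fin r → Fin r → ℝ}
    (hu : ∀ k l, u k ⬝ᵥ u l = if k = l then 1 else 0)
    (heig : ∀ k, (Matrix.of Θ * (Matrix.of Θ)ᵀ) *ᵥ u k = gramEigenvalues Θ k • u k)
    (k l : Fin r) :
    ∑ i, ∑ j, gramVariation Θ (matUnit i j) (u k) (u k) *
      gramVariation Θ (matUnit i j) (u l) (u l) =
        if k = l then 4 * gramEigenvalues Θ k else 0 := by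
  have h : ∑ i, ∑ j, gramVariation Θ (matUnit i j) (u k) (u k) *
      gramVariation Θ (matUnit i j) (u l) (u l) =
      4 * ((u k ⬝ᵥ u l) * ((u k ᵥ* Matrix.of Θ) ⬝ᵥ (u l ᵥ* Matrix.of Θ))) := by
    simp only [dotProduct, Finset.sum_mul_sum]
    simp only [Finset.mul_sum]
    refine Finset.sum_congr rfl fun i _ => Finset.sum_congr rfl fun j _ => ?_
    rw [gramVariation_matUnit, gramVariation_matUnit]
    ring
  rw [h, hu, gram_inner_eq hu heig]
  split_ifs <;> simp

/-- The Laplacian of an eigenvalue of `Θ Θᵀ`. -/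
theorem sum_eigenvalue_second_variation {Θ : Mat r q} {u : Fin r → Fin r → ℝ}
    (hu : ∀ k l, u k ⬝ᵥ u l = if k = l then 1 else 0)
    (heig : ∀ k, (Matrix.of Θ * (Matrix.of Θ)ᵀ) *ᵥ u k = gramEigenvalues Θ k • u k)
    (k : Fin r) :
    ∑ i, ∑ j, (2 * ((u k ᵥ* Matrix.of (matUnit i j)) ⬝ᵥ (u k ᵥ* Matrix.of (matUnit i j))) +
      2 * ∑ l, gramVariation Θ (matUnit i j) (u k) (u l) ^ 2 /
        (gramEigenvalues Θ k - gramEigenvalues Θ l)) =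
      2 * q + 2 * ∑ l, (gramEigenvalues Θ k + gramEigenvalues Θ l) /
        (gramEigenvalues Θ k - gramEigenvalues Θ l) := by
  have h1 : ∑ i, ∑ j : Fin q, (u k ᵥ* Matrix.of (matUnit i j)) ⬝ᵥ
      (u k ᵥ* Matrix.of (matUnit i j)) = q := by
    have h : ∑ i, u k i * u k i = 1 := by simpa [dotProduct] using hu k k
    simp [vecMul_matUnit, ← Finset.mul_sum, h]
  have h2 : ∀ l, (∑ i, ∑ j, gramVariation Θ (matUnit i j) (u k) (u l) ^ 2) /
      (gramEigenvalues Θ k - gramEigenvalues Θ l) =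
      (gramEigenvalues Θ k + gramEigenvalues Θ l) /
        (gramEigenvalues Θ k - gramEigenvalues Θ l) := by
    intro l
    -- On the diagonal both quotients have denominator 0 and vanish.
    by_cases hkl : k = l
    · simp [hkl]
    congr 1
    have h : ∑ i, ∑ j, gramVariation Θ (matUnit i j) (u k) (u l) ^ 2 =
        (u l ⬝ᵥ u l) * ((u k ᵥ* Matrix.of Θ) ⬝ᵥ (u k ᵥ* Matrix.of Θ)) +
        2 * ((u k ⬝ᵥ u l) * ((u k ᵥ* Matrix.of Θ) ⬝ᵥ (u l ᵥ* Matrix.of Θ))) +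
        (u k ⬝ᵥ u k) * ((u l ᵥ* Matrix.of Θ) ⬝ᵥ (u l ᵥ* Matrix.of Θ)) := by
      simp only [dotProduct, Finset.sum_mul_sum]
      simp only [Finset.mul_sum, ← Finset.sum_add_distrib]
      refine Finset.sum_congr rfl fun i _ => Finset.sum_congr rfl fun j _ => ?_
      rw [gramVariation_matUnit]
      ring
    rw [h, hu, hu, hu, gram_inner_eq hu heig, gram_inner_eq hu heig, gram_inner_eq hu heig]
    simp [hkl]
  simp_rw [Finset.sum_add_distrib, ← Finset.mul_sum, h1]
  congr 2
  rw [← Finset.sum_congr rfl fun l _ => h2 l]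
  simp_rw [Finset.sum_div]
  symm
  refine Finset.sum_comm.trans ?_
  exact Finset.sum_congr rfl fun i _ => Finset.sum_comm

end SpectralCalculus

/-! ### Chain rules for twice differentiable functions. -/

section SecondOrder

variable {E F : Type*} [NormedAddCommGroup E] [NormedSpace ℝ E] [NormedAddCommGroup F]
  [NormedSpace ℝ F]

/-- The second derivative of a twice differentiable function along a curve. -/
theorem TwiceDifferentiableAt.hasSecondDerivAtZero_comp {f : E → ℝ} {γ γ' : ℝ → E} {c : E}
    (hf : TwiceDifferentiableAt f (γ 0)) (hγ : ∀ᶠ s in 𝓝 0, HasDerivAt γ (γ' s) s)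
    (hγ' : HasDerivAt γ' c 0) :
    HasSecondDerivAtZero (fun s => f (γ s))
      (fderiv ℝ (fderiv ℝ f) (γ 0) (γ' 0) (γ' 0) + fderiv ℝ f (γ 0) c) := by
  have hγ0 := hγ.self_of_nhds
  refine .of_hasDerivAt (φ' := fun s => fderiv ℝ f (γ s) (γ' s)) ?_ ?_
  · filter_upwards [hγ, hγ0.continuousAt.eventually hf.1] with s h1 h2
    exact h2.hasFDerivAt.comp_hasDerivAt s h1
  · exact (hf.2.hasFDerivAt.comp_hasDerivAt (0 : ℝ) hγ0).clm_apply hγ'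

theorem TwiceDifferentiableAt.hasSecondDerivAtZero_line {f : E → ℝ} {x : E}
    (hf : TwiceDifferentiableAt f x) (v : E) :
    HasSecondDerivAtZero (fun s : ℝ => f (x + s • v)) (fderiv ℝ (fderiv ℝ f) x v v) := by
  have h := TwiceDifferentiableAt.hasSecondDerivAtZero_comp (f := f) (γ := fun s : ℝ => x + s • v)
    (γ' := fun _ => v) (c := 0) (by simpa using hf)
    (.of_forall fun s => by simpa using ((hasDerivAt_id s).smul_const v).const_add x)
    (hasDerivAt_const _ _)
  simpa using h

theorem TwiceDifferentiableAt.lineDeriv_lineDeriv {f : E → ℝ} {x : E}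
    (hf : TwiceDifferentiableAt f x) (v : E) :
    lineDeriv ℝ (fun y => lineDeriv ℝ f y v) x v = fderiv ℝ (fderiv ℝ f) x v v := by
  have h1 : (fun y => lineDeriv ℝ f y v) =ᶠ[𝓝 x] fun y => fderiv ℝ f y v :=
    hf.1.mono fun y hy => hy.lineDeriv_eq_fderiv
  have h2 : HasFDerivAt (fun y => fderiv ℝ f y v)
      ((fderiv ℝ (fderiv ℝ f) x).flip v) x := by
    have := hf.2.hasFDerivAt.clm_apply (hasFDerivAt_const v x)
    simpa using this
  rw [(h2.congr_of_eventuallyEq h1).differentiableAt.lineDeriv_eq_fderiv,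
    (h2.congr_of_eventuallyEq h1).fderiv]
  rfl

theorem TwiceDifferentiableAt.comp_contDiffAt {f : F → ℝ} {Φ : E → F} {x : E}
    (hf : TwiceDifferentiableAt f (Φ x)) (hΦ : ContDiffAt ℝ 2 Φ x) :
    TwiceDifferentiableAt (fun y => f (Φ y)) x := by
  have h1 : ∀ᶠ y in 𝓝 x, DifferentiableAt ℝ Φ y :=
    (hΦ.eventually (by simp)).mono fun y hy => hy.differentiableAt (by norm_num)
  have h2 : ∀ᶠ y in 𝓝 x, DifferentiableAt ℝ f (Φ y) := hΦ.continuousAt.eventually hf.1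
  refine ⟨by filter_upwards [h1, h2] with y h3 h4 using h4.comp y h3, ?_⟩
  have h3 : fderiv ℝ (fun y => f (Φ y)) =ᶠ[𝓝 x] fun y => (fderiv ℝ f (Φ y)).comp (fderiv ℝ Φ y) := by
    filter_upwards [h1, h2] with y h3 h4 using fderiv_comp y h4 h3
  refine DifferentiableAt.congr_of_eventuallyEq ?_ h3
  exact (hf.2.comp x (hΦ.differentiableAt (by norm_num))).clm_comp
    ((hΦ.fderiv_right (m := 1) (by norm_num)).differentiableAt (by norm_num))

theorem HasSecondDerivAtZero.unique {φ : ℝ → ℝ} {a b : ℝ} (ha : HasSecondDerivAtZero φ a)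
    (hb : HasSecondDerivAtZero φ b) : a = b := ha.2.unique hb.2

theorem ContDiffAt.twiceDifferentiableAt {f : E → ℝ} {x : E} (hf : ContDiffAt ℝ 2 f x) :
    TwiceDifferentiableAt f x :=
  ⟨(hf.eventually (by simp)).mono fun y hy => hy.differentiableAt (by norm_num),
    (hf.fderiv_right (m := 1) (by norm_num)).differentiableAt (by norm_num)⟩

end SecondOrder

/-! ### The Laplacian of a spectral function. -/

section SpectralLaplacian

variable {r q : ℕ}

theorem HasCoordLaplacian.unique {p : Mat r q → ℝ} {x : Mat r q} {ℓ ℓ' : ℝ}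
    (h : HasCoordLaplacian p x ℓ) (h' : HasCoordLaplacian p x ℓ') : ℓ = ℓ' := by
  obtain ⟨a, ha, rfl⟩ := h
  obtain ⟨b, hb, rfl⟩ := h'
  exact Finset.sum_congr rfl fun i _ => Finset.sum_congr rfl fun j _ => (ha i j).unique (hb i j)

theorem TwiceDifferentiableAt.hasCoordLaplacian {p : Mat r q → ℝ} {x : Mat r q}
    (hp : TwiceDifferentiableAt p x) : HasCoordLaplacian p x (matLaplacian p x) :=
  ⟨_, fun i j => hp.hasSecondDerivAtZero_line (matUnit i j),
    Finset.sum_congr rfl fun i _ => Finset.sum_congr rfl fun j _ =>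
      (hp.lineDeriv_lineDeriv (matUnit i j)).symm⟩

theorem contDiffAt_gramEigenvalues {Θ : Mat r q} (hΘ : StrictAnti (gramEigenvalues Θ)) :
    ContDiffAt ℝ 2 gramEigenvalues Θ := by
  obtain ⟨u, -, -, h, -⟩ := exists_eigenvalue_variations hΘ
  exact contDiffAt_pi.2 h

theorem TwiceDifferentiableAt.spectralPrior {g : (Fin r → ℝ) → ℝ} {Θ : Mat r q}
    (hΘ : StrictAnti (gramEigenvalues Θ)) (hg : TwiceDifferentiableAt g (gramEigenvalues Θ)) :
    TwiceDifferentiableAt (spectralPrior q g) Θ :=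
  hg.comp_contDiffAt (contDiffAt_gramEigenvalues hΘ)

/-- Exchanging the indices flips the sign of the denominator, so both halves of the numerator
contribute equally. The diagonal may be added since its inverse is 0. -/
theorem sum_sum_erase_sub_div (lam φ : Fin r → ℝ) :
    ∑ k, ∑ j ∈ Finset.univ.erase k, (lam k * φ k - lam j * φ j) / (lam k - lam j) =
      ∑ k, 2 * (lam k * (∑ j, (lam k - lam j)⁻¹) * φ k) := by
  have h1 : ∀ k, ∑ j ∈ Finset.univ.erase k, (lam k * φ k - lam j * φ j) / (lam k - lam j) =
      ∑ j, (lam k * φ k - lam j * φ j) / (lam k - lam j) := fun k =>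
    Finset.sum_erase _ (by simp)
  have h2 : ∑ k, ∑ j, lam j * φ j / (lam k - lam j) =
      -∑ k, ∑ j, lam k * φ k / (lam k - lam j) := by
    rw [Finset.sum_comm]
    simp only [← Finset.sum_neg_distrib]
    refine Finset.sum_congr rfl fun k _ => Finset.sum_congr rfl fun j _ => ?_
    rw [← div_neg, neg_sub]
  simp only [h1]
  simp only [sub_div, Finset.sum_sub_distrib, h2]
  rw [sub_neg_eq_add, ← two_mul, Finset.mul_sum]
  refine Finset.sum_congr rfl fun k _ => ?_
  rw [Finset.mul_sum, Finset.mul_sum, Finset.sum_mul, Finset.mul_sum]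
  exact Finset.sum_congr rfl fun j _ => by ring

theorem spectralLaplacian_eq_sum (g : (Fin r → ℝ) → ℝ) (lam : Fin r → ℝ) :
    spectralLaplacian q g lam = ∑ k, (2 * ((q : ℝ) - r + 1) * eigPartial k g lam +
      4 * (lam k * (∑ j, (lam k - lam j)⁻¹) * eigPartial k g lam) +
      4 * lam k * eigPartial k (eigPartial k g) lam) := by
  rw [spectralLaplacian, Finset.sum_add_distrib, Finset.sum_add_distrib, sum_sum_erase_sub_div,
    ← Finset.sum_add_distrib, ← Finset.sum_add_distrib, Finset.mul_sum]
  exact Finset.sum_congr rfl fun k _ => by ring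

/-- Off the diagonal, $(a+b)/(a-b)=2a/(a-b)-1$; the diagonal term is 0, hence `r - 1` rather than
`r`. -/
theorem sum_add_div_sub {lam : Fin r → ℝ} (hlam : Function.Injective lam) (k : Fin r) :
    ∑ l, (lam k + lam l) / (lam k - lam l) = 2 * (lam k * ∑ l, (lam k - lam l)⁻¹) - (r - 1) := by
  have h : ∀ l, (lam k + lam l) / (lam k - lam l) =
      2 * (lam k * (lam k - lam l)⁻¹) - 1 + if k = l then 1 else 0 := by
    intro l
    by_cases hkl : k = l
    · simp [hkl]
    · have : lam k - lam l ≠ 0 := sub_ne_zero.2 (hlam.ne hkl)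
      simp only [if_neg hkl]
      field_simp
      ring
  simp only [h, Finset.sum_add_distrib, Finset.sum_sub_distrib, ← Finset.mul_sum]
  simp
  ring

theorem clm_apply_eq_sum {F : Type*} [NormedAddCommGroup F] [NormedSpace ℝ F]
    (f : (Fin r → ℝ) →L[ℝ] F) (c : Fin r → ℝ) :
    f c = ∑ k, c k • f (Pi.single k 1) := by
  conv_lhs => rw [pi_eq_sum_univ' c]
  rw [map_sum]
  refine Finset.sum_congr rfl fun k _ => ?_
  rw [map_smul]

/-- The Laplacian of a spectral function of `Θ Θᵀ`. -/
theorem hasCoordLaplacian_spectralPrior {g : (Fin r → ℝ) → ℝ} {Θ : Mat r q}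
    (hΘ : StrictAnti (gramEigenvalues Θ)) (hg : TwiceDifferentiableAt g (gramEigenvalues Θ)) :
    HasCoordLaplacian (spectralPrior q g) Θ (spectralLaplacian q g (gramEigenvalues Θ)) := by
  obtain ⟨u, hu, heig, -, hvar⟩ := exists_eigenvalue_variations hΘ
  set Λ := gramEigenvalues Θ with hΛ
  set H := fderiv ℝ (fderiv ℝ g) Λ with hH
  set p : Fin r → Fin q → Fin r → ℝ := fun i j k => gramVariation Θ (matUnit i j) (u k) (u k)
    with hp
  set c : Fin r → Fin q → Fin r → ℝ := fun i j k =>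
    2 * ((u k ᵥ* Matrix.of (matUnit i j)) ⬝ᵥ (u k ᵥ* Matrix.of (matUnit i j))) +
      2 * ∑ l, gramVariation Θ (matUnit i j) (u k) (u l) ^ 2 / (Λ k - Λ l) with hc
  refine ⟨fun i j => H (p i j) (p i j) + fderiv ℝ g Λ (c i j), fun i j => ?_, ?_⟩
  · set γ : ℝ → Fin r → ℝ := fun s => gramEigenvalues (Θ + s • matUnit i j) with hγ
    have hγ0 : γ 0 = Λ := by simp [hγ, hΛ]
    have h1 : ∀ᶠ s in 𝓝 0, HasDerivAt γ (fun k => deriv (fun t => γ t k) s) s := by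
      have : ∀ᶠ s in 𝓝 0, ∀ k, DifferentiableAt ℝ (fun t => γ t k) s :=
        Filter.eventually_all.2 fun k => (hvar (matUnit i j) k).2.1
      filter_upwards [this] with s hs
      exact hasDerivAt_pi.2 fun k => (hs k).hasDerivAt
    have h2 : HasDerivAt (fun s k => deriv (fun t => γ t k) s) (c i j) 0 :=
      hasDerivAt_pi.2 fun k => (hvar (matUnit i j) k).2.2
    have h3 := TwiceDifferentiableAt.hasSecondDerivAtZero_comp (f := g) (γ := γ)
      (by rw [hγ0]; exact hg) h1 h2
    have h4 : (fun k => deriv (fun t => γ t k) 0) = p i j := by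
      ext k; exact (hvar (matUnit i j) k).1.deriv
    rw [h4, hγ0] at h3
    exact h3
  · have e1 : ∀ k, eigPartial k g Λ = fderiv ℝ g Λ (Pi.single k 1) := fun k =>
      hg.1.self_of_nhds.lineDeriv_eq_fderiv
    have e2 : ∀ k, eigPartial k (eigPartial k g) Λ = H (Pi.single k 1) (Pi.single k 1) := fun k =>
      hg.lineDeriv_lineDeriv _
    have s1 : ∑ i, ∑ j, fderiv ℝ g Λ (c i j) =
        ∑ k, (2 * q + 2 * ∑ l, (Λ k + Λ l) / (Λ k - Λ l)) * eigPartial k g Λ := by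
      have h1 : ∀ k, 2 * q + 2 * ∑ l, (Λ k + Λ l) / (Λ k - Λ l) = ∑ i, ∑ j, c i j k := fun k =>
        (sum_eigenvalue_second_variation hu heig k).symm
      simp_rw [h1, Finset.sum_mul, e1]
      symm
      refine Finset.sum_comm.trans (Finset.sum_congr rfl fun i _ => ?_)
      refine Finset.sum_comm.trans (Finset.sum_congr rfl fun j _ => ?_)
      rw [clm_apply_eq_sum]
      rfl
    -- Orthogonality of the eigenvalue gradients removes all mixed second derivatives of `g`.
    have s2 : ∑ i, ∑ j, H (p i j) (p i j) =
        ∑ k, 4 * Λ k * eigPartial k (eigPartial k g) Λ := by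
      have h1 : ∀ i j, H (p i j) (p i j) =
          ∑ k, ∑ l, p i j k * p i j l * H (Pi.single k 1) (Pi.single l 1) := by
        intro i j
        rw [clm_apply_eq_sum H (p i j), _root_.sum_apply]
        refine Finset.sum_congr rfl fun k _ => ?_
        rw [_root_.smul_apply, clm_apply_eq_sum (H (Pi.single k 1)) (p i j),
          Finset.smul_sum]
        refine Finset.sum_congr rfl fun l _ => ?_
        simp only [smul_eq_mul]
        ring
      have h2 : ∀ k l, ∑ i, ∑ j, p i j k * p i j l * H (Pi.single k 1) (Pi.single l 1) =
          if k = l then 4 * Λ k * H (Pi.single k 1) (Pi.single l 1) else 0 := by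
        intro k l
        simp_rw [← Finset.sum_mul]
        rw [sum_gramVariation_mul hu heig]
        split_ifs <;> simp [hΛ]
      simp_rw [h1]
      have h3 : ∑ i, ∑ j : Fin q, ∑ k, ∑ l,
          p i j k * p i j l * H (Pi.single k 1) (Pi.single l 1) =
          ∑ k, ∑ l, ∑ i, ∑ j, p i j k * p i j l * H (Pi.single k 1) (Pi.single l 1) := by
        simp_rw [Finset.sum_comm (s := (Finset.univ : Finset (Fin q)))]
        rw [Finset.sum_comm]
        refine Finset.sum_congr rfl fun k _ => ?_
        rw [Finset.sum_comm]
      rw [h3]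
      simp_rw [h2, e2]
      simp
    simp_rw [Finset.sum_add_distrib]
    rw [s1, s2, spectralLaplacian_eq_sum, ← Finset.sum_add_distrib]
    refine Finset.sum_congr rfl fun k _ => ?_
    rw [sum_add_div_sub hΘ.injective]
    ring

theorem matLaplacian_spectralPrior {g : (Fin r → ℝ) → ℝ} {Θ : Mat r q}
    (hΘ : StrictAnti (gramEigenvalues Θ)) (hg : TwiceDifferentiableAt g (gramEigenvalues Θ)) :
    matLaplacian (spectralPrior q g) Θ = spectralLaplacian q g (gramEigenvalues Θ) :=
  (hg.spectralPrior hΘ).hasCoordLaplacian.unique (hasCoordLaplacian_spectralPrior hΘ hg)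

end SpectralLaplacian

/-! ### Null sets of zeros of analytic functions. -/

section AnalyticNull

/-- The zeros of an analytic function that does not vanish identically form a null set. -/
theorem ae_ne_zero_of_analyticAt {E : Type*} [NormedAddCommGroup E] [NormedSpace ℝ E]
    [MeasurableSpace E] [BorelSpace E] [FiniteDimensional ℝ E] (μ : Measure E)
    [μ.IsAddHaarMeasure] {F : E → ℝ} (hF : ∀ x, AnalyticAt ℝ F x) {x₀ : E} (h0 : F x₀ ≠ 0) :
    ∀ᵐ x ∂μ, F x ≠ 0 := by
  -- On the line through `x₀` and `x` the function is analytic and nonzero at `t = 0`, so its zeros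
  -- are isolated.
  have hline : ∀ x, ∀ᵐ t : ℝ, F (AffineMap.homothety x₀ t x) ≠ 0 := by
    intro x
    have han : AnalyticOnNhd ℝ (fun t : ℝ => F (AffineMap.homothety x₀ t x)) Set.univ := by
      intro t _
      refine AnalyticAt.comp (g := F) (hF _) ?_
      simp only [AffineMap.homothety_apply, vsub_eq_sub, vadd_eq_add]
      fun_prop
    have h := han.preimage_zero_mem_codiscrete (x := 0) (by simpa using h0)
    have h1 := ae_restrict_le_codiscreteWithin (μ := (volume : Measure ℝ)) MeasurableSet.univ h
    rw [Measure.restrict_univ] at h1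
    filter_upwards [h1] with t ht using ht
  have hcont : Continuous F := continuous_iff_continuousAt.2 fun x => (hF x).continuousAt
  have hmeas : MeasurableSet {p : E × ℝ | F (AffineMap.homothety x₀ p.2 p.1) ≠ 0} := by
    refine (isOpen_ne_fun ?_ continuous_const).measurableSet
    refine hcont.comp ?_
    simp only [AffineMap.homothety_apply, vsub_eq_sub, vadd_eq_add]
    fun_prop
  -- By Fubini some nonzero ratio `t` is good for almost every `x`; the homothety carries its null
  -- set onto the zeros of `F`.
  have hall : ∀ᵐ t : ℝ, ∀ᵐ x ∂μ, F (AffineMap.homothety x₀ t x) ≠ 0 :=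
    (Measure.ae_ae_comm (ν := (volume : Measure ℝ)) hmeas).1 (.of_forall hline)
  have hne : ∀ᵐ t : ℝ, t ≠ 0 := by simp [ae_iff]
  obtain ⟨t, ht, ht0⟩ := (hall.and hne).exists
  have h1 : {x | ¬ F x ≠ 0} ⊆
      AffineMap.homothety x₀ t '' {x | ¬ F (AffineMap.homothety x₀ t x) ≠ 0} := by
    intro y hy
    have h2 : AffineMap.homothety x₀ t (AffineMap.homothety x₀ t⁻¹ y) = y := by
      simp [AffineMap.homothety_apply, smul_smul, ht0]
    exact ⟨AffineMap.homothety x₀ t⁻¹ y, by rw [Set.mem_ofPred_eq, h2]; exact hy, h2⟩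
  rw [ae_iff]
  refine measure_mono_null h1 ?_
  rw [Measure.addHaar_image_homothety, ae_iff.1 ht, mul_zero]

theorem AnalyticAt.matrix_det {E : Type*} [NormedAddCommGroup E] [NormedSpace ℝ E] {r : ℕ}
    {M : E → Matrix (Fin r) (Fin r) ℝ} {x : E} (hM : ∀ a b, AnalyticAt ℝ (fun y => M y a b) x) :
    AnalyticAt ℝ (fun y => (M y).det) x := by
  simp only [Matrix.det_apply']
  refine Finset.analyticAt_fun_sum _ fun σ _ => analyticAt_const.mul ?_
  exact Finset.analyticAt_fun_prod _ fun i _ => hM _ _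

end AnalyticNull

/-! ### Discriminant and determinant as functions of the matrix entries. -/

section GramDiscriminant

variable {r q : ℕ}

/-- The discriminant of the characteristic polynomial of `Θ Θᵀ`, as the determinant of the Hankel
matrix of power sums of the eigenvalues. -/
def gramDiscriminant (Θ : Mat r q) : ℝ :=
  (Matrix.of fun k l : Fin r =>
    ((Matrix.of Θ * (Matrix.of Θ)ᵀ) ^ ((k : ℕ) + (l : ℕ))).trace).det

theorem analyticAt_gram_apply (Θ : Mat r q) (a b : Fin r) :
    AnalyticAt ℝ (fun T : Mat r q => (Matrix.of T * (Matrix.of T)ᵀ) a b) Θ := by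
  simp only [Matrix.mul_apply, Matrix.transpose_apply, Matrix.of_apply]
  have h : ∀ a c, AnalyticAt ℝ (fun T : Mat r q => T a c) Θ := fun a c =>
    ((ContinuousLinearMap.proj (R := ℝ) (φ := fun _ : Fin q => ℝ) c).comp
      (ContinuousLinearMap.proj (R := ℝ) (φ := fun _ : Fin r => Fin q → ℝ) a)).analyticAt Θ
  exact Finset.analyticAt_fun_sum _ fun c _ => (h a c).mul (h b c)

/-- Traces of powers are polynomials in the entries, whereas the ordered eigenvalues need not be
smooth at collisions; this is the reason for the Hankel form. -/
theorem analyticAt_gramDiscriminant (Θ : Mat r q) : AnalyticAt ℝ gramDiscriminant Θ := by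
  have h : ∀ (n : ℕ) (a b : Fin r),
      AnalyticAt ℝ (fun T : Mat r q => ((Matrix.of T * (Matrix.of T)ᵀ) ^ n) a b) Θ := by
    intro n
    induction n with
    | zero => exact fun a b => analyticAt_const
    | succ n ih =>
      intro a b
      simp only [pow_succ, Matrix.mul_apply (M := _ ^ n)]
      exact Finset.analyticAt_fun_sum _ fun c _ => (ih a c).mul (analyticAt_gram_apply Θ c b)
  refine AnalyticAt.matrix_det fun a b => ?_
  simp only [Matrix.of_apply, Matrix.trace, Matrix.diag_apply]
  exact Finset.analyticAt_fun_sum _ fun c _ => h _ c c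

theorem analyticAt_det_gram (Θ : Mat r q) :
    AnalyticAt ℝ (fun T : Mat r q => (Matrix.of T * (Matrix.of T)ᵀ).det) Θ :=
  AnalyticAt.matrix_det fun a b => analyticAt_gram_apply Θ a b

theorem exists_gram_diagonalization (Θ : Mat r q) : ∃ U : Matrix (Fin r) (Fin r) ℝ,
    U * Uᵀ = 1 ∧ Matrix.of Θ * (Matrix.of Θ)ᵀ = Uᵀ * diagonal (gramEigenvalues Θ) * U := by
  obtain ⟨u, hu, heig⟩ := exists_gram_eigenbasis Θ
  have h1 : Matrix.of u * (Matrix.of u)ᵀ = 1 := by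
    ext k l
    rw [Matrix.mul_apply, Matrix.one_apply, ← hu k l]
    rfl
  refine ⟨Matrix.of u, h1, ?_⟩
  have h2 : (Matrix.of u)ᵀ * Matrix.of u = 1 := mul_eq_one_comm.1 h1
  have h3 : (Matrix.of Θ * (Matrix.of Θ)ᵀ) * (Matrix.of u)ᵀ =
      (Matrix.of u)ᵀ * diagonal (gramEigenvalues Θ) := by
    ext a k
    rw [Matrix.mul_diagonal, mul_comm]
    exact congrFun (heig k) a
  rw [← h3, Matrix.mul_assoc, h2, Matrix.mul_one]

theorem trace_gram_pow (Θ : Mat r q) (n : ℕ) :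
    ((Matrix.of Θ * (Matrix.of Θ)ᵀ) ^ n).trace = ∑ i, gramEigenvalues Θ i ^ n := by
  obtain ⟨U, hU, hΘ⟩ := exists_gram_diagonalization Θ
  have h : ∀ n, (Matrix.of Θ * (Matrix.of Θ)ᵀ) ^ n =
      Uᵀ * diagonal (gramEigenvalues Θ) ^ n * U := by
    intro n
    induction n with
    | zero => simpa using (mul_eq_one_comm.1 hU).symm
    | succ n ih =>
      rw [pow_succ, ih, hΘ, pow_succ]
      simp only [Matrix.mul_assoc]
      rw [← Matrix.mul_assoc U, hU, Matrix.one_mul]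
  rw [h, Matrix.trace_mul_cycle, hU, Matrix.one_mul, Matrix.diagonal_pow, Matrix.trace_diagonal]
  rfl

/-- The power sums $\sum_i\lambda_i^{k+l}$ are the entries of $V^\top V$ for the Vandermonde matrix
$V$. -/
theorem gramDiscriminant_eq (Θ : Mat r q) :
    gramDiscriminant Θ = (vandermonde (gramEigenvalues Θ)).det ^ 2 := by
  rw [gramDiscriminant, sq]
  nth_rw 1 [← Matrix.det_transpose (vandermonde _)]
  rw [← Matrix.det_mul]
  congr 1
  ext k l
  rw [Matrix.of_apply, trace_gram_pow]
  simp only [Matrix.mul_apply, Matrix.transpose_apply, vandermonde_apply, pow_add]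

theorem gramDiscriminant_pos_iff {Θ : Mat r q} :
    0 < gramDiscriminant Θ ↔ StrictAnti (gramEigenvalues Θ) := by
  rw [gramDiscriminant_eq, sq_pos_iff, det_vandermonde_ne_zero_iff]
  exact ⟨(gramEigenvalues_antitone Θ).strictAnti_of_injective, StrictAnti.injective⟩

theorem det_gram (Θ : Mat r q) :
    (Matrix.of Θ * (Matrix.of Θ)ᵀ).det = ∏ i, gramEigenvalues Θ i := by
  obtain ⟨U, hU, hΘ⟩ := exists_gram_diagonalization Θ
  rw [hΘ, Matrix.det_mul, Matrix.det_mul, mul_right_comm, ← Matrix.det_mul,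
    mul_eq_one_comm.1 hU, Matrix.det_one, one_mul, Matrix.det_diagonal]

theorem gramEigenvalues_nonneg (Θ : Mat r q) (k : Fin r) : 0 ≤ gramEigenvalues Θ k := by
  obtain ⟨u, hu, heig⟩ := exists_gram_eigenbasis Θ
  have h := gram_inner_eq hu heig k k
  rw [if_pos rfl] at h
  rw [← h]
  exact Finset.sum_nonneg fun i _ => mul_self_nonneg _

theorem gramEigenvalues_pos_of_det_ne_zero {Θ : Mat r q}
    (h : (Matrix.of Θ * (Matrix.of Θ)ᵀ).det ≠ 0) (k : Fin r) : 0 < gramEigenvalues Θ k := by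
  rw [det_gram, Finset.prod_ne_zero_iff] at h
  exact (gramEigenvalues_nonneg Θ k).lt_of_ne' (h k (Finset.mem_univ k))

/-- The witness, a rectangular diagonal matrix, shows that the analytic barriers do not vanish
identically. -/
theorem exists_gramEigenvalues_strictAnti_pos (hrq : r ≤ q) :
    ∃ Θ : Mat r q, StrictAnti (gramEigenvalues Θ) ∧ ∀ k, 0 < gramEigenvalues Θ k := by
  set μ : Fin r → ℝ := fun k => (r : ℝ) - (k : ℕ) with hμ
  have hμpos : ∀ k, 0 < μ k := fun k => by simp [hμ]
  have hμa : StrictAnti μ := fun k l hkl => by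
    have : ((k : ℕ) : ℝ) < (l : ℕ) := by exact_mod_cast hkl
    simp only [hμ]
    linarith
  set Θ : Mat r q := fun i j => if j = Fin.castLE hrq i then √(μ i) else 0 with hΘ
  have hgram : Matrix.of Θ * (Matrix.of Θ)ᵀ = diagonal μ := by
    ext a b
    rw [Matrix.mul_apply]
    simp only [hΘ, Matrix.of_apply, Matrix.transpose_apply, ite_mul, zero_mul]
    rw [Finset.sum_ite_eq' ]
    by_cases hab : a = b
    · simp [hab, Real.mul_self_sqrt (hμpos b).le]
    · simp [hab]
  have he : gramEigenvalues Θ = μ := by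
    refine gramEigenvalues_eq_of_strictAnti Θ hμa fun k => ⟨Pi.single k 1, by simp, ?_⟩
    rw [hgram]
    ext a
    by_cases hak : a = k
    · subst hak; simp [Matrix.mulVec_diagonal]
    · simp [Matrix.mulVec_diagonal, hak]
  exact ⟨Θ, by rw [he]; exact hμa, by rw [he]; exact hμpos⟩

/-- If `Θ Θᵀ` has distinct eigenvalues, then `Θ` has corank at most one. -/
theorem adjugate_ne_zero_of_strictAnti {Θ : Mat r r} (hΘ : StrictAnti (gramEigenvalues Θ))
    (hdet : (Matrix.of Θ).det = 0) : (Matrix.of Θ).adjugate ≠ 0 := by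
  intro h0
  obtain ⟨U, hU, hg⟩ := exists_gram_diagonalization Θ
  have hdet' : (Matrix.of Θ * (Matrix.of Θ)ᵀ).det = 0 := by rw [Matrix.det_mul, hdet, zero_mul]
  rw [det_gram, Finset.prod_eq_zero_iff] at hdet'
  obtain ⟨i, -, hi⟩ := hdet'
  have h1 : diagonal (gramEigenvalues Θ) = U * (Matrix.of Θ * (Matrix.of Θ)ᵀ) * Uᵀ := by
    rw [hg]
    simp only [Matrix.mul_assoc]
    rw [hU, Matrix.mul_one, ← Matrix.mul_assoc, hU, Matrix.one_mul]
  -- The adjugate is multiplicative up to order, so the diagonal form also has adjugate 0. Its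
  -- `i`-th entry is the product of the other eigenvalues, so a second one vanishes.
  have h2 := congrArg adjugate h1
  rw [adjugate_mul_distrib, adjugate_mul_distrib, adjugate_mul_distrib, h0, adjugate_diagonal] at h2
  have h3 := congrFun (congrFun h2 i) i
  simp only [Matrix.mul_zero, Matrix.zero_mul, Matrix.diagonal_apply_eq, Matrix.zero_apply,
    Finset.prod_eq_zero_iff] at h3
  obtain ⟨j, hj, hj0⟩ := h3
  exact Finset.ne_of_mem_erase hj (hΘ.injective (by rw [hj0, hi]))

/-- The determinant is affine in each entry with the cofactor as slope. This yields both its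
harmonicity and the kink of its absolute value. -/
theorem det_add_smul_matUnit (Θ : Mat r r) (i j : Fin r) (s : ℝ) :
    (Matrix.of (Θ + s • matUnit i j)).det =
      (Matrix.of Θ).det + s * (Matrix.of Θ).adjugate j i := by
  have h : Matrix.of (Θ + s • matUnit i j) =
      (Matrix.of Θ).updateRow i (Matrix.of Θ i + s • Pi.single j 1) := by
    ext a b
    by_cases hai : a = i
    · subst hai; simp [matUnit]
    · simp [matUnit, hai]
  rw [h, Matrix.det_updateRow_add, Matrix.det_updateRow_smul, Matrix.updateRow_eq_self,
    Matrix.adjugate_apply]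

end GramDiscriminant

/-! ### Barriers at collisions and rank deficiency. -/

section Barriers

variable {r q : ℕ}

theorem HasSecondDerivAtZero.congr {φ ψ : ℝ → ℝ} {a : ℝ} (h : HasSecondDerivAtZero φ a)
    (he : ψ =ᶠ[𝓝 0] φ) : HasSecondDerivAtZero ψ a := by
  refine ⟨?_, h.2.congr_of_eventuallyEq he.deriv⟩
  filter_upwards [h.1, he.eventually_nhds] with s h1 h2 using h1.congr_of_eventuallyEq h2

theorem HasCoordLaplacian.congr {p p' : Mat r q → ℝ} {x : Mat r q} {ℓ : ℝ}
    (h : HasCoordLaplacian p x ℓ) (he : p' =ᶠ[𝓝 x] p) : HasCoordLaplacian p' x ℓ := by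
  obtain ⟨a, ha, hs⟩ := h
  refine ⟨a, fun i j => (ha i j).congr ?_, hs⟩
  have hlin : Filter.Tendsto (fun s : ℝ => x + s • matUnit i j) (𝓝 0) (𝓝 x) := by
    have : Continuous (fun s : ℝ => x + s • matUnit i j) := by fun_prop
    simpa using this.tendsto 0
  exact hlin.eventually he

theorem eigPartial_eigPartial {g : (Fin r → ℝ) → ℝ} {lam : Fin r → ℝ} {k : Fin r}
    {φ : (Fin r → ℝ) → ℝ} {a : ℝ} (h : ∀ᶠ y in 𝓝 lam, eigPartial k g y = φ y)
    (hφ : HasDerivAt (fun t : ℝ => φ (lam + t • Pi.single k 1)) a 0) :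
    eigPartial k (eigPartial k g) lam = a := by
  have hlin : Filter.Tendsto (fun t : ℝ => lam + t • (Pi.single k 1 : Fin r → ℝ)) (𝓝 0)
      (𝓝 lam) := by
    have : Continuous (fun t : ℝ => lam + t • (Pi.single k 1 : Fin r → ℝ)) := by fun_prop
    simpa using this.tendsto 0
  exact (hφ.congr_of_eventuallyEq (hlin.eventually h)).deriv

theorem hasDerivAt_add_smul_single_apply (lam : Fin r → ℝ) (k i : Fin r) :
    HasDerivAt (fun t : ℝ => (lam + t • (Pi.single k 1 : Fin r → ℝ)) i)
      ((Pi.single k 1 : Fin r → ℝ) i) 0 := by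
  simpa using ((hasDerivAt_id (0 : ℝ)).mul_const ((Pi.single k 1 : Fin r → ℝ) i)).const_add (lam i)

theorem sum_sum_inv_sub (lam : Fin r → ℝ) : ∑ k, ∑ j, (lam k - lam j)⁻¹ = 0 := by
  have h : ∑ k, ∑ j, (lam k - lam j)⁻¹ = -∑ k, ∑ j, (lam k - lam j)⁻¹ := by
    conv_lhs => rw [Finset.sum_comm]
    simp only [← Finset.sum_neg_distrib]
    refine Finset.sum_congr rfl fun k _ => Finset.sum_congr rfl fun j _ => ?_
    rw [← inv_neg, neg_sub]
  linarith

/-- The cyclic identity behind the harmonicity of the logarithm of the discriminant. -/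
theorem sum_mul_sq_sum_inv_sub {lam : Fin r → ℝ} (hlam : Function.Injective lam) :
    ∑ k, lam k * (∑ j, (lam k - lam j)⁻¹) ^ 2 = ∑ k, lam k * ∑ j, ((lam k - lam j) ^ 2)⁻¹ := by
  -- The summand of the square minus its diagonal. For distinct indices the cyclic sum is the second
  -- divided difference of the identity function, hence 0; when two indices agree every term
  -- vanishes.
  set T : Fin r → Fin r → Fin r → ℝ := fun k i j => lam k * ((lam k - lam i)⁻¹ * (lam k - lam j)⁻¹ -
    if i = j then ((lam k - lam i) ^ 2)⁻¹ else 0) with hT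
  have h1 : ∑ k, ∑ i, ∑ j, T k i j = ∑ k, lam k * (∑ j, (lam k - lam j)⁻¹) ^ 2 -
      ∑ k, lam k * ∑ j, ((lam k - lam j) ^ 2)⁻¹ := by
    rw [← Finset.sum_sub_distrib]
    refine Finset.sum_congr rfl fun k _ => ?_
    rw [← mul_sub, sq, Finset.sum_mul_sum, ← Finset.sum_sub_distrib, Finset.mul_sum]
    refine Finset.sum_congr rfl fun i _ => ?_
    rw [← Finset.mul_sum, Finset.sum_sub_distrib]
    simp
  have h2 : ∀ k i j, T k i j + T i j k + T j k i = 0 := by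
    intro k i j
    simp only [hT]
    by_cases hki : k = i
    · subst hki
      by_cases hkj : k = j
      · subst hkj; simp
      · simp [Ne.symm hkj, hkj]
        exact .inr (by rw [sq, mul_inv, sub_self])
    by_cases hij : i = j
    · subst hij
      simp [Ne.symm hki, hki]
      exact .inr (by rw [sq, mul_inv, sub_self])
    by_cases hkj : k = j
    · subst hkj
      simp [Ne.symm hki, hki]
      exact .inr (by rw [sq, mul_inv, sub_self])
    have e1 : lam k - lam i ≠ 0 := sub_ne_zero.2 (hlam.ne hki)
    have e2 : lam i - lam j ≠ 0 := sub_ne_zero.2 (hlam.ne hij)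
    have e3 : lam k - lam j ≠ 0 := sub_ne_zero.2 (hlam.ne hkj)
    rw [if_neg hij, if_neg (Ne.symm hkj), if_neg hki, ← neg_sub (lam k) (lam i),
      ← neg_sub (lam k) (lam j), ← neg_sub (lam i) (lam j)]
    field_simp
    ring
  have h3 : ∑ k, ∑ i, ∑ j, T i j k = ∑ k, ∑ i, ∑ j, T k i j := by
    rw [Finset.sum_comm]
    exact Finset.sum_congr rfl fun k _ => Finset.sum_comm
  have h4 : ∑ k, ∑ i, ∑ j, T j k i = ∑ k, ∑ i, ∑ j, T k i j :=
    (Finset.sum_congr rfl fun k _ => Finset.sum_comm).trans Finset.sum_comm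
  have h5 : ∑ k, ∑ i, ∑ j, (T k i j + T i j k + T j k i) = 0 := by simp [h2]
  simp only [Finset.sum_add_distrib, h3, h4] at h5
  linarith

/-- The logarithm of the discriminant as a function of the eigenvalues. -/
def logDiscriminant (lam : Fin r → ℝ) : ℝ := ∑ i, ∑ j, Real.log (lam i - lam j)

theorem isOpen_injective : IsOpen {lam : Fin r → ℝ | Function.Injective lam} := by
  have : {lam : Fin r → ℝ | Function.Injective lam} =
      ⋂ i, ⋂ j, ⋂ _ : i ≠ j, {lam : Fin r → ℝ | lam i ≠ lam j} := by
    ext lam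
    simp only [Set.mem_ofPred_eq, Set.mem_iInter]
    exact ⟨fun h i j hij => h.ne hij, fun h i j hij => by by_contra hne; exact h i j hne hij⟩
  rw [this]
  exact isOpen_iInter_of_finite fun i => isOpen_iInter_of_finite fun j =>
    isOpen_iInter_of_finite fun _ => isOpen_ne_fun (continuous_apply i) (continuous_apply j)

theorem eigPartial_logDiscriminant {lam : Fin r → ℝ} (hlam : Function.Injective lam) (k : Fin r) :
    eigPartial k logDiscriminant lam = 2 * ∑ j, (lam k - lam j)⁻¹ := by
  have h : HasDerivAt (fun t : ℝ => logDiscriminant (lam + t • Pi.single k 1))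
      (∑ i, ∑ j, ((Pi.single k 1 : Fin r → ℝ) i - (Pi.single k 1 : Fin r → ℝ) j) /
        (lam i - lam j)) 0 := by
    unfold logDiscriminant
    refine HasDerivAt.fun_sum fun i _ => HasDerivAt.fun_sum fun j _ => ?_
    by_cases hij : i = j
    · subst hij
      simpa using hasDerivAt_const (0 : ℝ) (0 : ℝ)
    · have h1 := ((hasDerivAt_add_smul_single_apply lam k i).sub
        (hasDerivAt_add_smul_single_apply lam k j)).log (by
          simpa using sub_ne_zero.2 (hlam.ne hij))
      simpa using h1
  have h2 : ∑ i, ∑ j, ((Pi.single k 1 : Fin r → ℝ) i - (Pi.single k 1 : Fin r → ℝ) j) /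
        (lam i - lam j) = 2 * ∑ j, (lam k - lam j)⁻¹ := by
    simp only [sub_div, Finset.sum_sub_distrib]
    have e1 : ∑ i, ∑ j, (Pi.single k 1 : Fin r → ℝ) i / (lam i - lam j) =
        ∑ j, (lam k - lam j)⁻¹ := by
      rw [Finset.sum_eq_single k (by simp +contextual) (by simp)]
      simp
    have e2 : ∑ i, ∑ j, (Pi.single k 1 : Fin r → ℝ) j / (lam i - lam j) =
        -∑ j, (lam k - lam j)⁻¹ := by
      rw [Finset.sum_comm, Finset.sum_eq_single k (by simp +contextual) (by simp)]
      rw [← Finset.sum_neg_distrib]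
      refine Finset.sum_congr rfl fun j _ => ?_
      rw [← inv_neg, neg_sub]
      simp
    rw [e1, e2]; ring
  rw [← h2]
  exact h.deriv

theorem eigPartial_eigPartial_logDiscriminant {lam : Fin r → ℝ} (hlam : Function.Injective lam)
    (k : Fin r) : eigPartial k (eigPartial k logDiscriminant) lam =
      -2 * ∑ j, ((lam k - lam j) ^ 2)⁻¹ := by
  refine eigPartial_eigPartial (φ := fun y => 2 * ∑ j, (y k - y j)⁻¹) ?_ ?_
  · filter_upwards [isOpen_injective.mem_nhds hlam] with y hy
    exact eigPartial_logDiscriminant hy k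
  · have h : HasDerivAt (fun t : ℝ => ∑ j, ((lam + t • (Pi.single k 1 : Fin r → ℝ)) k -
        (lam + t • (Pi.single k 1 : Fin r → ℝ)) j)⁻¹) (∑ j, -((lam k - lam j) ^ 2)⁻¹) 0 := by
      refine HasDerivAt.fun_sum fun j _ => ?_
      by_cases hkj : k = j
      · subst hkj
        simpa using hasDerivAt_const (0 : ℝ) (0 : ℝ)
      · have h1 := ((hasDerivAt_add_smul_single_apply lam k k).sub
          (hasDerivAt_add_smul_single_apply lam k j)).inv (by
            simpa using sub_ne_zero.2 (hlam.ne hkj))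
        refine h1.congr_deriv ?_
        simp [Ne.symm hkj, neg_div]
    refine (h.const_mul 2).congr_deriv ?_
    rw [Finset.sum_neg_distrib]
    ring

/-- The terms without a factor `lam k` cancel by antisymmetry, and those with such a factor by
`sum_mul_sq_sum_inv_sub`. -/
theorem spectralLaplacian_logDiscriminant {lam : Fin r → ℝ} (hlam : Function.Injective lam) :
    spectralLaplacian q logDiscriminant lam = 0 := by
  rw [spectralLaplacian_eq_sum]
  simp only [eigPartial_logDiscriminant hlam, eigPartial_eigPartial_logDiscriminant hlam]
  have h1 := sum_sum_inv_sub lam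
  have h2 := sum_mul_sq_sum_inv_sub hlam
  calc _ = 4 * ((q : ℝ) - r + 1) * ∑ k, ∑ j, (lam k - lam j)⁻¹ +
        8 * (∑ k, lam k * (∑ j, (lam k - lam j)⁻¹) ^ 2 -
          ∑ k, lam k * ∑ j, ((lam k - lam j) ^ 2)⁻¹) := by
        rw [← Finset.sum_sub_distrib, Finset.mul_sum, Finset.mul_sum, ← Finset.sum_add_distrib]
        exact Finset.sum_congr rfl fun k _ => by ring
    _ = 0 := by rw [h1, h2]; ring

theorem contDiffAt_logDiscriminant {lam : Fin r → ℝ} (hlam : Function.Injective lam) :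
    ContDiffAt ℝ 2 logDiscriminant lam := by
  unfold logDiscriminant
  refine ContDiffAt.sum fun i _ => ContDiffAt.sum fun j _ => ?_
  by_cases hij : i = j
  · subst hij
    simpa using contDiffAt_const
  · exact ContDiffAt.log (by fun_prop) (sub_ne_zero.2 (hlam.ne hij))

/-- As `Real.log` is even and vanishes at 0, the sum over all ordered pairs is twice the sum over
$i<j$, matching the squared Vandermonde determinant. -/
theorem log_gramDiscriminant {Θ : Mat r q} (hΘ : StrictAnti (gramEigenvalues Θ)) :
    Real.log (gramDiscriminant Θ) = spectralPrior q logDiscriminant Θ := by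
  set Λ := gramEigenvalues Θ with hΛ
  have hne : ∀ i, ∀ j ∈ Finset.Ioi i, Λ j - Λ i ≠ 0 := fun i j hj =>
    sub_ne_zero.2 (hΘ.injective.ne (Finset.mem_Ioi.1 hj).ne')
  have hcompl : ∀ i, ∑ j, Real.log (Λ i - Λ j) = ∑ j ∈ ({i}ᶜ : Finset (Fin r)),
      Real.log (Λ i - Λ j) := fun i => by
    rw [← Finset.sum_add_sum_compl ({i} : Finset (Fin r))]
    simp
  rw [gramDiscriminant_eq, det_vandermonde, Real.log_pow,
    Real.log_prod fun i _ => Finset.prod_ne_zero_iff.2 (hne i)]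
  simp_rw [fun i => Real.log_prod (hne i)]
  rw [spectralPrior, logDiscriminant, ← hΛ]
  simp_rw [hcompl]
  have h := Finset.sum_sum_Ioi_add_eq_sum_sum_off_diag (fun i j => Real.log (Λ j - Λ i))
  rw [← h, Finset.mul_sum]
  refine Finset.sum_congr rfl fun i _ => ?_
  rw [Finset.mul_sum]
  refine Finset.sum_congr rfl fun j _ => ?_
  rw [← neg_sub (Λ j), Real.log_neg_eq_log]
  push_cast
  ring

theorem continuous_gramDiscriminant : Continuous (gramDiscriminant : Mat r q → ℝ) :=
  continuous_iff_continuousAt.2 fun Θ => (analyticAt_gramDiscriminant Θ).continuousAt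

theorem eventually_strictAnti_gramEigenvalues {Θ : Mat r q} (hΘ : StrictAnti (gramEigenvalues Θ)) :
    ∀ᶠ T in 𝓝 Θ, StrictAnti (gramEigenvalues T) := by
  filter_upwards [continuous_gramDiscriminant.continuousAt.eventually
    (eventually_gt_nhds (gramDiscriminant_pos_iff.2 hΘ))] with T hT
  exact gramDiscriminant_pos_iff.1 hT

/-- The logarithm of the discriminant is harmonic. -/
theorem hasCoordLaplacian_log_gramDiscriminant {Θ : Mat r q}
    (hΘ : StrictAnti (gramEigenvalues Θ)) :
    HasCoordLaplacian (fun T => Real.log (gramDiscriminant T)) Θ 0 := by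
  have h := hasCoordLaplacian_spectralPrior (q := q) hΘ
    (contDiffAt_logDiscriminant hΘ.injective).twiceDifferentiableAt
  rw [spectralLaplacian_logDiscriminant hΘ.injective] at h
  refine h.congr ?_
  filter_upwards [eventually_strictAnti_gramEigenvalues hΘ] with T hT
  exact log_gramDiscriminant hT

/-- The factor `q - r - 1` decides the method: `log det` is subharmonic for `q > r`, but has the
wrong sign for a barrier when `q = r`. -/
theorem spectralLaplacian_sum_log {lam : Fin r → ℝ} (hlam : ∀ i, 0 < lam i) :
    spectralLaplacian q (fun y : Fin r → ℝ => ∑ i, Real.log (y i)) lam =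
      2 * ((q : ℝ) - r - 1) * ∑ i, (lam i)⁻¹ := by
  have h1 : ∀ y : Fin r → ℝ, (∀ i, 0 < y i) → ∀ k,
      eigPartial k (fun y : Fin r → ℝ => ∑ i, Real.log (y i)) y = (y k)⁻¹ := by
    intro y hy k
    have h : HasDerivAt (fun t : ℝ => ∑ i, Real.log ((y + t • (Pi.single k 1 : Fin r → ℝ)) i))
        (∑ i, (Pi.single k 1 : Fin r → ℝ) i / y i) 0 := by
      refine HasDerivAt.fun_sum fun i _ => ?_
      simpa using (hasDerivAt_add_smul_single_apply y k i).log (by simpa using (hy i).ne')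
    rw [Finset.sum_eq_single k (by simp +contextual) (by simp)] at h
    simp only [Pi.single_eq_same, one_div] at h
    exact h.deriv
  have h2 : ∀ k, eigPartial k (eigPartial k fun y : Fin r → ℝ => ∑ i, Real.log (y i)) lam =
      -((lam k) ^ 2)⁻¹ := by
    intro k
    refine eigPartial_eigPartial (φ := fun y => (y k)⁻¹) ?_ ?_
    · have : ∀ᶠ y in 𝓝 lam, ∀ i, 0 < y i := Filter.eventually_all.2 fun i =>
        (continuous_apply i).continuousAt.eventually (eventually_gt_nhds (hlam i))
      exact this.mono fun y hy => h1 y hy k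
    · refine ((hasDerivAt_add_smul_single_apply lam k k).inv
        (by simpa using (hlam k).ne')).congr_deriv ?_
      simp [neg_div]
  rw [spectralLaplacian_eq_sum]
  simp only [h1 lam hlam, h2]
  have h3 := sum_sum_inv_sub lam
  calc _ = 2 * ((q : ℝ) - r - 1) * ∑ i, (lam i)⁻¹ + 4 * ∑ k, ∑ j, (lam k - lam j)⁻¹ := by
        rw [Finset.mul_sum, Finset.mul_sum, ← Finset.sum_add_distrib]
        refine Finset.sum_congr rfl fun k _ => ?_
        have := (hlam k).ne'
        field_simp
        ring
    _ = _ := by rw [h3]; ring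

theorem hasCoordLaplacian_log_det_gram {Θ : Mat r q} (hΘ : StrictAnti (gramEigenvalues Θ))
    (hpos : ∀ i, 0 < gramEigenvalues Θ i) :
    HasCoordLaplacian (fun T : Mat r q => Real.log (Matrix.of T * (Matrix.of T)ᵀ).det) Θ
      (2 * ((q : ℝ) - r - 1) * ∑ i, (gramEigenvalues Θ i)⁻¹) := by
  have hc : ContDiffAt ℝ 2 (fun y : Fin r → ℝ => ∑ i, Real.log (y i)) (gramEigenvalues Θ) :=
    ContDiffAt.sum fun i _ => ContDiffAt.log (by fun_prop) (hpos i).ne'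
  have h := hasCoordLaplacian_spectralPrior (q := q) hΘ hc.twiceDifferentiableAt
  rw [spectralLaplacian_sum_log hpos] at h
  refine h.congr ?_
  have hd : (Matrix.of Θ * (Matrix.of Θ)ᵀ).det ≠ 0 := by
    rw [det_gram]
    exact Finset.prod_ne_zero_iff.2 fun i _ => (hpos i).ne'
  filter_upwards [(analyticAt_det_gram Θ).continuousAt.eventually_ne hd] with T hT
  rw [det_gram, Real.log_prod fun i _ => (gramEigenvalues_pos_of_det_ne_zero hT i).ne']
  rfl

theorem hasCoordLaplacian_abs_det {Θ : Mat r r} (hdet : (Matrix.of Θ).det ≠ 0) :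
    HasCoordLaplacian (fun T : Mat r r => |(Matrix.of T).det|) Θ 0 := by
  have h1 : HasCoordLaplacian (fun T : Mat r r => (Matrix.of T).det) Θ 0 := by
    refine ⟨fun _ _ => 0, fun i j => ?_, by simp⟩
    simp only [det_add_smul_matUnit]
    refine .of_hasDerivAt (φ' := fun _ => (Matrix.of Θ).adjugate j i) (.of_forall fun s => ?_)
      (hasDerivAt_const _ _)
    simpa using ((hasDerivAt_id s).mul_const ((Matrix.of Θ).adjugate j i)).const_add
      (Matrix.of Θ).det
  have hc : ContinuousAt (fun T : Mat r r => (Matrix.of T).det) Θ :=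
    (Continuous.matrix_det continuous_id).continuousAt
  rcases hdet.lt_or_gt with h | h
  · have h2 := h1.const_mul (-1)
    rw [mul_zero] at h2
    refine h2.congr ?_
    filter_upwards [hc.eventually (eventually_lt_nhds h)] with T hT
    rw [abs_of_neg hT, neg_one_mul]
  · refine h1.congr ?_
    filter_upwards [hc.eventually (eventually_gt_nhds h)] with T hT
    rw [abs_of_pos hT]

/-- Only collisions go into `F`. At a singular matrix with simple spectrum some cofactor is nonzero,
so `|det|` has a genuine kink along that entry, while `hsq` makes the prior differentiable there. -/
theorem extMarginal_spectralPrior_le_of_square {g : (Fin r → ℝ) → ℝ}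
    (hg : ∀ lam : Fin r → ℝ, StrictAnti lam → (∀ i, 0 < lam i) → TwiceDifferentiableAt g lam)
    (hsq : ∀ Θ : Mat r r, StrictAnti (gramEigenvalues Θ) →
      DifferentiableAt ℝ (spectralPrior r g) Θ)
    (hnonneg : ∀ Θ : Mat r r, 0 ≤ spectralPrior r g Θ)
    (hD : ∀ lam : Fin r → ℝ, StrictAnti lam → (∀ i, 0 < lam i) → spectralLaplacian r g lam ≤ 0)
    {s : ℝ} (hs : 0 < s) :
    ∀ᵐ x : Mat r r, extMarginal (spectralPrior r g) s x ≤ ENNReal.ofReal (spectralPrior r g x) := by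
  refine extMarginal_le_of_superharmonic (F := gramDiscriminant)
    (k := fun T : Mat r r => |(Matrix.of T).det|) (Reg := {T | (Matrix.of T).det ≠ 0}) hnonneg
    continuous_gramDiscriminant (Continuous.matrix_det continuous_id).abs (fun _ => abs_nonneg _)
    (fun Θ hΘ => (hsq Θ (gramDiscriminant_pos_iff.1 hΘ)).continuousAt.continuousWithinAt)
    ?_ ?_ ?_ hs
  · intro Θ hF hdet
    have hΘ := gramDiscriminant_pos_iff.1 hF
    have hpos := gramEigenvalues_pos_of_det_ne_zero (Θ := Θ) (by
      rw [Matrix.det_mul, Matrix.det_transpose]; exact mul_ne_zero hdet hdet)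
    exact ⟨_, _, _, hasCoordLaplacian_spectralPrior hΘ (hg _ hΘ hpos),
      hasCoordLaplacian_log_gramDiscriminant hΘ, hasCoordLaplacian_abs_det hdet,
      hD _ hΘ hpos, le_rfl, le_rfl⟩
  · intro Θ hF hdet
    have hΘ := gramDiscriminant_pos_iff.1 hF
    have hdet : (Matrix.of Θ).det = 0 := not_not.1 hdet
    obtain ⟨j, i, hij⟩ : ∃ j i, (Matrix.of Θ).adjugate j i ≠ 0 := by
      by_contra! h
      exact adjugate_ne_zero_of_strictAnti hΘ hdet (by ext j i; exact h j i)
    have hlin : DifferentiableAt ℝ (fun t : ℝ => Θ + t • matUnit i j) 0 := by fun_prop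
    refine ⟨matUnit i j, |(Matrix.of Θ).adjugate j i|, abs_pos.2 hij, ?_, ?_, fun t => ?_⟩
    · exact DifferentiableAt.comp (0 : ℝ) (g := spectralPrior r g) (by simpa using hsq Θ hΘ) hlin
    · exact DifferentiableAt.comp (0 : ℝ) (g := gramDiscriminant)
        (analyticAt_gramDiscriminant _).differentiableAt hlin
    · rw [det_add_smul_matUnit, hdet, zero_add, abs_mul, mul_comm]
  · obtain ⟨Θ, hΘ, -⟩ := exists_gramEigenvalues_strictAnti_pos (le_refl r)
    filter_upwards [ae_ne_zero_of_analyticAt volume analyticAt_gramDiscriminant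
      (gramDiscriminant_pos_iff.2 hΘ).ne'] with T hT
    refine lt_of_le_of_ne ?_ hT.symm
    rw [gramDiscriminant_eq]
    exact sq_nonneg _

/-- Rank-deficient matrices have codimension `q - r + 1 ≥ 2`, so they join the collisions in the
zero set of `F`, and no kink is needed. -/
theorem extMarginal_spectralPrior_le_of_lt (hrq : r < q) {g : (Fin r → ℝ) → ℝ}
    (hg : ∀ lam : Fin r → ℝ, StrictAnti lam → (∀ i, 0 < lam i) → TwiceDifferentiableAt g lam)
    (hnonneg : ∀ Θ : Mat r q, 0 ≤ spectralPrior q g Θ)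
    (hD : ∀ lam : Fin r → ℝ, StrictAnti lam → (∀ i, 0 < lam i) → spectralLaplacian q g lam ≤ 0)
    {s : ℝ} (hs : 0 < s) :
    ∀ᵐ x : Mat r q, extMarginal (spectralPrior q g) s x ≤ ENNReal.ofReal (spectralPrior q g x) := by
  set F : Mat r q → ℝ := fun T => gramDiscriminant T * (Matrix.of T * (Matrix.of T)ᵀ).det with hF
  have hFan : ∀ T, AnalyticAt ℝ F T := fun T =>
    (analyticAt_gramDiscriminant T).mul (analyticAt_det_gram T)
  have hFc : Continuous F := continuous_iff_continuousAt.2 fun T => (hFan T).continuousAt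
  have hdetn : ∀ T : Mat r q, 0 ≤ (Matrix.of T * (Matrix.of T)ᵀ).det := fun T => by
    rw [det_gram]; exact Finset.prod_nonneg fun i _ => gramEigenvalues_nonneg T i
  have hDn : ∀ T : Mat r q, 0 ≤ gramDiscriminant T := fun T => by
    rw [gramDiscriminant_eq]; exact sq_nonneg _
  have hFpos : ∀ T, 0 < F T → StrictAnti (gramEigenvalues T) ∧ ∀ i, 0 < gramEigenvalues T i := by
    intro T hT
    have h1 := left_ne_zero_of_mul hT.ne'
    have h2 := right_ne_zero_of_mul hT.ne'
    exact ⟨gramDiscriminant_pos_iff.1 ((hDn T).lt_of_ne' h1),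
      gramEigenvalues_pos_of_det_ne_zero h2⟩
  refine extMarginal_le_of_superharmonic (F := F) (k := fun _ => 0) (Reg := Set.univ) hnonneg
    hFc continuous_const (fun _ => le_rfl) ?_ ?_ (fun x _ hx => absurd (Set.mem_univ x) hx) ?_ hs
  · intro Θ hΘ
    obtain ⟨h1, h2⟩ := hFpos Θ hΘ
    exact ((hg _ h1 h2).spectralPrior h1).1.self_of_nhds.continuousAt.continuousWithinAt
  · intro Θ hΘ _
    obtain ⟨h1, h2⟩ := hFpos Θ hΘ
    refine ⟨_, _, _, hasCoordLaplacian_spectralPrior h1 (hg _ h1 h2),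
      ((hasCoordLaplacian_log_gramDiscriminant h1).add
        (hasCoordLaplacian_log_det_gram h1 h2)).congr ?_, hasCoordLaplacian_const 0 Θ,
      hD _ h1 h2, ?_, le_rfl⟩
    · filter_upwards [hFc.continuousAt.eventually (eventually_gt_nhds hΘ)] with T hT
      exact Real.log_mul (left_ne_zero_of_mul hT.ne') (right_ne_zero_of_mul hT.ne')
    · have h3 : (r : ℝ) + 1 ≤ q := by exact_mod_cast hrq
      have h4 : 0 ≤ ∑ i, (gramEigenvalues Θ i)⁻¹ :=
        Finset.sum_nonneg fun i _ => inv_nonneg.2 (h2 i).le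
      have h5 : (0 : ℝ) ≤ 2 * ((q : ℝ) - r - 1) := by linarith
      simpa using mul_nonneg h5 h4
  · obtain ⟨Θ, hΘ, hpos⟩ := exists_gramEigenvalues_strictAnti_pos hrq.le
    have h0 : F Θ ≠ 0 := mul_ne_zero (gramDiscriminant_pos_iff.2 hΘ).ne' (by
      rw [det_gram]; exact Finset.prod_ne_zero_iff.2 fun i _ => (hpos i).ne')
    filter_upwards [ae_ne_zero_of_analyticAt volume hFan h0] with T hT
    exact (mul_nonneg (hDn T) (hdetn T)).lt_of_ne' hT

end Barriers

/-! ### The Laplacian formula and minimaxity combined. -/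

theorem mainTheorem5 (r q : ℕ) (hrq : r ≤ q) (vx vy : ℝ) (hvx : 0 < vx) (hvy : 0 < vy)
    (g : (Fin r → ℝ) → ℝ)
    (hg : ∀ lam : Fin r → ℝ, StrictAnti lam → (∀ i, 0 < lam i) → TwiceDifferentiableAt g lam)
    (hsq : q = r → ∀ Θ : Mat r q, StrictAnti (gramEigenvalues Θ) →
      DifferentiableAt ℝ (spectralPrior q g) Θ)
    (hnonneg : ∀ Θ : Mat r q, 0 ≤ spectralPrior q g Θ)
    (hne : ¬ spectralPrior q g =ᵐ[volume] 0)
    (hfin : ∀ X : Mat r q,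
      Integrable (fun Θ : Mat r q => normalDensity vx Θ X * spectralPrior q g Θ)) :
    (∀ Θ : Mat r q, StrictAnti (gramEigenvalues Θ) →
      TwiceDifferentiableAt g (gramEigenvalues Θ) →
        TwiceDifferentiableAt (spectralPrior q g) Θ ∧
        matLaplacian (spectralPrior q g) Θ = spectralLaplacian q g (gramEigenvalues Θ)) ∧
    ((∀ lam : Fin r → ℝ, StrictAnti lam → (∀ i, 0 < lam i) → spectralLaplacian q g lam ≤ 0) →
      IsKLMinimax vx vy (bayesPredictive (spectralPrior q g) vx vy)) := by
  refine ⟨fun Θ hΘ h => ⟨h.spectralPrior hΘ, matLaplacian_spectralPrior hΘ h⟩, fun hD => ?_⟩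
  refine isKLMinimax_bayesPredictive hnonneg hne hvx hvy hfin fun s hs => ?_
  rcases hrq.eq_or_lt with rfl | hlt
  · exact extMarginal_spectralPrior_le_of_square hg (hsq rfl) hnonneg hD hs
  · exact extMarginal_spectralPrior_le_of_lt hlt hg hnonneg hD hs

end
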